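/- **Setting.** Let $D\ge 0$, $T,N\ge 1$, $\mathcal X=\mathbb R^D$, $[N]_0=\{0,\dots,N\}$, and let $N(x;\mu,S)$ denote the Gaussian density. Quantities with time index $\le 0$ or $>T$ are ignored (e.g. $G_1(x_{0:1})=G_1(x_1)$, $Q'_{T+1}\equiv 1$). For $1\le t\le T$ let $$Q_t(x_{t-1:t})=M_t(x_t\mid x_{t-1})\,G_t(x_{t-1:t}),\qquad M_t(x_t\mid x_{t-1})=N(x_t;m_t(x_{t-1}),C_t(x_{t-1})),$$ where $m_t$, $C_t$ are measurable, $C_t(\cdot)$ is symmetric positive definite, and $G_t>0$ is differentiable. Assume $\int\prod_{t=1}^T Q_t(x_{t-1:t})\,dx_{1:T}<\infty$ and let $\pi_T(x_{1:T})\propto\prod_{t=1}^TQ_t(x_{t-1:t})$ be the corresponding probability distribution on $\mathcal X^T$. Let $\delta_t>0$, $\kappa\in\{0,1\}$, $\beta_t=2/(2+\delta_t)$, and let $\widetilde C_t(x_{t-1})\in\mathbb R^{D\times D}$ be arbitrary preconditioning matrices, measurable in $x_{t-1}$. Write $G_{1:T}(x_{1:T})=\prod_{t=1}^TG_t(x_{t-1:t})$,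 so that $\nabla_{x_t}\log G_{1:T}(x_{1:T})=\nabla_{x_t}[\log G_t(x_{t-1:t})+\log G_{t+1}(x_{t:t+1})]$. For a gradient $g$ put $q_t(u_t\mid x_{t-1},x_t;g)=N\bigl(u_t;\,x_t+\kappa\tfrac{\delta_t}2\widetilde C_t(x_{t-1})g,\ \tfrac{\delta_t}2C_t(x_{t-1})\bigr)$. **Proposals.** The *fully-adapted* proposal is $$M'_t(x_t\mid x_{t-1};u)=N\bigl(x_t;\beta_tu_t+(1-\beta_t)m_t(x_{t-1}),(1-\beta_t)C_t(x_{t-1})\bigr).$$ If $m_t(x)=F_tx+b_t$ and $C_t(x)=C_t$ for all $t$, the *twisted* proposal is the probability density in $x_t$ with $$M'_t(x_t\mid x_{t-1};u)\propto\int_{\mathcal X^{T-t}}\prod_{s=t}^TM_s(x_s\mid x_{s-1})\,N(u_s;x_s,\tfrac{\delta_s}2C_s)\,dx_{t+1:T}.$$ **Potentials.** Given a proposal $M'$, let $$G'_t(x_{t-1:t};u)=Q_t(x_{t-1:t})\frac{q_t(u_t\mid x_{t-1},x_t;\nabla_{x_t}\log G_t(x_{t-1:t}))}{M'_t(x_t\mid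 x_{t-1};u)},$$ $$G^{+}_t(x_{t-2:t};u)=G'_t(x_{t-1:t};u)\,\frac{q_{t-1}(u_{t-1}\mid x_{t-2},x_{t-1};\nabla_{x_{t-1}}\log G_{1:T}(x_{1:T}))}{q_{t-1}(u_{t-1}\mid x_{t-2},x_{t-1};\nabla_{x_{t-1}}\log G_{t-1}(x_{t-2:t-1}))}$$ (the last ratio being absent for $t=1$), and $Q'_t=M'_tG'_t$, $Q^+_t=M'_tG^+_t$. **Algorithms.** Given $x_{1:T}\in\mathcal X^T$: 0. independently for $t=1,\dots,T$ sample $u_t\sim q_t(\cdot\mid x_{t-1},x_t;g_t)$ with $g_t=\nabla_{x_t}\log G_t(x_{t-1:t})$ [for "+": $g_t=\nabla_{x_t}\log G_{1:T}(x_{1:T})$]; 1. for $t=1,\dots,T$: sample $k_t$ uniformly on $[N]_0$ and set $x_t^{k_t}=x_t$; if $t>1$, set $a_{t-1}^{k_t}=k_{t-1}$ and, for $n\ne k_t$, sample independently $a_{t-1}^n=i$ with probability $W_{t-1}^i$; for $n\neq k_t$ sample independently $x_t^n\sim M'_t(\cdot\mid x_{t-1}^{a_{t-1}^n};u)$; for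 all $n\in[N]_0$ let $w_t^n=G'_t(x_{t-1:t}^{(n)};u)$ [for "+": $w_t^n=G^+_t(x_{t-2:t}^{(n)};u)$], where $x_{1:t}^{(n)}=(x_{1:t-1}^{(a_{t-1}^n)},x_t^n)$ is the $n$th lineage, and $W_t^n=w_t^n/\sum_{m=0}^Nw_t^m$; 2. sample $i\in[N]_0\setminus\{k_T\}$ with probability $W_T^i/(1-W_T^{k_T})$; set $l_T=i$ with probability $1\wedge\frac{1-W_T^{k_T}}{1-W_T^i}$ and $l_T=k_T$ otherwise; 3. for $t=T-1,\dots,1$ sample $l_t=i\in[N]_0$ with probability proportional to $W_t^i\,Q'_{t+1}(x_t^i,x_{t+1}^{l_{t+1}};u)$ [for "+": $W_t^i\,Q^+_{t+1}(x_{t-1:t}^{(i)},x_{t+1}^{l_{t+1}};u)\,Q^+_{t+2}(x_t^i,x_{t+1}^{l_{t+1}},x_{t+2}^{l_{t+2}};u)$]; 4. return $\tilde x_{1:T}=(x_1^{l_1},\dots,x_T^{l_T})$. With the fully-adapted proposal these are the *Particle-aPCNL* and *Particle-aPCNL+* algorithms; with the twisted proposal they are the *twisted Particle-aPCNL* and *twisted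 Particle-aPCNL+* algorithms. **Proposition.** Sampling $\tilde x_{1:T}$ given $x_{1:T}$ via the Particle-aPCNL algorithm, or via the Particle-aPCNL+ algorithm, induces a Markov kernel on $\mathcal X^T$ which leaves $\pi_T$ invariant. If moreover $m_t(x)=F_tx+b_t$ and $C_t(x)=C_t$ for all $1\le t\le T$, then the same holds for the twisted Particle-aPCNL and the twisted Particle-aPCNL+ algorithms. -/

import Mathlib

open MeasureTheory ProbabilityTheory
open scoped ENNReal Matrix

noncomputable section

namespace ParticlePCNL

/-- The state space `ℝ^D` with its Euclidean structure and Lebesgue measure. -/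
abbrev State (D : ℕ) : Type := EuclideanSpace ℝ (Fin D)

/-- A path `x_{1:T}`; the coordinate `i : Fin T` is the state at time `i + 1`. -/
abbrev StatePath (D T : ℕ) : Type := Fin T → State D

/-- `ext x t` is `x_t` for `1 ≤ t ≤ T`.  Quantities with time index `t ≤ 0` or `t > T` are to be
ignored: they are given the dummy value `0`. -/
def ext {D T : ℕ} (x : StatePath D T) (t : ℕ) : State D :=
  if h : 1 ≤ t ∧ t ≤ T then x ⟨t - 1, by omega⟩ else 0

/-- The product of a `D × D` matrix and a state. -/
def act {D : ℕ} (A : Matrix (Fin D) (Fin D) ℝ) (x : State D) : State D :=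
  WithLp.toLp 2 (A *ᵥ x.ofLp)

/-! ### Gaussian and categorical distributions -/

/-- The Gaussian density `N(x; μ, S)` (for nonsingular `S`). -/
def gaussPDF {D : ℕ} (μ : State D) (S : Matrix (Fin D) (Fin D) ℝ) (x : State D) : ℝ≥0∞ :=
  ENNReal.ofReal ((Real.sqrt ((2 * Real.pi) ^ D * S.det))⁻¹ *
    Real.exp (-(1 / 2) * ((x - μ).ofLp ⬝ᵥ (S⁻¹ *ᵥ (x - μ).ofLp))))

/-- The distribution on the states with Lebesgue density `p`. -/
def lawOf {D : ℕ} (p : State D → ℝ≥0∞) : Measure (State D) :=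
  volume.withDensity p

/-- The distribution on `{0, …, N}` that gives mass `p i` to `i`. -/
def categorical {N : ℕ} (p : Fin (N + 1) → ℝ≥0∞) : Measure (Fin (N + 1)) :=
  ∑ i, p i • Measure.dirac i

/-- `v` divided by its sum. -/
def normalise {N : ℕ} (v : Fin (N + 1) → ℝ≥0∞) (i : Fin (N + 1)) : ℝ≥0∞ :=
  v i / ∑ j, v j

/-! ### Feynman-Kac models with conditionally Gaussian dynamics -/

/-- The data of the model: `M_t(x_t | x_{t-1}) = N(x_t; m_t(x_{t-1}), C_t(x_{t-1}))` and
`G_t(x_{t-1}, x_t)`, for `t = 1, …, T`.  At `t = 1` the argument `x_0` is always the dummy `0`. -/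
structure Model (D : ℕ) where
  m : ℕ → State D → State D
  C : ℕ → State D → Matrix (Fin D) (Fin D) ℝ
  G : ℕ → State D → State D → ℝ

namespace Model

variable {D : ℕ} (𝓜 : Model D)

/-- The mutation density `M_t(y | x)`. -/
def M (t : ℕ) (x y : State D) : ℝ≥0∞ := gaussPDF (𝓜.m t x) (𝓜.C t x) y

/-- `Q_t(x, y) = M_t(y | x) G_t(x, y)`. -/
def Q (t : ℕ) (x y : State D) : ℝ≥0∞ := 𝓜.M t x y * ENNReal.ofReal (𝓜.G t x y)

/-- `∏_{t=1}^T Q_t(x_{t-1:t})`. -/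
def gamma {T : ℕ} (x : StatePath D T) : ℝ≥0∞ :=
  ∏ t ∈ Finset.Icc 1 T, 𝓜.Q t (ext x (t - 1)) (ext x t)

/-- The joint smoothing distribution `π_T(x_{1:T}) ∝ ∏_{t=1}^T Q_t(x_{t-1:t})`. -/
def target (T : ℕ) : Measure (StatePath D T) :=
  (∫⁻ x : StatePath D T, 𝓜.gamma x)⁻¹ • (volume : Measure (StatePath D T)).withDensity 𝓜.gamma

/-- `∇_{x_t} log G_t(x_{t-1:t})` at `(x_{t-1}, x_t) = (x, y)`. -/
def filterGrad (t : ℕ) (x y : State D) : State D :=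
  gradient (fun y' => Real.log (𝓜.G t x y')) y

/-- `∇_{x_t} log G_{1:T}(x_{1:T})`, where `G_{1:T}(x_{1:T}) = ∏_{s=1}^T G_s(x_{s-1:s})`. -/
def smoothGrad {T : ℕ} (x : StatePath D T) (t : Fin T) : State D :=
  gradient (fun y => Real.log (∏ s ∈ Finset.Icc 1 T,
    𝓜.G s (ext (Function.update x t y) (s - 1)) (ext (Function.update x t y) s))) (x t)

/-- `∇_{x_t} log G_{1:T}(x_{1:T}) = ∇_{x_t} [log G_t(x_{t-1:t}) + log G_{t+1}(x_{t:t+1})]` for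
`t < T`, as a function of `(x_{t-1}, x_t, x_{t+1}) = (x, y, z)`. -/
def smoothGradLocal (t : ℕ) (x y z : State D) : State D :=
  gradient (fun y' => Real.log (𝓜.G t x y') + Real.log (𝓜.G (t + 1) y' z)) y

end Model

/-- The tuning parameters: step sizes `δ_t`, the switch `κ` of the gradient information and the
preconditioning matrices `C̃_t(x_{t-1})`. -/
structure Tuning (D : ℕ) where
  δ : ℕ → ℝ
  κ : ℝ
  pre : ℕ → State D → Matrix (Fin D) (Fin D) ℝ

section Ingredients

variable {D T : ℕ} (𝓜 : Model D) (θ : Tuning D)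

/-- The covariance `(δ_t / 2) C_t(x_{t-1})` of the auxiliary variable. -/
def auxCov (t : ℕ) (x : State D) : Matrix (Fin D) (Fin D) ℝ := (θ.δ t / 2) • 𝓜.C t x

/-- The centre `x_t + κ (δ_t / 2) C̃_t(x_{t-1}) g` of the auxiliary variable, for a gradient `g`;
`x = x_{t-1}` and `y = x_t`. -/
def auxMean (t : ℕ) (x y g : State D) : State D :=
  y + (θ.κ * (θ.δ t / 2)) • act (θ.pre t x) g

/-- The law of `u_{1:T}` given the reference path `x_{1:T}` when the gradients are `g_{1:T}`:
independently over `t`, `u_t ∼ N(x_t + κ (δ_t / 2) C̃_t(x_{t-1}) g_t, (δ_t / 2) C_t(x_{t-1}))`. -/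
def auxLaw (x : StatePath D T) (g : Fin T → State D) : Measure (StatePath D T) :=
  Measure.pi fun i : Fin T =>
    lawOf (gaussPDF (auxMean θ (i + 1) (ext x i) (ext x (i + 1)) (g i))
      (auxCov 𝓜 θ (i + 1) (ext x i)))

/-- A family of proposal densities `(t, x_{t-1}, x_t) ↦ M'_t(x_t | x_{t-1}; u_{1:T})`, given
`u_{1:T}`. -/
abbrev Proposal (D T : ℕ) : Type := StatePath D T → ℕ → State D → State D → ℝ≥0∞

/-- `β_t = 2 / (2 + δ_t)`. -/
def beta (t : ℕ) : ℝ := 2 / (2 + θ.δ t)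

/-- The fully-adapted proposal
`M'_t(y | x; u_t) = N(y; β_t u_t + (1 - β_t) m_t(x), (1 - β_t) C_t(x))`. -/
def adapted : Proposal D T := fun u t x y =>
  gaussPDF (beta θ t • ext u t + (1 - beta θ t) • 𝓜.m t x) ((1 - beta θ t) • 𝓜.C t x) y

/-- `futureLik u r t x` is the density of the pseudo observations `u_{t+1:t+r}` given `x_t = x`,
i.e. the integral over `x_{t+1:t+r}` of
`∏_{s=t+1}^{t+r} M_s(x_s | x_{s-1}) N(u_s; x_s, (δ_s / 2) C_s)`, as an iterated integral. -/
def futureLik (u : StatePath D T) : ℕ → ℕ → State D → ℝ≥0∞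
  | 0, _, _ => 1
  | r + 1, t, x => ∫⁻ y, 𝓜.M (t + 1) x y *
      gaussPDF y (auxCov 𝓜 θ (t + 1) x) (ext u (t + 1)) * futureLik u r (t + 1) y

/-- The fully twisted proposal `M'_t(y | x; u_{t:T}) = p(x_t = y | x_{t-1} = x, u_{t:T})`: the
normalised version of the integral over `x_{t+1:T}` of
`∏_{s=t}^T M_s(x_s | x_{s-1}) N(u_s; x_s, (δ_s / 2) C_s)`, as a density in `y = x_t`. -/
def twisted : Proposal D T := fun u t x y =>
  (𝓜.M t x y * gaussPDF y (auxCov 𝓜 θ t x) (ext u t) * futureLik 𝓜 θ u (T - t) t y) /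
    ∫⁻ y', 𝓜.M t x y' * gaussPDF y' (auxCov 𝓜 θ t x) (ext u t) * futureLik 𝓜 θ u (T - t) t y'

/-- The potential `G'_t(x_{t-1:t}; u)` at `(x_{t-1}, x_t) = (x, y)`:
`Q_t(x, y) N(u_t; y + κ (δ_t/2) C̃_t(x) ∇_y log G_t(x, y), (δ_t/2) C_t(x)) / M'_t(y | x; u)`. -/
def potential (M' : Proposal D T) (u : StatePath D T) (t : ℕ) (x y : State D) : ℝ≥0∞ :=
  𝓜.Q t x y *
    gaussPDF (auxMean θ t x y (𝓜.filterGrad t x y)) (auxCov 𝓜 θ t x) (ext u t) / M' u t x y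

/-- `Q'_t(x_{t-1:t}; u) = M'_t(x_t | x_{t-1}; u) G'_t(x_{t-1:t}; u)`. -/
def semigroup (M' : Proposal D T) (u : StatePath D T) (t : ℕ) (x y : State D) : ℝ≥0∞ :=
  M' u t x y * potential 𝓜 θ M' u t x y

/-- The smoothing-gradient potential `G'_t(x_{t-2:t}; u)` at `(x_{t-2}, x_{t-1}, x_t) = (w, x, y)`:
`G'_t(x_{t-1:t}; u)`, multiplied for `t ≥ 2` by the ratio of the density of `u_{t-1}` with the
smoothing gradient and the one with the filtering gradient. -/
def potentialPlus (M' : Proposal D T) (u : StatePath D T) (t : ℕ) (w x y : State D) : ℝ≥0∞ :=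
  potential 𝓜 θ M' u t x y *
    if 2 ≤ t then
      gaussPDF (auxMean θ (t - 1) w x (𝓜.smoothGradLocal (t - 1) w x y))
          (auxCov 𝓜 θ (t - 1) w) (ext u (t - 1)) /
        gaussPDF (auxMean θ (t - 1) w x (𝓜.filterGrad (t - 1) w x))
          (auxCov 𝓜 θ (t - 1) w) (ext u (t - 1))
    else 1

/-- `Q'_t(x_{t-2:t}; u) = M'_t(x_t | x_{t-1}; u) G'_t(x_{t-2:t}; u)`, and `1` for `t > T`. -/
def semigroupPlus (M' : Proposal D T) (u : StatePath D T) (t : ℕ) (w x y : State D) : ℝ≥0∞ :=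
  if t ≤ T then M' u t x y * potentialPlus 𝓜 θ M' u t w x y else 1

end Ingredients

/-! ### The conditional sequential Monte Carlo update -/

/-- The particle system: the particles `x t n = x_t^n`, the ancestor indices `a t n = a_t^n`
(so `a (t - 1) n` is the ancestor of particle `n` at time `t`), and the positions `k t = k_t` of
the reference path.  Entries that have not been generated are `0`. -/
abbrev System (D N : ℕ) : Type :=
  (ℕ → Fin (N + 1) → State D) × (ℕ → Fin (N + 1) → Fin (N + 1)) × (ℕ → Fin (N + 1))

namespace System

variable {D N : ℕ} (h : System D N)

/-- `x_t^n`. -/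
def x (t : ℕ) (n : Fin (N + 1)) : State D := h.1 t n

/-- `a_t^n`. -/
def a (t : ℕ) (n : Fin (N + 1)) : Fin (N + 1) := h.2.1 t n

/-- `k_t`. -/
def k (t : ℕ) : Fin (N + 1) := h.2.2 t

/-- The component of the lineage `x_{1:t}^{(n)}` at time `t - 1`. -/
def parent (t : ℕ) (n : Fin (N + 1)) : State D := h.x (t - 1) (h.a (t - 1) n)

/-- The component of the lineage `x_{1:t}^{(n)}` at time `t - 2`. -/
def grandparent (t : ℕ) (n : Fin (N + 1)) : State D := h.parent (t - 1) (h.a (t - 1) n)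

end System

/-- The ingredients of a CSMC update: `prop t x_{t-1}` is the proposal density at time `t`,
`wt t x_{t-2} x_{t-1} x_t` is the unnormalised weight, and `back t x_{t-1} x_t x_{t+1} x_{t+2}` is
the factor by which the weight at time `t` is multiplied in backward sampling. -/
structure Ingredients (D : ℕ) where
  prop : ℕ → State D → State D → ℝ≥0∞
  wt : ℕ → State D → State D → State D → ℝ≥0∞
  back : ℕ → State D → State D → State D → State D → ℝ≥0∞

section CSMC

variable {D N : ℕ} (I : Ingredients D)

/-- The normalised weights `W_t^n`. -/
def weight (h : System D N) (t : ℕ) : Fin (N + 1) → ℝ≥0∞ :=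
  normalise fun n => I.wt t (h.grandparent t n) (h.parent t n) (h.x t n)

/-- The ancestor indices `a_{t-1}^{0:N}`, given `k_t = k`: `a_{t-1}^k = k_{t-1}`, and the others
are independent draws from the weights at time `t - 1`.  At time `1` there are none. -/
def ancestorLaw (h : System D N) (t : ℕ) (k : Fin (N + 1)) :
    Measure (Fin (N + 1) → Fin (N + 1)) :=
  if 1 < t then
    Measure.pi fun n => if n = k then Measure.dirac (h.k (t - 1)) else
      categorical (weight I h (t - 1))
  else Measure.dirac 0

/-- The particles `x_t^{0:N}`, given `k_t = k` and `a_{t-1} = a`: `x_t^k` is the state `r` of the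
reference path, and the others are independent draws from their proposal densities. -/
def particleLaw (h : System D N) (t : ℕ) (r : State D) (k : Fin (N + 1))
    (a : Fin (N + 1) → Fin (N + 1)) : Measure (Fin (N + 1) → State D) :=
  Measure.pi fun n => if n = k then Measure.dirac r else lawOf (I.prop t (h.x (t - 1) (a n)))

/-- The `t`-th step of the forward pass, where `r` is the state of the reference path at `t`. -/
def forwardStep (r : State D) (t : ℕ) (h : System D N) : Measure (System D N) :=
  (categorical fun _ : Fin (N + 1) => ((N : ℝ≥0∞) + 1)⁻¹).bind fun k =>
    (ancestorLaw I h t k).bind fun a =>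
      (particleLaw I h t r k a).map fun y =>
        (Function.update h.1 t y, Function.update h.2.1 (t - 1) a, Function.update h.2.2 t k)

/-- The particle system after the time steps `1, …, t`. -/
def forward {T : ℕ} (x : StatePath D T) : ℕ → Measure (System D N)
  | 0 => Measure.dirac (0, 0, 0)
  | t + 1 => (forward x t).bind (forwardStep I (ext x (t + 1)) (t + 1))

/-- The forced-move law of `l_T`: propose `i ≠ k_T` with probability `W_T^i / (1 - W_T^{k_T})`,
accept it with probability `1 ∧ (1 - W_T^{k_T}) / (1 - W_T^i)`, and keep `k_T` otherwise. -/
def finalIndex (T : ℕ) (h : System D N) : Measure (Fin (N + 1)) :=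
  let W := weight I h T
  let k := h.k T
  (categorical fun i => if i = k then 0 else W i / (1 - W k)).bind fun i =>
    min 1 ((1 - W k) / (1 - W i)) • Measure.dirac i +
      (1 - min 1 ((1 - W k) / (1 - W i))) • Measure.dirac k

/-- The backward-sampling law of `l_t`, given the indices `l_{t+1}` and `l_{t+2}`. -/
def backwardStep (h : System D N) (t : ℕ) (l : ℕ → Fin (N + 1)) : Measure (Fin (N + 1)) :=
  categorical (normalise fun i => weight I h t i *
    I.back t (h.parent t i) (h.x t i) (h.x (t + 1) (l (t + 1))) (h.x (t + 2) (l (t + 2))))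

/-- The indices `l_T, l_{T-1}, …, l_{T-r}`. -/
def backward (T : ℕ) (h : System D N) : ℕ → Measure (ℕ → Fin (N + 1))
  | 0 => (finalIndex I T h).map fun i => Function.update 0 T i
  | r + 1 => (backward T h r).bind fun l =>
      (backwardStep I h (T - (r + 1)) l).map fun i => Function.update l (T - (r + 1)) i

/-- The law of the output `(x_1^{l_1}, …, x_T^{l_T})` of the CSMC update with `N` proposed
particles, given the reference path `x`. -/
def csmc (N : ℕ) {T : ℕ} (x : StatePath D T) : Measure (StatePath D T) :=
  (forward (N := N) I x T).bind fun h =>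
    (backward I T h (T - 1)).map fun l (i : Fin T) => h.x (i + 1) (l (i + 1))

end CSMC

/-! ### The algorithms -/

section Algorithms

variable {D : ℕ} (𝓜 : Model D) (θ : Tuning D) (N : ℕ) {T : ℕ}

/-- Given `u_{1:T}`: proposals `M'_t`, weights `G'_t(x_{t-1:t}; u)` and backward factors
`Q'_{t+1}(x_{t:t+1}; u)`. -/
def filterIngredients (M' : Proposal D T) (u : StatePath D T) : Ingredients D where
  prop := M' u
  wt t _ x y := potential 𝓜 θ M' u t x y
  back t _ y z _ := semigroup 𝓜 θ M' u (t + 1) y z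

/-- Given `u_{1:T}`: proposals `M'_t`, weights `G'_t(x_{t-2:t}; u)` and backward factors
`Q'_{t+1}(x_{t-1:t+1}; u) Q'_{t+2}(x_{t:t+2}; u)`. -/
def smoothIngredients (M' : Proposal D T) (u : StatePath D T) : Ingredients D where
  prop := M' u
  wt := potentialPlus 𝓜 θ M' u
  back t x y z z' :=
    semigroupPlus 𝓜 θ M' u (t + 1) x y z * semigroupPlus 𝓜 θ M' u (t + 2) y z z'

/-- Sample `u_{1:T}` around the reference path with filtering gradients, then run CSMC. -/
def filterUpdate (M' : Proposal D T) (x : StatePath D T) : Measure (StatePath D T) :=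
  (auxLaw 𝓜 θ x fun i => 𝓜.filterGrad (i + 1) (ext x i) (ext x (i + 1))).bind fun u =>
    csmc (filterIngredients 𝓜 θ M' u) N x

/-- Sample `u_{1:T}` around the reference path with smoothing gradients, then run CSMC. -/
def smoothUpdate (M' : Proposal D T) (x : StatePath D T) : Measure (StatePath D T) :=
  (auxLaw 𝓜 θ x (𝓜.smoothGrad x)).bind fun u =>
    csmc (smoothIngredients 𝓜 θ M' u) N x

/-- One iteration of the Particle-aPCNL algorithm started from `x`. -/
def aPCNL (x : StatePath D T) : Measure (StatePath D T) :=
  filterUpdate 𝓜 θ N (adapted 𝓜 θ) x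

/-- One iteration of the Particle-aPCNL+ algorithm started from `x`. -/
def aPCNLPlus (x : StatePath D T) : Measure (StatePath D T) :=
  smoothUpdate 𝓜 θ N (adapted 𝓜 θ) x

/-- One iteration of the twisted Particle-aPCNL algorithm started from `x`. -/
def twistedAPCNL (x : StatePath D T) : Measure (StatePath D T) :=
  filterUpdate 𝓜 θ N (twisted 𝓜 θ) x

/-- One iteration of the twisted Particle-aPCNL+ algorithm started from `x`. -/
def twistedAPCNLPlus (x : StatePath D T) : Measure (StatePath D T) :=
  smoothUpdate 𝓜 θ N (twisted 𝓜 θ) x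

end Algorithms

/-- Sampling from `law x` given `x` induces a Markov kernel, which leaves `π` invariant. -/
def InducesInvariantKernel {α : Type*} [MeasurableSpace α] (law : α → Measure α)
    (π : Measure α) : Prop :=
  ∃ P : Kernel α α, IsMarkovKernel P ∧ (∀ x, P x = law x) ∧ P.Invariant π

end ParticlePCNL

end

noncomputable section

/-! The algorithms are Gibbs samplers on an extended space. Give `(x, u)` the joint density `γ(x) ∏
q_t(u_t | x)`. Step 0 draws `u` from its conditional law given `x`. For fixed `u` the joint density,
as a function of `x`, equals `∏ M'_t G'_t` (respectively `∏ M'_t G⁺_t`), because the proposal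
cancels in the product and the correction ratios in `G⁺` telescope, turning filtering gradients into
smoothing gradients (`massProd_filter`, `massProd_smooth`). It therefore suffices that, for every
fixed `u`, the conditional SMC update preserves the measure with density `massProd`. Tonelli then
gives invariance of the marginal in `x` (`Regular.inducesInvariantKernel`). Only positivity,
measurability and normalisation of the proposals matter, so the adapted and twisted cases share one
proof.

The invariance of conditional SMC (`lintegral_massProd_csmc`) has three ingredients, all phrased
through `flow`, the unnormalised law of the particle system when the reference path is drawn from
`massProd`.

Position: given all particles and ancestors, the index `k_t` of the reference particle has law `W_t`
(`flow_position`). Integrating the new reference state against proposal times weight makes the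
reference particle an ordinary draw, tilted by its weight. Averaging `k_{t-1}` over `W_{t-1}` makes
its ancestor an ordinary draw too. What remains is an unconditional particle system tilted by the
weight of a uniformly chosen particle.

Final index: the forced move is reversible with respect to `W_T`, so it can be ignored after
averaging over the position.

Backward sampling: given later states `z`, the law of `k_t` is `W_t` reweighted by the target
factors that couple `x_t` with `z`, and the backward step redraws the index from this very law.
Hence the drawn particle may be replaced by the reference state, and induction downwards in time
returns the reference path itself (`lintegral_backwardMean`). Since weights may depend on `x_{t-2}`,
two factors couple `x_t`, together with its parent, to the future. -/

namespace ParticlePCNL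

/-! ### Gaussian densities: positivity, bounds, normalisation, measurability. -/

section Gaussian

variable {D : ℕ}

theorem gaussPDF_pos (μ x : State D) {S : Matrix (Fin D) (Fin D) ℝ} (hS : S.PosDef) :
    gaussPDF μ S x ≠ 0 := by
  have := hS.det_pos
  rw [gaussPDF, Ne, ENNReal.ofReal_eq_zero, not_le]
  positivity

theorem gaussPDF_ne_top (μ x : State D) (S : Matrix (Fin D) (Fin D) ℝ) :
    gaussPDF μ S x ≠ ∞ := ENNReal.ofReal_ne_top

theorem gaussPDF_le (μ x : State D) {S : Matrix (Fin D) (Fin D) ℝ} (hS : S.PosDef) :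
    gaussPDF μ S x ≤ ENNReal.ofReal (Real.sqrt ((2 * Real.pi) ^ D * S.det))⁻¹ := by
  refine ENNReal.ofReal_le_ofReal (mul_le_of_le_one_right (by positivity) ?_)
  have := hS.inv.posSemidef.dotProduct_mulVec_nonneg (x - μ).ofLp
  rw [Real.exp_le_one_iff]
  simp only [star_trivial] at this
  linarith

theorem lintegral_exp_neg_half_norm_sq :
    ∫⁻ x : State D, ENNReal.ofReal (Real.exp (-(1 / 2) * ‖x‖ ^ 2)) =
      ENNReal.ofReal (Real.sqrt ((2 * Real.pi) ^ D)) := by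
  have h := GaussianFourier.integral_rexp_neg_mul_sq_norm (V := State D) (b := 1 / 2) (by norm_num)
  have hpos : (0 : ℝ) < (Real.pi / (1 / 2)) ^ ((Module.finrank ℝ (State D) : ℝ) / 2) := by
    positivity
  rw [← ofReal_integral_eq_lintegral_ofReal, h]
  · congr 1
    rw [finrank_euclideanSpace_fin, Real.sqrt_eq_rpow, ← Real.rpow_natCast, ← Real.rpow_mul
      (by positivity)]
    ring_nf
  -- The Bochner integral of a non-integrable function is `0`, so a positive value of the integral
  -- already proves integrability.
  · by_contra hn
    rw [integral_undef hn] at h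
    exact hpos.ne h
  · exact Filter.Eventually.of_forall fun x => (Real.exp_pos _).le

/-- Factor `S⁻¹ = BᴴB`. The quadratic form becomes `‖B(x - μ)‖²`, translation removes `μ`, and the
linear substitution by `B` contributes `|det B|⁻¹ = √(det S)`, which cancels the normalising
constant. -/
theorem lintegral_gaussPDF (μ : State D) {S : Matrix (Fin D) (Fin D) ℝ} (hS : S.PosDef) :
    ∫⁻ x, gaussPDF μ S x = 1 := by
  obtain ⟨B, hB⟩ : ∃ B : Matrix (Fin D) (Fin D) ℝ, S⁻¹ = Bᴴ * B := by
    open scoped MatrixOrder Matrix.Norms.L2Operator in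
    exact CStarAlgebra.nonneg_iff_eq_star_mul_self.1 hS.inv.posSemidef.nonneg
  have hdet : S.det⁻¹ = B.det * B.det := by
    have := congrArg Matrix.det hB
    rwa [Matrix.det_mul, Matrix.det_conjTranspose, star_trivial, Matrix.det_nonsing_inv,
      Ring.inverse_eq_inv'] at this
  have hSpos := hS.det_pos
  have hBdet : B.det ≠ 0 := by
    intro h0
    rw [h0, mul_zero, inv_eq_zero] at hdet
    exact hSpos.ne' hdet
  let f : State D →ₗ[ℝ] State D := B.toLpLin 2 2
  have hf : LinearMap.det f = B.det := LinearMap.det_toLpLin 2 B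
  have hfmeas : Measurable f := (LinearMap.continuous_of_finiteDimensional f).measurable
  have hquad : ∀ x : State D, x.ofLp ⬝ᵥ (S⁻¹ *ᵥ x.ofLp) = ‖f x‖ ^ 2 := by
    intro x
    have : (f x).ofLp = B *ᵥ x.ofLp := rfl
    rw [EuclideanSpace.real_norm_sq_eq, hB, ← Matrix.mulVec_mulVec, Matrix.dotProduct_mulVec,
      Matrix.vecMul_conjTranspose, star_trivial, star_trivial, this]
    simp [dotProduct, sq]
  have hmeas : Measurable fun y : State D => ENNReal.ofReal (Real.exp (-(1 / 2) * ‖y‖ ^ 2)) := by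
    fun_prop
  have hcov : ∫⁻ x : State D, ENNReal.ofReal (Real.exp (-(1 / 2) * ‖f x‖ ^ 2)) =
      ENNReal.ofReal |B.det⁻¹| * ENNReal.ofReal (Real.sqrt ((2 * Real.pi) ^ D)) := by
    rw [← lintegral_exp_neg_half_norm_sq, ← hf, ← lintegral_map hmeas hfmeas,
      Measure.map_linearMap_addHaar_eq_smul_addHaar _ (by rwa [hf]), lintegral_smul_measure]
    rfl
  have hsub := lintegral_sub_right_eq_self (μ := (volume : Measure (State D)))
    (fun x => ENNReal.ofReal (Real.exp (-(1 / 2) * ‖f x‖ ^ 2))) μ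
  simp only [gaussPDF, hquad]
  simp_rw [ENNReal.ofReal_mul (inv_nonneg.2 (Real.sqrt_nonneg ((2 * Real.pi) ^ D * S.det)))]
  rw [lintegral_const_mul _ (by fun_prop), hsub, hcov, ← ENNReal.ofReal_mul (by positivity),
    ← ENNReal.ofReal_mul (by positivity), ENNReal.ofReal_eq_one]
  have h1 : Real.sqrt S.det = |B.det⁻¹| := by
    rw [← Real.sqrt_sq_eq_abs]
    congr 1
    rw [inv_pow, sq, ← hdet, inv_inv]
  rw [Real.sqrt_mul (by positivity), h1]
  have h2 : |B.det⁻¹| ≠ 0 := by simpa using hBdet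
  have h3 : Real.sqrt ((2 * Real.pi) ^ D) ≠ 0 := by positivity
  field_simp

/-- The inverse is the adjugate divided by the determinant, both continuous in the entries. The
convention `0⁻¹ = 0` covers singular matrices. -/
theorem measurable_inv_apply {α : Type*} [MeasurableSpace α]
    {S : α → Matrix (Fin D) (Fin D) ℝ} (hS : ∀ i j, Measurable fun a => S a i j) (i j : Fin D) :
    Measurable fun a => (S a)⁻¹ i j := by
  have h : Measurable fun a => (fun i j => S a i j : Fin D → Fin D → ℝ) :=
    measurable_pi_lambda _ fun i => measurable_pi_lambda _ fun j => hS i j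
  have hdet : Continuous fun A : Fin D → Fin D → ℝ => (Matrix.of A).det :=
    Continuous.matrix_det (A := fun A : Fin D → Fin D → ℝ => Matrix.of A) continuous_id
  have hadj : Continuous fun A : Fin D → Fin D → ℝ => (Matrix.of A).adjugate i j :=
    (Continuous.matrix_adjugate (A := fun A : Fin D → Fin D → ℝ => Matrix.of A)
      continuous_id).matrix_elem i j
  simp only [Matrix.inv_def, Ring.inverse_eq_inv', Matrix.smul_apply, smul_eq_mul]
  exact ((hdet.measurable.comp h).inv).mul (hadj.measurable.comp h)

theorem measurable_det {α : Type*} [MeasurableSpace α]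
    {S : α → Matrix (Fin D) (Fin D) ℝ} (hS : ∀ i j, Measurable fun a => S a i j) :
    Measurable fun a => (S a).det := by
  have h : Measurable fun a => (fun i j => S a i j : Fin D → Fin D → ℝ) :=
    measurable_pi_lambda _ fun i => measurable_pi_lambda _ fun j => hS i j
  have hdet : Continuous fun A : Fin D → Fin D → ℝ => (Matrix.of A).det :=
    Continuous.matrix_det (A := fun A : Fin D → Fin D → ℝ => Matrix.of A) continuous_id
  exact hdet.measurable.comp h

theorem measurable_state_apply {α : Type*} [MeasurableSpace α] {x : α → State D}
    (hx : Measurable x) (i : Fin D) : Measurable fun a => (x a).ofLp i :=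
  (EuclideanSpace.proj (𝕜 := ℝ) i).continuous.measurable.comp hx

theorem measurable_gaussPDF {α : Type*} [MeasurableSpace α] {μ x : α → State D}
    {S : α → Matrix (Fin D) (Fin D) ℝ} (hμ : Measurable μ) (hx : Measurable x)
    (hS : ∀ i j, Measurable fun a => S a i j) :
    Measurable fun a => gaussPDF (μ a) (S a) (x a) := by
  have hy := fun i => measurable_state_apply (hx.sub hμ) i
  have hI := fun i j => measurable_inv_apply hS i j
  simp only [Pi.sub_apply] at hy
  simp only [gaussPDF, dotProduct, Matrix.mulVec]
  refine ENNReal.measurable_ofReal.comp (Measurable.mul ?_ ?_)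
  · exact (Real.continuous_sqrt.measurable.comp ((measurable_det hS).const_mul _)).inv
  · refine Real.measurable_exp.comp (Measurable.const_mul ?_ _)
    exact Finset.measurable_sum _ fun i _ => (hy i).mul
      (Finset.measurable_sum _ fun j _ => (hI i j).mul (hy j))

theorem measurable_act {α : Type*} [MeasurableSpace α] {x : α → State D}
    {A : α → Matrix (Fin D) (Fin D) ℝ} (hA : ∀ i j, Measurable fun a => A a i j)
    (hx : Measurable x) : Measurable fun a => act (A a) (x a) := by
  refine (WithLp.measurable_toLp 2 (Fin D → ℝ)).comp (measurable_pi_lambda _ fun i => ?_)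
  change Measurable fun a => ∑ j, A a i j * (x a).ofLp j
  exact Finset.measurable_sum _ fun j _ => (hA i j).mul (measurable_state_apply hx j)

end Gaussian

/-! ### Parametrised integrals, binds and products of probability measures. -/

section Measures

variable {α β γ : Type*} [MeasurableSpace α] [MeasurableSpace β] [MeasurableSpace γ]

theorem measurable_lintegral_param {κ : α → Measure β} [∀ a, IsProbabilityMeasure (κ a)]
    {f : α → β → ℝ≥0∞} (hκ : Measurable κ) (hf : Measurable (Function.uncurry f)) :
    Measurable fun a => ∫⁻ b, f a b ∂κ a := by
  let K : Kernel α β := ⟨κ, hκ⟩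
  have : IsMarkovKernel K := ⟨fun a => inferInstanceAs (IsProbabilityMeasure (κ a))⟩
  exact Measurable.lintegral_kernel_prod_right' (κ := K) hf

theorem measurable_bind_param {κ : α → Measure β} [∀ a, IsProbabilityMeasure (κ a)]
    {f : α → β → Measure γ} (hκ : Measurable κ) (hf : Measurable (Function.uncurry f)) :
    Measurable fun a => (κ a).bind (f a) := by
  refine Measure.measurable_of_measurable_coe _ fun s hs => ?_
  have : ∀ a, (κ a).bind (f a) s = ∫⁻ b, f a b s ∂κ a := fun a =>
    Measure.bind_apply hs (hf.comp measurable_prodMk_left).aemeasurable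
  simp only [this]
  exact measurable_lintegral_param hκ ((Measure.measurable_coe hs).comp hf)

theorem measurable_map_param {κ : α → Measure β} [∀ a, IsProbabilityMeasure (κ a)]
    {f : α → β → γ} (hκ : Measurable κ) (hf : Measurable (Function.uncurry f)) :
    Measurable fun a => (κ a).map (f a) := by
  have : ∀ a, (κ a).map (f a) = (κ a).bind fun b => Measure.dirac (f a b) := fun a =>
    (Measure.bind_dirac_eq_map _ (hf.comp measurable_prodMk_left)).symm
  simp only [this]
  exact measurable_bind_param hκ (Measure.measurable_dirac.comp hf)

theorem isProbabilityMeasure_bind {μ : Measure α} [IsProbabilityMeasure μ] {f : α → Measure β}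
    (hf : Measurable f) (h : ∀ a, IsProbabilityMeasure (f a)) :
    IsProbabilityMeasure (μ.bind f) := by
  constructor
  rw [Measure.bind_apply MeasurableSet.univ hf.aemeasurable]
  simp

theorem ae_bind {μ : Measure α} {f : α → Measure β} {p : β → Prop} (hf : Measurable f)
    (hp : MeasurableSet {b | p b}) (h : ∀ᵐ a ∂μ, ∀ᵐ b ∂f a, p b) : ∀ᵐ b ∂μ.bind f, p b := by
  change (μ.bind f) {b | p b}ᶜ = 0
  rw [Measure.bind_apply hp.compl hf.aemeasurable]
  refine (lintegral_congr_ae ?_).trans lintegral_zero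
  filter_upwards [h] with a ha using ha

theorem measurable_apply_index {ι : Type*} [Countable ι] [MeasurableSpace ι]
    [MeasurableSingletonClass ι] {f : α → ι → β} {i : α → ι} (hf : Measurable f)
    (hi : Measurable i) : Measurable fun a => f a (i a) := by
  have : Measurable fun p : (ι → β) × ι => p.1 p.2 :=
    measurable_from_prod_countable_left fun j => measurable_pi_apply j
  exact this.comp (hf.prodMk hi)

theorem measurable_measure_pi {ι : Type*} [Fintype ι] {κ : ι → α → Measure β}
    [∀ i a, IsProbabilityMeasure (κ i a)] (hκ : ∀ i, Measurable (κ i)) :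
    Measurable fun a => Measure.pi fun i => κ i a := by
  refine Measurable.measure_of_isPiSystem_of_isProbabilityMeasure generateFrom_pi.symm
    isPiSystem_pi ?_
  rintro _ ⟨s, hs, rfl⟩
  simp only [Measure.pi_pi]
  exact Finset.measurable_prod _ fun i _ =>
    (Measure.measurable_coe (hs i (Set.mem_univ i))).comp (hκ i)

theorem bind_pi_update_dirac {ι : Type*} [Fintype ι] [DecidableEq ι] (μ : ι → Measure β)
    [∀ i, IsProbabilityMeasure (μ i)] (j : ι) :
    (μ j).bind (fun y => Measure.pi fun i => if i = j then Measure.dirac y else μ i) =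
      Measure.pi μ := by
  have hprob : ∀ i y, IsProbabilityMeasure (if i = j then Measure.dirac y else μ i) := by
    intro i y; split_ifs <;> infer_instance
  have hmeas : Measurable fun y : β =>
      Measure.pi fun i => if i = j then Measure.dirac y else μ i := by
    refine measurable_measure_pi (κ := fun i y => if i = j then Measure.dirac y else μ i)
      fun i => ?_
    split_ifs
    · exact Measure.measurable_dirac
    · exact measurable_const
  symm
  refine Measure.pi_eq fun s hs => ?_
  rw [Measure.bind_apply (MeasurableSet.univ_pi hs) hmeas.aemeasurable]
  simp only [Measure.pi_pi]
  have : ∀ y, ∏ i, (if i = j then Measure.dirac y else μ i) (s i) =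
      (s j).indicator (fun _ => ∏ i ∈ Finset.univ.erase j, μ i (s i)) y := by
    intro y
    rw [← Finset.mul_prod_erase _ _ (Finset.mem_univ j), if_pos rfl, Measure.dirac_apply' _ (hs j),
      Finset.prod_congr rfl fun i hi => by rw [if_neg (Finset.ne_of_mem_erase hi)]]
    by_cases hy : y ∈ s j <;> simp [hy]
  simp only [this]
  rw [lintegral_indicator_const (hs j), mul_comm,
    Finset.mul_prod_erase _ (fun i => μ i (s i)) (Finset.mem_univ j)]

/-- Pinning one coordinate of a product measure and then drawing the pinned value from that
coordinate's own law restores the product. This converts conditional particle steps, in which one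
ancestor or one particle is prescribed, into unconditional ones. -/
theorem lintegral_pi_mixture {ι : Type*} [Fintype ι] [DecidableEq ι] (μ : ι → Measure β)
    [∀ i, IsProbabilityMeasure (μ i)] (j : ι) {f : (ι → β) → ℝ≥0∞} (hf : Measurable f) :
    ∫⁻ y, ∫⁻ x, f x ∂(Measure.pi fun i => if i = j then Measure.dirac y else μ i) ∂μ j =
      ∫⁻ x, f x ∂Measure.pi μ := by
  have hprob : ∀ i y, IsProbabilityMeasure (if i = j then Measure.dirac y else μ i) := by
    intro i y; split_ifs <;> infer_instance
  have hmeas : Measurable fun y : β =>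
      Measure.pi fun i => if i = j then Measure.dirac y else μ i := by
    refine measurable_measure_pi (κ := fun i y => if i = j then Measure.dirac y else μ i)
      fun i => ?_
    split_ifs
    · exact Measure.measurable_dirac
    · exact measurable_const
  conv_rhs => rw [← bind_pi_update_dirac μ j]
  rw [Measure.lintegral_bind hmeas.aemeasurable hf.aemeasurable]

theorem ae_pi_dirac {ι : Type*} [Fintype ι] [DecidableEq ι] [MeasurableSingletonClass β]
    (μ : ι → Measure β) [∀ i, IsProbabilityMeasure (μ i)] (j : ι) (y : β) :
    ∀ᵐ x ∂(Measure.pi fun i => if i = j then Measure.dirac y else μ i), x j = y := by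
  have hprob : ∀ i, IsProbabilityMeasure (if i = j then Measure.dirac y else μ i) := by
    intro i; split_ifs <;> infer_instance
  have h := (measurePreserving_eval (fun i => if i = j then Measure.dirac y else μ i) j)
  have h2 : ∀ᵐ z ∂(if j = j then Measure.dirac y else μ j), z = y := by
    rw [if_pos rfl, ae_dirac_eq]; rfl
  exact h.quasiMeasurePreserving.ae h2

end Measures

/-! ### Categorical laws and normalised weights. -/

section Discrete

variable {N : ℕ} {α : Type*} [MeasurableSpace α]

theorem lintegral_categorical (p : Fin (N + 1) → ℝ≥0∞) (f : Fin (N + 1) → ℝ≥0∞) :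
    ∫⁻ i, f i ∂categorical p = ∑ i, p i * f i := by
  simp [categorical, lintegral_smul_measure]

theorem isProbabilityMeasure_categorical {p : Fin (N + 1) → ℝ≥0∞} (hp : ∑ i, p i = 1) :
    IsProbabilityMeasure (categorical p) := by
  constructor
  have := lintegral_categorical p 1
  simpa [hp] using this

theorem measurable_categorical {p : α → Fin (N + 1) → ℝ≥0∞}
    (hp : ∀ i, Measurable fun a => p a i) : Measurable fun a => categorical (p a) := by
  refine Measure.measurable_of_measurable_coe _ fun s hs => ?_
  simp only [categorical, Measure.coe_finsetSum, Finset.sum_apply, Measure.smul_apply,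
    smul_eq_mul]
  exact Finset.measurable_sum _ fun i _ => (hp i).mul_const _

theorem measurable_normalise {v : α → Fin (N + 1) → ℝ≥0∞} (hv : ∀ i, Measurable fun a => v a i)
    (i : Fin (N + 1)) : Measurable fun a => normalise (v a) i :=
  (hv i).div (Finset.measurable_sum _ fun j _ => hv j)

theorem sum_ne_zero_of_ne_zero {v : Fin (N + 1) → ℝ≥0∞} (h0 : ∀ i, v i ≠ 0) : ∑ i, v i ≠ 0 :=
  fun h => h0 0 (Finset.sum_eq_zero_iff.1 h 0 (Finset.mem_univ _))

theorem sum_ne_top_of_ne_top {v : Fin (N + 1) → ℝ≥0∞} (h : ∀ i, v i ≠ ∞) : ∑ i, v i ≠ ∞ :=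
  ENNReal.sum_ne_top.2 fun i _ => h i

theorem sum_normalise {v : Fin (N + 1) → ℝ≥0∞} (h0 : ∀ i, v i ≠ 0) (h : ∀ i, v i ≠ ∞) :
    ∑ i, normalise v i = 1 := by
  simp only [normalise, div_eq_mul_inv, ← Finset.sum_mul]
  exact ENNReal.mul_inv_cancel (sum_ne_zero_of_ne_zero h0) (sum_ne_top_of_ne_top h)

theorem normalise_ne_zero {v : Fin (N + 1) → ℝ≥0∞} (h0 : ∀ i, v i ≠ 0) (h : ∀ i, v i ≠ ∞)
    (i : Fin (N + 1)) : normalise v i ≠ 0 :=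
  ENNReal.div_ne_zero.2 ⟨h0 i, sum_ne_top_of_ne_top h⟩

/-- This is why backward factors need only be correct up to a factor that does not depend on the
drawn index. -/
theorem normalise_mul_const (v : Fin (N + 1) → ℝ≥0∞) {c : ℝ≥0∞} (hc0 : c ≠ 0) (hc : c ≠ ∞) :
    (normalise fun i => v i * c) = normalise v := by
  funext i
  simp only [normalise, ← Finset.sum_mul]
  rw [ENNReal.mul_div_mul_right _ _ hc0 hc]

/-- Drawing an index from the normalised weights does not change a weighted sum. -/
theorem sum_mul_sum_normalise {v : Fin (N + 1) → ℝ≥0∞} (h0 : ∀ i, v i ≠ 0) (h : ∀ i, v i ≠ ∞)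
    (φ : Fin (N + 1) → ℝ≥0∞) :
    ∑ k, v k * ∑ i, normalise v i * φ i = ∑ i, v i * φ i := by
  rw [← Finset.sum_mul, Finset.mul_sum]
  refine Finset.sum_congr rfl fun i _ => ?_
  rw [← mul_assoc, normalise, ENNReal.mul_div_cancel (sum_ne_zero_of_ne_zero h0)
    (sum_ne_top_of_ne_top h)]

end Discrete

/-! ### Laws with densities, and integration over paths one state at a time. -/

section Paths

variable {D : ℕ}

theorem isProbabilityMeasure_lawOf {p : State D → ℝ≥0∞} (hp : ∫⁻ y, p y = 1) :
    IsProbabilityMeasure (lawOf p) := by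
  constructor
  rw [lawOf, withDensity_apply _ MeasurableSet.univ, setLIntegral_univ, hp]

theorem measurable_lawOf {α : Type*} [MeasurableSpace α] {p : α → State D → ℝ≥0∞}
    (hp : Measurable (Function.uncurry p)) : Measurable fun a => lawOf (p a) := by
  refine Measure.measurable_of_measurable_coe _ fun s hs => ?_
  simp only [lawOf, withDensity_apply _ hs]
  exact Measurable.lintegral_prod_right' (ν := volume.restrict s) hp

theorem lintegral_lawOf {p : State D → ℝ≥0∞} (hp : Measurable p) {f : State D → ℝ≥0∞}
    (hf : Measurable f) : ∫⁻ y, f y ∂lawOf p = ∫⁻ y, p y * f y :=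
  lintegral_withDensity_eq_lintegral_mul _ hp hf

theorem measurable_ext (T t : ℕ) : Measurable fun x : StatePath D T => ext x t := by
  unfold ext
  split_ifs
  · exact measurable_pi_apply _
  · exact measurable_const

theorem ext_zero {T : ℕ} (x : StatePath D T) : ext x 0 = 0 := by simp [ext]

theorem ext_succ {T : ℕ} (x : StatePath D T) (i : Fin T) : ext x (i + 1) = x i := by
  simp [ext]

theorem lintegral_path_succ {E : Type*} [MeasureSpace E] [SigmaFinite (volume : Measure E)]
    (T : ℕ) {f : (Fin (T + 1) → E) → ℝ≥0∞} (hf : Measurable f) :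
    ∫⁻ x : Fin (T + 1) → E, f x =
      ∫⁻ x : Fin T → E, ∫⁻ z : E, f (Fin.snoc (α := fun _ => E) x z) := by
  let e := MeasurableEquiv.piFinSuccAbove (fun _ : Fin (T + 1) => E) (Fin.last T)
  have he := (volume_preserving_piFinSuccAbove (fun _ : Fin (T + 1) => E) (Fin.last T)).symm e
  have hs : ∀ p : E × (Fin T → E), e.symm p = Fin.snoc (α := fun _ => E) p.2 p.1 := fun p =>
    Fin.insertNth_last' _ _
  rw [← he.lintegral_comp hf, Measure.volume_eq_prod, lintegral_prod_symm]
  · simp only [hs]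
  · exact (hf.comp e.symm.measurable).aemeasurable

theorem ext_snoc {T : ℕ} (x : StatePath D T) (z : State D) :
    ext (T := T + 1) (Fin.snoc (α := fun _ => State D) x z) =
      Function.update (ext x) (T + 1) z := by
  funext t
  rcases eq_or_ne t (T + 1) with rfl | ht
  · have := ext_succ (T := T + 1) (Fin.snoc (α := fun _ => State D) x z) (Fin.last T)
    simpa using this
  · rw [Function.update_of_ne ht]
    by_cases h : 1 ≤ t ∧ t ≤ T
    · have h' : 1 ≤ t ∧ t ≤ T + 1 := ⟨h.1, by omega⟩
      rw [ext, ext, dif_pos h, dif_pos h']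
      have : (⟨t - 1, by omega⟩ : Fin (T + 1)) = Fin.castSucc ⟨t - 1, by omega⟩ := rfl
      rw [this, Fin.snoc_castSucc]
    · have h' : ¬ (1 ≤ t ∧ t ≤ T + 1) := by omega
      rw [ext, ext, dif_neg h, dif_neg h']

theorem lintegral_ext_succ (T : ℕ) {f : (ℕ → State D) → ℝ≥0∞} (hf : Measurable f) :
    ∫⁻ x : StatePath D (T + 1), f (ext x) =
      ∫⁻ x : StatePath D T, ∫⁻ z, f (Function.update (ext x) (T + 1) z) := by
  rw [lintegral_path_succ T (f := fun x : StatePath D (T + 1) => f (ext x))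
    (hf.comp (measurable_pi_lambda _ fun t => measurable_ext _ t))]
  simp only [ext_snoc]

theorem lintegral_fin_prod {E : Type*} [MeasureSpace E] [SigmaFinite (volume : Measure E)]
    (T : ℕ) {g : Fin T → E → ℝ≥0∞} (hg : ∀ i, Measurable (g i)) :
    ∫⁻ x : Fin T → E, ∏ i, g i (x i) = ∏ i, ∫⁻ z, g i z := by
  induction T with
  | zero => simp [volume_pi]
  | succ T ih =>
    have hm : ∀ (n : ℕ) (k : Fin n → E → ℝ≥0∞), (∀ i, Measurable (k i)) →
        Measurable fun x : Fin n → E => ∏ i, k i (x i) := fun n k hk =>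
      Finset.measurable_prod _ fun i _ => (hk i).comp (measurable_pi_apply i)
    rw [lintegral_path_succ T (hm _ g hg), Fin.prod_univ_castSucc, ← ih fun i => hg _,
      ← lintegral_mul_const _ (hm _ _ fun i => hg _)]
    refine lintegral_congr fun x => ?_
    simp only [Fin.prod_univ_castSucc, Fin.snoc_castSucc, Fin.snoc_last]
    rw [lintegral_const_mul _ (hg _)]

/-- Writing the law of the auxiliary variables as a density against Lebesgue measure on paths makes
the order of integration over `x` and `u` interchangeable. -/
theorem pi_lawOf {T : ℕ} {g : Fin T → State D → ℝ≥0∞} (hg : ∀ i, Measurable (g i))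
    (hg1 : ∀ i, ∫⁻ y, g i y = 1) :
    (Measure.pi fun i => lawOf (g i)) =
      (volume : Measure (StatePath D T)).withDensity fun u => ∏ i, g i (u i) := by
  have := fun i => isProbabilityMeasure_lawOf (hg1 i)
  refine Measure.pi_eq fun s hs => ?_
  rw [withDensity_apply _ (MeasurableSet.univ_pi hs), ← lintegral_indicator
    (MeasurableSet.univ_pi hs)]
  have : ∀ u : StatePath D T, (Set.univ.pi s).indicator (fun u => ∏ i, g i (u i)) u =
      ∏ i, (s i).indicator (g i) (u i) := by
    intro u
    by_cases h : u ∈ Set.univ.pi s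
    · rw [Set.indicator_of_mem h]
      exact Finset.prod_congr rfl fun i _ => (Set.indicator_of_mem (h i (Set.mem_univ i)) _).symm
    · rw [Set.indicator_of_notMem h]
      simp only [Set.mem_pi, Set.mem_univ, true_imp_iff, not_forall] at h
      obtain ⟨i, hi⟩ := h
      exact (Finset.prod_eq_zero (Finset.mem_univ i) (Set.indicator_of_notMem hi _)).symm
  simp only [this]
  rw [lintegral_fin_prod T fun i => (hg i).indicator (hs i)]
  exact Finset.prod_congr rfl fun i _ => by
    rw [lintegral_indicator (hs i), lawOf, withDensity_apply _ (hs i)]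

end Paths

/-! ### Regular ingredients, and the forward pass as a measurable family of probability measures. -/

/-- The product of proposal density and weight at time `t`; it is `1` for `t > T`. -/
def mass {D : ℕ} (I : Ingredients D) (T t : ℕ) (w x y : State D) : ℝ≥0∞ :=
  if t ≤ T then I.prop t x y * I.wt t w x y else 1

/-- A measurable family of ingredients for `T` time steps: the proposals are positive probability
densities, the weights are positive, and up to a constant the backward factors are the terms of
the target that involve the state at time `t` together with later ones. -/
structure Regular {Ω : Type*} [MeasurableSpace Ω] {D : ℕ} (I : Ω → Ingredients D) (T : ℕ) :
    Prop where
  measurable_prop : ∀ t ∈ Finset.Icc 1 T,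
    Measurable fun p : Ω × State D × State D => (I p.1).prop t p.2.1 p.2.2
  prop_ne_zero : ∀ t ∈ Finset.Icc 1 T, ∀ ω x y, (I ω).prop t x y ≠ 0
  prop_ne_top : ∀ t ∈ Finset.Icc 1 T, ∀ ω x y, (I ω).prop t x y ≠ ∞
  lintegral_prop : ∀ t ∈ Finset.Icc 1 T, ∀ ω x, ∫⁻ y, (I ω).prop t x y = 1
  measurable_wt : ∀ t ∈ Finset.Icc 1 T,
    Measurable fun p : Ω × State D × State D × State D => (I p.1).wt t p.2.1 p.2.2.1 p.2.2.2
  wt_ne_zero : ∀ t ∈ Finset.Icc 1 T, ∀ ω w x y, (I ω).wt t w x y ≠ 0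
  wt_ne_top : ∀ t ∈ Finset.Icc 1 T, ∀ ω w x y, (I ω).wt t w x y ≠ ∞
  measurable_back : ∀ t, 1 ≤ t → t < T →
    Measurable fun p : Ω × State D × State D × State D × State D =>
      (I p.1).back t p.2.1 p.2.2.1 p.2.2.2.1 p.2.2.2.2
  -- The constant is chosen before `x` and `y`: it may depend on the later states but not on the
  -- candidate `(x_{t-1}, x_t)`, so it cancels in the normalisation over candidates.
  back_factor : ∀ t, 1 ≤ t → t < T → ∀ ω z z', ∃ c : ℝ≥0∞, c ≠ 0 ∧ c ≠ ∞ ∧ ∀ x y,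
    (I ω).back t x y z z' * c = mass (I ω) T (t + 1) x y z * mass (I ω) T (t + 2) y z z'

section SystemMeasurability

variable {α : Type*} [MeasurableSpace α] {D N : ℕ} {h : α → System D N} {i : α → Fin (N + 1)}

theorem measurable_particle (hh : Measurable h) (hi : Measurable i) (t : ℕ) :
    Measurable fun a => (h a).x t (i a) :=
  measurable_apply_index ((measurable_pi_apply t).comp hh.fst) hi

theorem measurable_ancestor (hh : Measurable h) (hi : Measurable i) (t : ℕ) :
    Measurable fun a => (h a).a t (i a) :=
  measurable_apply_index ((measurable_pi_apply t).comp hh.snd.fst) hi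

theorem measurable_position (hh : Measurable h) (t : ℕ) : Measurable fun a => (h a).k t :=
  (measurable_pi_apply t).comp hh.snd.snd

theorem measurable_parent (hh : Measurable h) (hi : Measurable i) (t : ℕ) :
    Measurable fun a => (h a).parent t (i a) :=
  measurable_particle hh (measurable_ancestor hh hi _) _

theorem measurable_grandparent (hh : Measurable h) (hi : Measurable i) (t : ℕ) :
    Measurable fun a => (h a).grandparent t (i a) :=
  measurable_parent hh (measurable_ancestor hh hi _) _

end SystemMeasurability

theorem measurable_update_param {α β : Type*} [MeasurableSpace α] [MeasurableSpace β]
    {f : α → ℕ → β} {g : α → β} (hf : Measurable f) (hg : Measurable g) (t : ℕ) :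
    Measurable fun a => Function.update (f a) t (g a) := by
  refine measurable_pi_lambda _ fun s => ?_
  rcases eq_or_ne s t with rfl | hs
  · simpa using hg
  · simpa [Function.update_of_ne hs] using measurable_pi_iff.1 hf s

/-- The system after time step `t` has generated the particles `y`, with ancestors `a` and position
`k` of the reference path. -/
def System.extend {D N : ℕ} (h : System D N) (t : ℕ) (a : Fin (N + 1) → Fin (N + 1))
    (y : Fin (N + 1) → State D) (k : Fin (N + 1)) : System D N :=
  (Function.update h.1 t y, Function.update h.2.1 (t - 1) a, Function.update h.2.2 t k)

theorem measurable_extend {α : Type*} [MeasurableSpace α] {D N : ℕ} {h : α → System D N} (t : ℕ)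
    {a : α → Fin (N + 1) → Fin (N + 1)} {y : α → Fin (N + 1) → State D} {k : α → Fin (N + 1)}
    (hh : Measurable h) (ha : Measurable a) (hy : Measurable y) (hk : Measurable k) :
    Measurable fun c => (h c).extend t (a c) (y c) (k c) :=
  (measurable_update_param hh.fst hy t).prodMk
    ((measurable_update_param hh.snd.fst ha _).prodMk (measurable_update_param hh.snd.snd hk t))

namespace Regular

variable {Ω : Type*} [MeasurableSpace Ω] {D : ℕ} {I : Ω → Ingredients D} {T : ℕ}
  (hI : Regular I T) {α : Type*} [MeasurableSpace α] {N : ℕ}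
include hI

theorem mass_ne_zero (ω : Ω) {t : ℕ} (ht : 1 ≤ t) (w x y : State D) :
    mass (I ω) T t w x y ≠ 0 := by
  unfold mass
  split_ifs with h
  · have := Finset.mem_Icc.2 ⟨ht, h⟩
    exact mul_ne_zero (hI.prop_ne_zero t this ω x y) (hI.wt_ne_zero t this ω w x y)
  · exact one_ne_zero

theorem mass_ne_top (ω : Ω) {t : ℕ} (ht : 1 ≤ t) (w x y : State D) :
    mass (I ω) T t w x y ≠ ∞ := by
  unfold mass
  split_ifs with h
  · have := Finset.mem_Icc.2 ⟨ht, h⟩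
    exact ENNReal.mul_ne_top (hI.prop_ne_top t this ω x y) (hI.wt_ne_top t this ω w x y)
  · exact ENNReal.one_ne_top

theorem measurable_prop_comp {t : ℕ} (ht : t ∈ Finset.Icc 1 T) {v : α → Ω} {x y : α → State D}
    (hv : Measurable v) (hx : Measurable x) (hy : Measurable y) :
    Measurable fun a => (I (v a)).prop t (x a) (y a) :=
  (hI.measurable_prop t ht).comp (hv.prodMk (hx.prodMk hy))

theorem measurable_wt_comp {t : ℕ} (ht : t ∈ Finset.Icc 1 T) {v : α → Ω} {w x y : α → State D}
    (hv : Measurable v) (hw : Measurable w) (hx : Measurable x) (hy : Measurable y) :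
    Measurable fun a => (I (v a)).wt t (w a) (x a) (y a) :=
  (hI.measurable_wt t ht).comp (hv.prodMk (hw.prodMk (hx.prodMk hy)))

theorem measurable_mass_comp {t : ℕ} (ht : 1 ≤ t) {v : α → Ω} {w x y : α → State D}
    (hv : Measurable v) (hw : Measurable w) (hx : Measurable x) (hy : Measurable y) :
    Measurable fun a => mass (I (v a)) T t (w a) (x a) (y a) := by
  unfold mass
  split_ifs with h
  · have := Finset.mem_Icc.2 ⟨ht, h⟩
    exact (hI.measurable_prop_comp this hv hx hy).mul (hI.measurable_wt_comp this hv hw hx hy)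
  · exact measurable_const

theorem sum_weight {t : ℕ} (ht : t ∈ Finset.Icc 1 T) (ω : Ω) (h : System D N) :
    ∑ i, weight (I ω) h t i = 1 :=
  sum_normalise (fun _ => hI.wt_ne_zero t ht _ _ _ _) fun _ => hI.wt_ne_top t ht _ _ _ _

theorem weight_ne_zero {t : ℕ} (ht : t ∈ Finset.Icc 1 T) (ω : Ω) (h : System D N)
    (i : Fin (N + 1)) : weight (I ω) h t i ≠ 0 :=
  normalise_ne_zero (fun _ => hI.wt_ne_zero t ht _ _ _ _) (fun _ => hI.wt_ne_top t ht _ _ _ _) i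

theorem weight_ne_top {t : ℕ} (ht : t ∈ Finset.Icc 1 T) (ω : Ω) (h : System D N)
    (i : Fin (N + 1)) : weight (I ω) h t i ≠ ∞ := by
  refine ne_top_of_le_ne_top ENNReal.one_ne_top ((hI.sum_weight ht ω h).symm ▸ ?_)
  exact Finset.single_le_sum (f := weight (I ω) h t) (fun _ _ => zero_le) (Finset.mem_univ i)

theorem measurable_weight {t : ℕ} (ht : t ∈ Finset.Icc 1 T) {v : α → Ω} {h : α → System D N}
    (hv : Measurable v) (hh : Measurable h) (i : Fin (N + 1)) :
    Measurable fun a => weight (I (v a)) (h a) t i :=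
  measurable_normalise (fun _ => hI.measurable_wt_comp ht hv
    (measurable_grandparent hh measurable_const t) (measurable_parent hh measurable_const t)
    (measurable_particle hh measurable_const t)) i

theorem isProbabilityMeasure_ancestorLaw {t : ℕ} (ht : t ∈ Finset.Icc 1 T) (ω : Ω)
    (h : System D N) (k : Fin (N + 1)) :
    IsProbabilityMeasure (ancestorLaw (I ω) h t k) := by
  unfold ancestorLaw
  split_ifs with h1
  · have := isProbabilityMeasure_categorical
      (hI.sum_weight (t := t - 1) (by simp at ht ⊢; omega) ω h)
    have : ∀ n, IsProbabilityMeasure (if n = k then Measure.dirac (h.k (t - 1)) else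
        categorical (weight (I ω) h (t - 1))) := fun n => by split_ifs <;> infer_instance
    infer_instance
  · infer_instance

theorem measurable_ancestorLaw {t : ℕ} (ht : t ∈ Finset.Icc 1 T) {v : α → Ω}
    {h : α → System D N} (hv : Measurable v) (hh : Measurable h) (k : Fin (N + 1)) :
    Measurable fun a => ancestorLaw (I (v a)) (h a) t k := by
  unfold ancestorLaw
  split_ifs with h1
  · have ht' : t - 1 ∈ Finset.Icc 1 T := by simp at ht ⊢; omega
    have := fun a => isProbabilityMeasure_categorical (hI.sum_weight ht' (v a) (h a))
    have : ∀ n a, IsProbabilityMeasure (if n = k then Measure.dirac ((h a).k (t - 1)) else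
        categorical (weight (I (v a)) (h a) (t - 1))) := fun n a => by
      split_ifs <;> infer_instance
    refine measurable_measure_pi (κ := fun n a => if n = k then Measure.dirac ((h a).k (t - 1)) else
        categorical (weight (I (v a)) (h a) (t - 1))) fun n => ?_
    split_ifs
    · exact Measure.measurable_dirac.comp (measurable_position hh _)
    · exact measurable_categorical fun i => hI.measurable_weight ht' hv hh i
  · exact measurable_const

theorem isProbabilityMeasure_particleComponent {t : ℕ} (ht : t ∈ Finset.Icc 1 T) (ω : Ω)
    (x : State D) : IsProbabilityMeasure (lawOf ((I ω).prop t x)) :=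
  isProbabilityMeasure_lawOf (hI.lintegral_prop t ht ω _)

theorem isProbabilityMeasure_particleLaw {t : ℕ} (ht : t ∈ Finset.Icc 1 T) (ω : Ω)
    (h : System D N) (r : State D) (k : Fin (N + 1)) (a : Fin (N + 1) → Fin (N + 1)) :
    IsProbabilityMeasure (particleLaw (I ω) h t r k a) := by
  have := fun x => hI.isProbabilityMeasure_particleComponent ht ω x
  have : ∀ n, IsProbabilityMeasure (if n = k then Measure.dirac r else
      lawOf ((I ω).prop t (h.x (t - 1) (a n)))) := fun n => by split_ifs <;> infer_instance
  unfold particleLaw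
  infer_instance

theorem measurable_particleLaw {t : ℕ} (ht : t ∈ Finset.Icc 1 T) {v : α → Ω}
    {h : α → System D N} {r : α → State D} {b : α → Fin (N + 1) → Fin (N + 1)}
    (hv : Measurable v) (hh : Measurable h) (hr : Measurable r) (k : Fin (N + 1))
    (hb : Measurable b) :
    Measurable fun a => particleLaw (I (v a)) (h a) t (r a) k (b a) := by
  have := fun ω x => hI.isProbabilityMeasure_particleComponent ht ω x
  have : ∀ n a, IsProbabilityMeasure (if n = k then Measure.dirac (r a) else
      lawOf ((I (v a)).prop t ((h a).x (t - 1) (b a n)))) := fun n a => by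
    split_ifs <;> infer_instance
  refine measurable_measure_pi (κ := fun n a => if n = k then Measure.dirac (r a) else
      lawOf ((I (v a)).prop t ((h a).x (t - 1) (b a n)))) fun n => ?_
  split_ifs
  · exact Measure.measurable_dirac.comp hr
  · refine measurable_lawOf (hI.measurable_prop_comp ht (hv.comp measurable_fst) ?_ measurable_snd)
    exact (measurable_particle hh ((measurable_pi_apply n).comp hb) _).comp measurable_fst

omit hI in
theorem forwardStep_eq (J : Ingredients D) (r : State D) (t : ℕ) (h : System D N) :
    forwardStep J r t h = (categorical fun _ : Fin (N + 1) => ((N : ℝ≥0∞) + 1)⁻¹).bind fun k =>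
      (ancestorLaw J h t k).bind fun a =>
        (particleLaw J h t r k a).map fun y => h.extend t a y k := rfl

omit hI in
theorem sum_uniform : ∑ _ : Fin (N + 1), ((N : ℝ≥0∞) + 1)⁻¹ = 1 := by
  rw [Finset.sum_const, Finset.card_univ, Fintype.card_fin, nsmul_eq_mul, Nat.cast_succ]
  exact ENNReal.mul_inv_cancel (by simp) (by simp)

omit hI in
theorem lintegral_forwardStep (J : Ingredients D) (t : ℕ) (r : State D) (h : System D N)
    {g : System D N → ℝ≥0∞} (hg : Measurable g) :
    ∫⁻ s, g s ∂forwardStep J r t h = ∑ k, ((N : ℝ≥0∞) + 1)⁻¹ *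
      ∫⁻ a, ∫⁻ y, g (h.extend t a y k) ∂particleLaw J h t r k a ∂ancestorLaw J h t k := by
  rw [forwardStep_eq, Measure.lintegral_bind measurable_from_top.aemeasurable hg.aemeasurable,
    lintegral_categorical]
  refine Finset.sum_congr rfl fun k _ => congrArg _ ?_
  rw [Measure.lintegral_bind (measurable_of_countable _).aemeasurable hg.aemeasurable]
  refine lintegral_congr fun a => ?_
  exact lintegral_map hg (measurable_extend t measurable_const measurable_const measurable_id
    measurable_const)

theorem isProbabilityMeasure_forwardStep {t : ℕ} (ht : t ∈ Finset.Icc 1 T) (ω : Ω) (r : State D)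
    (h : System D N) : IsProbabilityMeasure (forwardStep (I ω) r t h) := by
  have := fun k => hI.isProbabilityMeasure_ancestorLaw ht ω h k
  have := fun k a => hI.isProbabilityMeasure_particleLaw ht ω h r k a
  constructor
  have := lintegral_forwardStep (I ω) t r h (g := fun _ => 1) measurable_const
  simpa [sum_uniform, -Finset.sum_const] using this

theorem measurable_forwardStep {t : ℕ} (ht : t ∈ Finset.Icc 1 T) {v : α → Ω}
    {h : α → System D N} {r : α → State D} (hv : Measurable v) (hh : Measurable h)
    (hr : Measurable r) : Measurable fun a => forwardStep (I (v a)) (r a) t (h a) := by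
  have := isProbabilityMeasure_categorical (sum_uniform (N := N))
  simp only [forwardStep_eq]
  refine measurable_bind_param measurable_const (measurable_from_prod_countable_left fun k => ?_)
  have := fun a => hI.isProbabilityMeasure_ancestorLaw ht (v a) (h a) k
  refine measurable_bind_param (hI.measurable_ancestorLaw ht hv hh k)
    (measurable_from_prod_countable_left fun b => ?_)
  have := fun a => hI.isProbabilityMeasure_particleLaw ht (v a) (h a) (r a) k b
  exact measurable_map_param (hI.measurable_particleLaw ht hv hh hr k measurable_const)
    (measurable_extend t (hh.comp measurable_fst) measurable_const measurable_snd measurable_const)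

end Regular

/-- The forward pass around a reference path that is indexed by all natural numbers. -/
def forwardNat {D N : ℕ} (J : Ingredients D) (y : ℕ → State D) : ℕ → Measure (System D N)
  | 0 => Measure.dirac (0, 0, 0)
  | t + 1 => (forwardNat J y t).bind (forwardStep J (y (t + 1)) (t + 1))

/-- Indexing the reference path by `ℕ` makes the first `t` steps comparable for reference paths of
different lengths, which the inductions on `t` require. -/
theorem forward_eq_forwardNat {D N T : ℕ} (J : Ingredients D) (x : StatePath D T) (t : ℕ) :
    forward (N := N) J x t = forwardNat J (ext x) t := by
  induction t with
  | zero => rfl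
  | succ t ih => rw [forward, forwardNat, ih]

theorem forwardNat_congr {D N : ℕ} (J : Ingredients D) {y y' : ℕ → State D} {t : ℕ}
    (h : ∀ s ≤ t, y s = y' s) : forwardNat (N := N) J y t = forwardNat J y' t := by
  induction t with
  | zero => rfl
  | succ t ih => rw [forwardNat, forwardNat, ih fun s hs => h s (by omega), h _ le_rfl]

namespace Regular

variable {Ω : Type*} [MeasurableSpace Ω] {D : ℕ} {I : Ω → Ingredients D} {T : ℕ}
  (hI : Regular I T) {α : Type*} [MeasurableSpace α] {N : ℕ}
include hI

theorem isProbabilityMeasure_forwardNat {t : ℕ} (ht : t ≤ T) (ω : Ω) (y : ℕ → State D) :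
    IsProbabilityMeasure (forwardNat (N := N) (I ω) y t) := by
  induction t with
  | zero => unfold forwardNat; infer_instance
  | succ t ih =>
    have := ih (by omega)
    have ht' : t + 1 ∈ Finset.Icc 1 T := by simp; omega
    exact isProbabilityMeasure_bind
      (hI.measurable_forwardStep ht' measurable_const measurable_id measurable_const)
      fun h => hI.isProbabilityMeasure_forwardStep ht' ω _ h

theorem measurable_forwardNat {t : ℕ} (ht : t ≤ T) {v : α → Ω} {y : α → ℕ → State D}
    (hv : Measurable v) (hy : Measurable y) :
    Measurable fun a => forwardNat (N := N) (I (v a)) (y a) t := by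
  induction t with
  | zero => exact measurable_const
  | succ t ih =>
    have := fun a => hI.isProbabilityMeasure_forwardNat (N := N) (t := t) (by omega) (v a) (y a)
    have ht' : t + 1 ∈ Finset.Icc 1 T := by simp; omega
    exact measurable_bind_param (ih (by omega))
      (hI.measurable_forwardStep ht' (hv.comp measurable_fst) measurable_snd
        (((measurable_pi_apply (t + 1)).comp hy).comp measurable_fst))

theorem lintegral_forwardNat_succ {t : ℕ} (ht : t + 1 ≤ T) (ω : Ω) (y : ℕ → State D)
    {g : System D N → ℝ≥0∞} (hg : Measurable g) :
    ∫⁻ h, g h ∂forwardNat (I ω) y (t + 1) =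
      ∫⁻ h, ∫⁻ s, g s ∂forwardStep (I ω) (y (t + 1)) (t + 1) h ∂forwardNat (I ω) y t :=
  Measure.lintegral_bind (hI.measurable_forwardStep (by simp; omega) measurable_const
    measurable_id measurable_const).aemeasurable hg.aemeasurable

theorem back_ne_zero {t : ℕ} (h1 : 1 ≤ t) (hT : t < T) (ω : Ω) (x y z z' : State D) :
    (I ω).back t x y z z' ≠ 0 := by
  obtain ⟨c, -, -, h⟩ := hI.back_factor t h1 hT ω z z'
  intro h0
  have := h x y
  rw [h0, zero_mul] at this
  exact mul_ne_zero (hI.mass_ne_zero ω (by omega) _ _ _) (hI.mass_ne_zero ω (by omega) _ _ _)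
    this.symm

theorem back_ne_top {t : ℕ} (h1 : 1 ≤ t) (hT : t < T) (ω : Ω) (x y z z' : State D) :
    (I ω).back t x y z z' ≠ ∞ := by
  obtain ⟨c, h0, -, h⟩ := hI.back_factor t h1 hT ω z z'
  intro htop
  have := h x y
  rw [htop, ENNReal.top_mul h0] at this
  exact ENNReal.mul_ne_top (hI.mass_ne_top ω (by omega) _ _ _)
    (hI.mass_ne_top ω (by omega) _ _ _) this.symm

theorem isProbabilityMeasure_backwardStep {t : ℕ} (h1 : 1 ≤ t) (hT : t < T) (ω : Ω)
    (h : System D N) (l : ℕ → Fin (N + 1)) :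
    IsProbabilityMeasure (backwardStep (I ω) h t l) := by
  have ht : t ∈ Finset.Icc 1 T := by simp; omega
  exact isProbabilityMeasure_categorical (sum_normalise
    (fun i => mul_ne_zero (hI.weight_ne_zero ht ω h i) (hI.back_ne_zero h1 hT ω _ _ _ _))
    fun i => ENNReal.mul_ne_top (hI.weight_ne_top ht ω h i) (hI.back_ne_top h1 hT ω _ _ _ _))

theorem measurable_backwardStep {t : ℕ} (h1 : 1 ≤ t) (hT : t < T) {v : α → Ω}
    {h : α → System D N} {l : α → ℕ → Fin (N + 1)} (hv : Measurable v) (hh : Measurable h)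
    (hl : Measurable l) : Measurable fun a => backwardStep (I (v a)) (h a) t (l a) := by
  have ht : t ∈ Finset.Icc 1 T := by simp; omega
  refine measurable_categorical fun i => measurable_normalise (fun j => ?_) i
  refine (hI.measurable_weight ht hv hh j).mul ?_
  exact (hI.measurable_back t h1 hT).comp (hv.prodMk ((measurable_parent hh measurable_const t).prodMk
    ((measurable_particle hh measurable_const t).prodMk
    ((measurable_particle hh ((measurable_pi_apply (t + 1)).comp hl) (t + 1)).prodMk
      (measurable_particle hh ((measurable_pi_apply (t + 2)).comp hl) (t + 2))))))

end Regular

theorem measurable_select {α : Type*} [MeasurableSpace α] {D N T : ℕ}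
    {h : α → System D N} {l : α → ℕ → Fin (N + 1)} (hh : Measurable h)
    (hl : Measurable l) :
    Measurable fun a => (fun i => (h a).x (i + 1) (l a (i + 1)) : StatePath D T) :=
  measurable_pi_lambda _ fun i =>
    measurable_particle hh ((measurable_pi_apply ((i : ℕ) + 1)).comp hl) _

/-! ### The forced move and its reversibility. -/

/-- The acceptance probability of the forced move from `k` to `i`. -/
def forcedAccept {N : ℕ} (W : Fin (N + 1) → ℝ≥0∞) (k i : Fin (N + 1)) : ℝ≥0∞ :=
  min 1 ((1 - W k) / (1 - W i))

/-- The proposal probabilities of the forced move from `k`. -/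
def forcedProposal {N : ℕ} (W : Fin (N + 1) → ℝ≥0∞) (k i : Fin (N + 1)) : ℝ≥0∞ :=
  if i = k then 0 else W i / (1 - W k)

/-- The forced-move transition from `k` for the probability vector `W`. -/
def forcedMove {N : ℕ} (W : Fin (N + 1) → ℝ≥0∞) (k : Fin (N + 1)) : Measure (Fin (N + 1)) :=
  (categorical (forcedProposal W k)).bind fun i =>
    forcedAccept W k i • Measure.dirac i + (1 - forcedAccept W k i) • Measure.dirac k

theorem finalIndex_eq {D N : ℕ} (J : Ingredients D) (T : ℕ) (h : System D N) :
    finalIndex J T h = forcedMove (weight J h T) (h.k T) := rfl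

section ForcedMove

variable {N : ℕ} {W : Fin (N + 1) → ℝ≥0∞}

theorem lintegral_forcedMove (W : Fin (N + 1) → ℝ≥0∞) (k : Fin (N + 1))
    (φ : Fin (N + 1) → ℝ≥0∞) :
    ∫⁻ i, φ i ∂forcedMove W k = ∑ i, forcedProposal W k i *
      (forcedAccept W k i * φ i + (1 - forcedAccept W k i) * φ k) := by
  rw [forcedMove, Measure.lintegral_bind measurable_from_top.aemeasurable
    measurable_from_top.aemeasurable, lintegral_categorical]
  simp [lintegral_add_measure, lintegral_smul_measure]

/-- With at least two particles, all of positive weight, no particle carries the whole mass, so the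
divisions by `1 - W k` are genuine. -/
theorem one_sub_ne_zero_of_sum_eq_one (hN : 1 ≤ N) (hW0 : ∀ i, W i ≠ 0) (hW : ∑ i, W i = 1)
    (k : Fin (N + 1)) : 1 - W k ≠ 0 := by
  rw [← hW, ← Finset.add_sum_erase _ _ (Finset.mem_univ k), Ne, tsub_eq_zero_iff_le, not_le]
  have hk : W k ≠ ∞ := ne_top_of_le_ne_top ENNReal.one_ne_top
    (hW ▸ Finset.single_le_sum (f := W) (fun _ _ => zero_le) (Finset.mem_univ k))
  refine ENNReal.lt_add_right hk fun h0 => ?_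
  obtain ⟨j, hj⟩ : ∃ j : Fin (N + 1), j ≠ k := by
    have : Nontrivial (Fin (N + 1)) := Fin.nontrivial_iff_two_le.2 (by omega)
    exact exists_ne k
  exact hW0 j (Finset.sum_eq_zero_iff.1 h0 j (Finset.mem_erase.2 ⟨hj, Finset.mem_univ j⟩))

theorem sum_forcedProposal (hN : 1 ≤ N) (hW0 : ∀ i, W i ≠ 0) (hW : ∑ i, W i = 1)
    (k : Fin (N + 1)) : ∑ i, forcedProposal W k i = 1 := by
  have hk : W k ≠ ∞ := ne_top_of_le_ne_top ENNReal.one_ne_top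
    (hW ▸ Finset.single_le_sum (f := W) (fun _ _ => zero_le) (Finset.mem_univ k))
  have h := Finset.add_sum_erase Finset.univ W (Finset.mem_univ k)
  have h1 : ∑ i ∈ Finset.univ.erase k, W i = 1 - W k := by
    rw [← hW, ← h, ENNReal.add_sub_cancel_left hk]
  rw [← Finset.add_sum_erase _ _ (Finset.mem_univ k)]
  have h2 : ∑ i ∈ Finset.univ.erase k, forcedProposal W k i =
      (∑ i ∈ Finset.univ.erase k, W i) / (1 - W k) := by
    rw [div_eq_mul_inv, Finset.sum_mul]
    exact Finset.sum_congr rfl fun i hi => by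
      rw [forcedProposal, if_neg (Finset.ne_of_mem_erase hi), div_eq_mul_inv]
  rw [h2, h1, forcedProposal, if_pos rfl, zero_add, ENNReal.div_self
    (one_sub_ne_zero_of_sum_eq_one hN hW0 hW k) (ENNReal.sub_ne_top ENNReal.one_ne_top)]

theorem isProbabilityMeasure_forcedMove (hN : 1 ≤ N) (hW0 : ∀ i, W i ≠ 0) (hW : ∑ i, W i = 1)
    (k : Fin (N + 1)) : IsProbabilityMeasure (forcedMove W k) := by
  constructor
  have := lintegral_forcedMove W k fun _ => 1
  simp only [mul_one, forcedAccept, add_tsub_cancel_of_le (min_le_left _ _),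
    sum_forcedProposal hN hW0 hW] at this
  simpa using this

/-- Detailed balance: for `i ≠ k` both sides equal `W_k W_i min((1 - W_k)⁻¹, (1 - W_i)⁻¹)`, which is
symmetric in `i` and `k`. -/
theorem forcedMove_flow_symm (hN : 1 ≤ N) (hW0 : ∀ i, W i ≠ 0) (hW : ∑ i, W i = 1)
    (k i : Fin (N + 1)) :
    W k * (forcedProposal W k i * forcedAccept W k i) =
      W i * (forcedProposal W i k * forcedAccept W i k) := by
  have key : ∀ a b : ℝ≥0∞, a ≠ 0 → a ≠ ∞ → a⁻¹ * min 1 (a / b) = min a⁻¹ b⁻¹ := by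
    intro a b ha ha'
    rw [mul_min_of_nonneg _ _ zero_le, mul_one, div_eq_mul_inv, ← mul_assoc,
      ENNReal.inv_mul_cancel ha ha', one_mul]
  have hne := one_sub_ne_zero_of_sum_eq_one hN hW0 hW
  have htop : ∀ i, 1 - W i ≠ ∞ := fun i => ENNReal.sub_ne_top ENNReal.one_ne_top
  rcases eq_or_ne i k with rfl | hik
  · rfl
  · rw [forcedProposal, forcedProposal, if_neg hik, if_neg hik.symm, forcedAccept, forcedAccept,
      div_eq_mul_inv (W i), div_eq_mul_inv (W k), mul_assoc, mul_assoc, key _ _ (hne k) (htop k),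
      key _ _ (hne i) (htop i), min_comm]
    ring

/-- By detailed balance the accepted flow into each index equals the accepted flow out of it.
Together with the rejected part it adds up to the full proposal mass, which is one. -/
theorem sum_mul_lintegral_forcedMove (hN : 1 ≤ N) (hW0 : ∀ i, W i ≠ 0) (hW : ∑ i, W i = 1)
    (φ : Fin (N + 1) → ℝ≥0∞) : ∑ k, W k * ∫⁻ i, φ i ∂forcedMove W k = ∑ k, W k * φ k := by
  simp only [lintegral_forcedMove, Finset.mul_sum, mul_add, Finset.sum_add_distrib]
  have h1 : ∑ k, ∑ i, W k * (forcedProposal W k i * (forcedAccept W k i * φ i)) =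
      ∑ k, ∑ i, W k * (forcedProposal W k i * (forcedAccept W k i * φ k)) := by
    rw [Finset.sum_comm]
    refine Finset.sum_congr rfl fun i _ => Finset.sum_congr rfl fun k _ => ?_
    rw [← mul_assoc (forcedProposal W k i), ← mul_assoc, forcedMove_flow_symm hN hW0 hW k i,
      mul_assoc, mul_assoc]
  rw [h1, ← Finset.sum_add_distrib]
  refine Finset.sum_congr rfl fun k _ => ?_
  rw [← Finset.sum_add_distrib]
  have : ∀ i, W k * (forcedProposal W k i * (forcedAccept W k i * φ k)) +
      W k * (forcedProposal W k i * ((1 - forcedAccept W k i) * φ k)) =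
      W k * φ k * forcedProposal W k i := by
    intro i
    rw [← mul_add, ← mul_add, ← add_mul, forcedAccept, add_tsub_cancel_of_le (min_le_left _ _),
      one_mul]
    ring
  simp only [this]
  rw [← Finset.mul_sum, sum_forcedProposal hN hW0 hW, mul_one]

theorem measurable_forcedMove {α : Type*} [MeasurableSpace α] {W : α → Fin (N + 1) → ℝ≥0∞}
    (hN : 1 ≤ N) (hW0 : ∀ a i, W a i ≠ 0) (hW1 : ∀ a, ∑ i, W a i = 1)
    (hW : ∀ i, Measurable fun a => W a i) (k : Fin (N + 1)) :
    Measurable fun a => forcedMove (W a) k := by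
  have := fun a => isProbabilityMeasure_categorical (sum_forcedProposal hN (hW0 a) (hW1 a) k)
  refine measurable_bind_param (measurable_categorical fun i => ?_)
    (measurable_from_prod_countable_left fun i => ?_)
  · unfold forcedProposal
    split_ifs
    · exact measurable_const
    · exact (hW i).div (measurable_const.sub (hW k))
  · have hA : Measurable fun a => forcedAccept (W a) k i :=
      measurable_const.min ((measurable_const.sub (hW k)).div (measurable_const.sub (hW i)))
    refine Measure.measurable_of_measurable_coe _ fun s hs => ?_
    change Measurable fun a => forcedAccept (W a) k i * Measure.dirac i s +
      (1 - forcedAccept (W a) k i) * Measure.dirac k s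
    exact (hA.mul_const _).add ((measurable_const.sub hA).mul_const _)

end ForcedMove

/-! ### The full conditional SMC update is a measurable family of probability measures. -/

namespace Regular

variable {Ω : Type*} [MeasurableSpace Ω] {D : ℕ} {I : Ω → Ingredients D} {T : ℕ}
  (hI : Regular I T) {α : Type*} [MeasurableSpace α] {N : ℕ}
include hI

theorem isProbabilityMeasure_finalIndex (hT : 1 ≤ T) (hN : 1 ≤ N) (ω : Ω) (h : System D N) :
    IsProbabilityMeasure (finalIndex (I ω) T h) := by
  have ht : T ∈ Finset.Icc 1 T := by simp; omega
  exact isProbabilityMeasure_forcedMove hN (hI.weight_ne_zero ht ω h) (hI.sum_weight ht ω h) _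

theorem measurable_finalIndex (hT : 1 ≤ T) (hN : 1 ≤ N) {v : α → Ω} {h : α → System D N}
    (hv : Measurable v) (hh : Measurable h) :
    Measurable fun a => finalIndex (I (v a)) T (h a) := by
  have ht : T ∈ Finset.Icc 1 T := by simp; omega
  simp only [finalIndex_eq]
  refine measurable_apply_index (f := fun a k => forcedMove (weight (I (v a)) (h a) T) k)
    (measurable_pi_lambda _ fun k => ?_) (measurable_position hh T)
  exact measurable_forcedMove hN (fun a => hI.weight_ne_zero ht _ _)
    (fun a => hI.sum_weight ht _ _) (fun i => hI.measurable_weight ht hv hh i) k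

theorem isProbabilityMeasure_backward (hT : 1 ≤ T) (hN : 1 ≤ N) (ω : Ω) (h : System D N) {r : ℕ}
    (hr : r < T) : IsProbabilityMeasure (backward (I ω) T h r) := by
  induction r with
  | zero =>
    have := hI.isProbabilityMeasure_finalIndex hT hN ω h
    exact Measure.isProbabilityMeasure_map measurable_from_top.aemeasurable
  | succ r ih =>
    have := ih (by omega)
    have hp := fun l => hI.isProbabilityMeasure_backwardStep (t := T - (r + 1)) (by omega)
      (by omega) ω h l
    refine isProbabilityMeasure_bind (measurable_map_param
      (hI.measurable_backwardStep (by omega) (by omega) measurable_const measurable_const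
        measurable_id) ?_)
      fun l => Measure.isProbabilityMeasure_map measurable_from_top.aemeasurable
    exact measurable_update_param measurable_fst measurable_snd _

theorem measurable_backward (hT : 1 ≤ T) (hN : 1 ≤ N) {r : ℕ} (hr : r < T) {v : α → Ω}
    {h : α → System D N} (hv : Measurable v) (hh : Measurable h) :
    Measurable fun a => backward (I (v a)) T (h a) r := by
  induction r with
  | zero =>
    have := fun a => hI.isProbabilityMeasure_finalIndex hT hN (v a) (h a)
    exact measurable_map_param (hI.measurable_finalIndex hT hN hv hh)
      (measurable_update_param measurable_const measurable_snd _)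
  | succ r ih =>
    have := fun a => hI.isProbabilityMeasure_backward hT hN (v a) (h a) (r := r) (by omega)
    have := fun a l => hI.isProbabilityMeasure_backwardStep (t := T - (r + 1)) (by omega)
      (by omega) (v a) (h a) l
    exact measurable_bind_param (ih (by omega)) (measurable_map_param
      (hI.measurable_backwardStep (by omega) (by omega) (hv.comp measurable_fst)
        (hh.comp measurable_fst) measurable_snd)
      (measurable_update_param (measurable_snd.comp measurable_fst) measurable_snd _))

theorem isProbabilityMeasure_csmc (hT : 1 ≤ T) (hN : 1 ≤ N) (ω : Ω) (x : StatePath D T) :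
    IsProbabilityMeasure (csmc (I ω) N x) := by
  rw [csmc, forward_eq_forwardNat]
  have := hI.isProbabilityMeasure_forwardNat (N := N) le_rfl ω (ext x)
  have := fun h : System D N => hI.isProbabilityMeasure_backward hT hN ω h (r := T - 1) (by omega)
  refine isProbabilityMeasure_bind (measurable_map_param
    (hI.measurable_backward hT hN (by omega) measurable_const measurable_id)
    (measurable_select measurable_fst measurable_snd))
    fun h => Measure.isProbabilityMeasure_map
      (measurable_select measurable_const measurable_id).aemeasurable

theorem measurable_csmc (hT : 1 ≤ T) (hN : 1 ≤ N) {v : α → Ω} {x : α → StatePath D T}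
    (hv : Measurable v) (hx : Measurable x) :
    Measurable fun a => csmc (I (v a)) N (x a) := by
  simp only [csmc, forward_eq_forwardNat]
  have := fun a => hI.isProbabilityMeasure_forwardNat (N := N) le_rfl (v a) (ext (x a))
  have := fun a (h : System D N) => hI.isProbabilityMeasure_backward hT hN (v a) h
    (r := T - 1) (by omega)
  refine measurable_bind_param (hI.measurable_forwardNat le_rfl hv
    (measurable_pi_lambda _ fun t => (measurable_ext T t).comp hx)) ?_
  exact measurable_map_param (hI.measurable_backward hT hN (by omega) (hv.comp measurable_fst)
    measurable_snd) (measurable_select (measurable_snd.comp measurable_fst) measurable_snd)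

theorem lintegral_csmc (hT : 1 ≤ T) (hN : 1 ≤ N) (ω : Ω) (x : StatePath D T)
    {f : StatePath D T → ℝ≥0∞} (hf : Measurable f) :
    ∫⁻ y, f y ∂csmc (I ω) N x = ∫⁻ h : System D N, ∫⁻ l, f (fun i => h.x (i + 1) (l (i + 1)))
      ∂backward (I ω) T h (T - 1) ∂forwardNat (I ω) (ext x) T := by
  have := fun h : System D N => hI.isProbabilityMeasure_backward hT hN ω h (r := T - 1) (by omega)
  have hm : Measurable fun h : System D N => (backward (I ω) T h (T - 1)).map
      fun l => (fun i => h.x (i + 1) (l (i + 1)) : StatePath D T) := measurable_map_param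
    (hI.measurable_backward hT hN (by omega) measurable_const measurable_id)
    (measurable_select measurable_fst measurable_snd)
  rw [csmc, forward_eq_forwardNat, Measure.lintegral_bind hm.aemeasurable hf.aemeasurable]
  exact lintegral_congr fun h => lintegral_map hf
    (measurable_select measurable_const measurable_id)

end Regular

/-! ### The joint law of the particle system and the position of the reference path. -/

/-- The unnormalised density of the states up to time `t`. -/
def massProd {D : ℕ} (J : Ingredients D) (T t : ℕ) (y : ℕ → State D) : ℝ≥0∞ :=
  ∏ s ∈ Finset.Icc 1 t, mass J T s (y (s - 1 - 1)) (y (s - 1)) (y s)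

theorem massProd_update {D : ℕ} (J : Ingredients D) (T t : ℕ) (y : ℕ → State D) (z : State D) :
    massProd J T (t + 1) (Function.update y (t + 1) z) =
      massProd J T t y * mass J T (t + 1) (y (t - 1)) (y t) z := by
  rw [massProd, massProd, Finset.prod_Icc_succ_top (by omega)]
  congr 1
  · refine Finset.prod_congr rfl fun s hs => ?_
    have := (Finset.mem_Icc.1 hs).2
    rw [Function.update_of_ne (by omega), Function.update_of_ne (by omega),
      Function.update_of_ne (by omega)]
  · rw [Function.update_self, Function.update_of_ne (by omega), Function.update_of_ne (by omega)]
    rfl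

/-- The particles and ancestors of a system, without the positions of the reference path. -/
def System.core {D N : ℕ} (h : System D N) : System D N := (h.1, h.2.1, 0)

theorem measurable_core {D N : ℕ} : Measurable (System.core : System D N → System D N) :=
  measurable_fst.prodMk (measurable_snd.fst.prodMk measurable_const)

/-- The integral of `ψ` with respect to the law of the particle system after time `t` when the
reference path has density `massProd J T t`. -/
def flow {D N : ℕ} (J : Ingredients D) (T t : ℕ) (ψ : System D N → ℝ≥0∞) : ℝ≥0∞ :=
  ∫⁻ x : StatePath D t, massProd J T t (ext x) * ∫⁻ h, ψ h ∂forwardNat J (ext x) t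

theorem measurable_ext' {D : ℕ} (T : ℕ) : Measurable fun x : StatePath D T => ext x :=
  measurable_pi_lambda _ fun t => measurable_ext T t

section

variable {D N : ℕ} (h : System D N) (t : ℕ) (a : Fin (N + 1) → Fin (N + 1))
  (y : Fin (N + 1) → State D) (k n : Fin (N + 1))

theorem System.extend_x_self : (h.extend t a y k).x t n = y n := by
  simp [System.extend, System.x]

theorem System.extend_k_self : (h.extend t a y k).k t = k := by
  simp [System.extend, System.k]

theorem System.extend_x_of_ne {s : ℕ} (hs : s ≠ t) : (h.extend t a y k).x s n = h.x s n := by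
  simp [System.extend, System.x, Function.update_of_ne hs]

theorem System.extend_a_of_ne {s : ℕ} (hs : s ≠ t - 1) : (h.extend t a y k).a s n = h.a s n := by
  simp [System.extend, System.a, Function.update_of_ne hs]

theorem System.extend_parent_self : (h.extend (t + 1) a y k).parent (t + 1) n = h.x t (a n) := by
  simp [System.extend, System.x, System.parent, System.a]

theorem System.extend_grandparent_self (ht : 1 ≤ t) :
    (h.extend (t + 1) a y k).grandparent (t + 1) n = h.parent t (a n) := by
  -- At `t = 0` truncated subtraction would identify row `t - 1` with the ancestor row just written,
  -- and the grandparent would be read from the wrong row.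
  have h1 : t - 1 ≠ t := by omega
  simp [System.extend, System.x, System.parent, System.grandparent, System.a,
    Function.update_of_ne h1]

end

namespace Regular

variable {Ω : Type*} [MeasurableSpace Ω] {D : ℕ} {I : Ω → Ingredients D} {T : ℕ}
  (hI : Regular I T) {α : Type*} [MeasurableSpace α] {N : ℕ}
include hI

theorem measurable_massProd (ω : Ω) (t : ℕ) :
    Measurable fun y : ℕ → State D => massProd (I ω) T t y :=
  Finset.measurable_prod _ fun _ hs => hI.measurable_mass_comp (v := fun _ => ω)
    (Finset.mem_Icc.1 hs).1 measurable_const (measurable_pi_apply _) (measurable_pi_apply _)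
    (measurable_pi_apply _)

theorem ae_ancestorLaw {t : ℕ} (h1 : 1 ≤ t) (ht : t ≤ T) (ω : Ω) (h : System D N)
    (k : Fin (N + 1)) : ∀ᵐ a ∂ancestorLaw (I ω) h (t + 1) k, a k = h.k t := by
  have := isProbabilityMeasure_categorical
    (hI.sum_weight (Finset.mem_Icc.2 ⟨h1, ht⟩) ω h)
  rw [ancestorLaw, if_pos (by omega)]
  exact ae_pi_dirac (fun _ => categorical (weight (I ω) h t)) k (h.k t)

theorem ae_particleLaw {t : ℕ} (ht : t ∈ Finset.Icc 1 T) (ω : Ω) (h : System D N) (r : State D)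
    (k : Fin (N + 1)) (a : Fin (N + 1) → Fin (N + 1)) :
    ∀ᵐ y ∂particleLaw (I ω) h t r k a, y k = r := by
  have := fun n => hI.isProbabilityMeasure_particleComponent ht ω (h.x (t - 1) (a n))
  exact ae_pi_dirac (fun n => lawOf ((I ω).prop t (h.x (t - 1) (a n)))) k r

theorem ae_forwardStep {t : ℕ} (ht : t + 1 ≤ T) (ω : Ω) (h : System D N) (r q : State D)
    (hq : ∀ k, ∀ᵐ a ∂ancestorLaw (I ω) h (t + 1) k, h.x t (a k) = q) :
    ∀ᵐ s ∂forwardStep (I ω) r (t + 1) h,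
      s.x (t + 1) (s.k (t + 1)) = r ∧ s.parent (t + 1) (s.k (t + 1)) = q := by
  have ht' : t + 1 ∈ Finset.Icc 1 T := by simp; omega
  have hset : MeasurableSet {s : System D N |
      s.x (t + 1) (s.k (t + 1)) = r ∧ s.parent (t + 1) (s.k (t + 1)) = q} :=
    (measurableSet_eq_fun (measurable_particle measurable_id (measurable_position measurable_id _)
      _) measurable_const).inter (measurableSet_eq_fun (measurable_parent measurable_id
      (measurable_position measurable_id _) _) measurable_const)
  rw [forwardStep_eq]
  refine ae_bind measurable_from_top hset (Filter.Eventually.of_forall fun k => ?_)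
  refine ae_bind (measurable_of_countable _) hset ?_
  filter_upwards [hq k] with a ha
  refine (ae_map_iff (measurable_extend _ measurable_const measurable_const measurable_id
    measurable_const).aemeasurable hset).2 ?_
  filter_upwards [hI.ae_particleLaw ht' ω h r k a] with y hy
  rw [System.extend_k_self]
  exact ⟨(System.extend_x_self _ _ _ _ _ _).trans hy,
    (System.extend_parent_self _ _ _ _ _ _).trans ha⟩

/-- The reference particle keeps its prescribed state and lineage, so the last two states of the
reference path can be read off the system. At `t = 0` both truncated indices point to the dummy
state, which `hy` matches with the zero entries of the initial system. -/
theorem ae_forwardNat {t : ℕ} (ht : t ≤ T) (ω : Ω) {y : ℕ → State D} (hy : y 0 = 0) :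
    ∀ᵐ h ∂forwardNat (N := N) (I ω) y t,
      h.x t (h.k t) = y t ∧ h.parent t (h.k t) = y (t - 1) := by
  induction t with
  | zero =>
    rw [forwardNat, ae_dirac_eq]
    exact ⟨hy.symm, hy.symm⟩
  | succ t ih =>
    have ht' : t + 1 ∈ Finset.Icc 1 T := by simp; omega
    refine ae_bind (hI.measurable_forwardStep ht' measurable_const measurable_id measurable_const)
      ?_ ?_
    · exact (measurableSet_eq_fun (measurable_particle measurable_id
        (measurable_position measurable_id _) _) measurable_const).inter (measurableSet_eq_fun
        (measurable_parent measurable_id (measurable_position measurable_id _) _)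
        measurable_const)
    · rcases Nat.eq_zero_or_pos t with rfl | h1
      · rw [forwardNat, ae_dirac_eq]
        exact hI.ae_forwardStep ht ω _ _ _ fun k => Filter.Eventually.of_forall fun a => hy.symm
      · filter_upwards [ih (by omega)] with h hh
        refine hI.ae_forwardStep ht ω _ _ _ fun k => ?_
        filter_upwards [hI.ae_ancestorLaw h1 (by omega) ω h k] with a ha
        rw [ha]
        exact hh.1

theorem measurable_bracket {t : ℕ} (ht : t + 1 ≤ T) (ω : Ω) {ψ : System D N → ℝ≥0∞}
    (hψ : Measurable ψ) {p q : α → State D} {h : α → System D N} (hp : Measurable p)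
    (hq : Measurable q) (hh : Measurable h) :
    Measurable fun b : α × State D => mass (I ω) T (t + 1) (p b.1) (q b.1) b.2 *
      ∫⁻ s, ψ s ∂forwardStep (I ω) b.2 (t + 1) (h b.1) :=
  (hI.measurable_mass_comp (v := fun _ => ω) (by omega) measurable_const (hp.comp measurable_fst)
    (hq.comp measurable_fst) measurable_snd).mul ((Measure.measurable_lintegral hψ).comp
      (hI.measurable_forwardStep (v := fun _ => ω) (by simp; omega) measurable_const
        (hh.comp measurable_fst) measurable_snd))

/-- Tonelli exchanges the new reference state with the old system, after which the reference states
inside `mass` are replaced by the particles that carry them. The integrand then no longer mentions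
the path `y`. -/
theorem lintegral_forwardNat_bracket {t : ℕ} (ht : t + 1 ≤ T) (ω : Ω) {ψ : System D N → ℝ≥0∞}
    (hψ : Measurable ψ) {y : ℕ → State D} (hy : y 0 = 0) :
    ∫⁻ z, mass (I ω) T (t + 1) (y (t - 1)) (y t) z *
        ∫⁻ h, ∫⁻ s, ψ s ∂forwardStep (I ω) z (t + 1) h ∂forwardNat (I ω) y t =
      ∫⁻ h : System D N, (∫⁻ z, mass (I ω) T (t + 1) (h.parent t (h.k t)) (h.x t (h.k t)) z *
        ∫⁻ s, ψ s ∂forwardStep (I ω) z (t + 1) h) ∂forwardNat (I ω) y t := by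
  have ht' : t + 1 ∈ Finset.Icc 1 T := by simp; omega
  have := hI.isProbabilityMeasure_forwardNat (N := N) (t := t) (by omega) ω y
  have hbr : Measurable fun b : System D N × State D =>
      mass (I ω) T (t + 1) (y (t - 1)) (y t) b.2 *
        ∫⁻ s, ψ s ∂forwardStep (I ω) b.2 (t + 1) b.1 :=
    hI.measurable_bracket ht ω hψ (p := fun _ => y (t - 1)) (q := fun _ => y t) (h := fun h => h)
      measurable_const measurable_const measurable_id
  have hstep : ∀ z, Measurable fun h : System D N =>
      ∫⁻ s, ψ s ∂forwardStep (I ω) z (t + 1) h := fun z =>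
    (Measure.measurable_lintegral hψ).comp
      (hI.measurable_forwardStep (v := fun _ => ω) (r := fun _ => z) ht' measurable_const
        measurable_id measurable_const)
  have hinner : ∀ z, mass (I ω) T (t + 1) (y (t - 1)) (y t) z *
      ∫⁻ h, ∫⁻ s, ψ s ∂forwardStep (I ω) z (t + 1) h ∂forwardNat (I ω) y t =
      ∫⁻ h, mass (I ω) T (t + 1) (y (t - 1)) (y t) z *
        ∫⁻ s, ψ s ∂forwardStep (I ω) z (t + 1) h ∂forwardNat (I ω) y t := fun z =>
    (lintegral_const_mul _ (hstep z)).symm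
  rw [lintegral_congr hinner]
  have hswap := lintegral_lintegral_swap (μ := (volume : Measure (State D)))
    (ν := forwardNat (N := N) (I ω) y t)
    (f := fun z h => mass (I ω) T (t + 1) (y (t - 1)) (y t) z *
        ∫⁻ s, ψ s ∂forwardStep (I ω) z (t + 1) h) (hbr.comp measurable_swap).aemeasurable
  rw [hswap]
  refine lintegral_congr_ae ?_
  filter_upwards [hI.ae_forwardNat (N := N) (t := t) (by omega) ω hy] with h hh
  rw [hh.1, hh.2]

theorem measurable_massProd_mul_forwardNat {t : ℕ} (ht : t ≤ T) (ω : Ω) {ψ : System D N → ℝ≥0∞}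
    (hψ : Measurable ψ) : Measurable fun y : ℕ → State D =>
      massProd (I ω) T t y * ∫⁻ h, ψ h ∂forwardNat (I ω) y t :=
  (hI.measurable_massProd ω _).mul ((Measure.measurable_lintegral hψ).comp
    (hI.measurable_forwardNat (v := fun _ => ω) ht measurable_const measurable_id))

/-- Integrating out the last reference state first is possible because the first `t` steps do not
see it. The result is again a `flow`, one step shorter, which makes inductions on time possible. -/
theorem flow_succ {t : ℕ} (ht : t + 1 ≤ T) (ω : Ω) {ψ : System D N → ℝ≥0∞} (hψ : Measurable ψ) :
    flow (I ω) T (t + 1) ψ = flow (I ω) T t fun h =>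
      ∫⁻ z, mass (I ω) T (t + 1) (h.parent t (h.k t)) (h.x t (h.k t)) z *
        ∫⁻ s, ψ s ∂forwardStep (I ω) z (t + 1) h := by
  refine (lintegral_ext_succ t (hI.measurable_massProd_mul_forwardNat ht ω hψ)).trans ?_
  refine lintegral_congr fun x => ?_
  rw [← hI.lintegral_forwardNat_bracket ht ω hψ (ext_zero x)]
  have hfwd : ∀ z, forwardNat (N := N) (I ω) (Function.update (ext x) (t + 1) z) t =
      forwardNat (I ω) (ext x) t := fun z =>
    forwardNat_congr _ fun s hs => Function.update_of_ne (by omega) _ _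
  have hterm : ∀ z, massProd (I ω) T (t + 1) (Function.update (ext x) (t + 1) z) *
      ∫⁻ h, ψ h ∂forwardNat (I ω) (Function.update (ext x) (t + 1) z) (t + 1) =
      massProd (I ω) T t (ext x) * (mass (I ω) T (t + 1) (ext x (t - 1)) (ext x t) z *
        ∫⁻ h, ∫⁻ s, ψ s ∂forwardStep (I ω) z (t + 1) h ∂forwardNat (I ω) (ext x) t) := by
    intro z
    rw [massProd_update, hI.lintegral_forwardNat_succ ht ω _ hψ, hfwd, Function.update_self,
      mul_assoc]
  rw [lintegral_congr hterm]
  refine lintegral_const_mul _ ?_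
  have := hI.isProbabilityMeasure_forwardNat (N := N) (t := t) (by omega) ω (ext x)
  refine (hI.measurable_mass_comp (v := fun _ => ω) (by omega) measurable_const measurable_const
    measurable_const measurable_id).mul (measurable_lintegral_param measurable_const ?_)
  exact (Measure.measurable_lintegral hψ).comp (hI.measurable_forwardStep (v := fun _ => ω)
    (by simp; omega) measurable_const measurable_snd measurable_fst)

/-- Here `mass` splits as proposal times weight. The proposal is the law that the pinned particle
lacks, so the particles become independent ordinary draws; the weight of the reference particle is
left over as a tilt. -/
theorem lintegral_particleLaw {t : ℕ} (ht : t + 1 ≤ T) (ω : Ω) (h : System D N)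
    (a : Fin (N + 1) → Fin (N + 1)) (j : Fin (N + 1)) (p : State D)
    {Φ : (Fin (N + 1) → State D) → ℝ≥0∞} (hΦ : Measurable Φ) :
    ∫⁻ z, mass (I ω) T (t + 1) p (h.x t (a j)) z *
        ∫⁻ y, Φ y ∂particleLaw (I ω) h (t + 1) z j a =
      ∫⁻ y, (I ω).wt (t + 1) p (h.x t (a j)) (y j) * Φ y
        ∂Measure.pi fun n => lawOf ((I ω).prop (t + 1) (h.x t (a n))) := by
  have ht' : t + 1 ∈ Finset.Icc 1 T := by simp; omega
  have := fun x => hI.isProbabilityMeasure_particleComponent ht' ω x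
  have hwt : Measurable fun z => (I ω).wt (t + 1) p (h.x t (a j)) z :=
    hI.measurable_wt_comp (v := fun _ => ω) ht' measurable_const measurable_const measurable_const
      measurable_id
  have hprop : Measurable fun z => (I ω).prop (t + 1) (h.x t (a j)) z :=
    hI.measurable_prop_comp (v := fun _ => ω) ht' measurable_const measurable_const measurable_id
  have hmix := lintegral_pi_mixture (fun n => lawOf ((I ω).prop (t + 1) (h.x t (a n)))) j
    (f := fun y => (I ω).wt (t + 1) p (h.x t (a j)) (y j) * Φ y)
    ((hwt.comp (measurable_pi_apply j)).mul hΦ)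
  rw [← hmix]
  have hin : ∀ z, ∫⁻ y, (I ω).wt (t + 1) p (h.x t (a j)) (y j) * Φ y
      ∂particleLaw (I ω) h (t + 1) z j a = (I ω).wt (t + 1) p (h.x t (a j)) z *
        ∫⁻ y, Φ y ∂particleLaw (I ω) h (t + 1) z j a := by
    intro z
    rw [← lintegral_const_mul _ hΦ]
    refine lintegral_congr_ae ?_
    filter_upwards [hI.ae_particleLaw ht' ω h z j a] with y hy
    rw [hy]
  change _ = ∫⁻ z, ∫⁻ y, (I ω).wt (t + 1) p (h.x t (a j)) (y j) * Φ y
      ∂particleLaw (I ω) h (t + 1) z j a ∂lawOf ((I ω).prop (t + 1) (h.x t (a j)))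
  simp only [hin]
  refine Eq.trans (lintegral_congr fun z => ?_) (lintegral_lawOf hprop (hwt.mul
    ((Measure.measurable_lintegral hΦ).comp (hI.measurable_particleLaw (v := fun _ => ω) ht'
      (h := fun _ => h) (b := fun _ => a) measurable_const measurable_const
      measurable_id j measurable_const)))).symm
  rw [mass, if_pos ht, mul_assoc]
  rfl

/-- Integrating the new state of the reference path over its target density turns the conditional
step into an unconditional one, weighted by the weight of the reference particle. -/
theorem lintegral_bracket {t : ℕ} (ht : t + 1 ≤ T) (ω : Ω) (h : System D N) (p q : State D)
    (hpq : ∀ j, ∀ᵐ a ∂ancestorLaw (I ω) h (t + 1) j, h.parent t (a j) = p ∧ h.x t (a j) = q)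
    {ψ : System D N → ℝ≥0∞} (hψ : Measurable ψ) :
    ∫⁻ z, mass (I ω) T (t + 1) p q z * ∫⁻ s, ψ s ∂forwardStep (I ω) z (t + 1) h =
      ∑ j, ((N : ℝ≥0∞) + 1)⁻¹ * ∫⁻ a, ∫⁻ y,
        (I ω).wt (t + 1) (h.parent t (a j)) (h.x t (a j)) (y j) * ψ (h.extend (t + 1) a y j)
        ∂(Measure.pi fun n => lawOf ((I ω).prop (t + 1) (h.x t (a n))))
        ∂ancestorLaw (I ω) h (t + 1) j := by
  have ht' : t + 1 ∈ Finset.Icc 1 T := by simp; omega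
  have := fun k => hI.isProbabilityMeasure_ancestorLaw ht' ω h k
  have hmass : Measurable fun z => mass (I ω) T (t + 1) p q z :=
    hI.measurable_mass_comp (v := fun _ => ω) (by omega) measurable_const measurable_const
      measurable_const measurable_id
  have hΦ : ∀ j a, Measurable fun y => ψ (h.extend (t + 1) a y j) := fun j a =>
    hψ.comp (measurable_extend _ measurable_const measurable_const measurable_id measurable_const)
  have hint : ∀ j a, Measurable fun z => ∫⁻ y, ψ (h.extend (t + 1) a y j)
      ∂particleLaw (I ω) h (t + 1) z j a := fun j a =>
    (Measure.measurable_lintegral (hΦ j a)).comp (hI.measurable_particleLaw (v := fun _ => ω) ht'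
      measurable_const measurable_const measurable_id j measurable_const)
  have hpair : ∀ j, Measurable fun b : State D × (Fin (N + 1) → Fin (N + 1)) =>
      mass (I ω) T (t + 1) p q b.1 * ∫⁻ y, ψ (h.extend (t + 1) b.2 y j)
        ∂particleLaw (I ω) h (t + 1) b.1 j b.2 := fun j =>
    measurable_from_prod_countable_left fun a => hmass.mul (hint j a)
  simp only [lintegral_forwardStep (I ω) (t + 1) _ h hψ, Finset.mul_sum]
  have hrew : ∀ z j, mass (I ω) T (t + 1) p q z * (((N : ℝ≥0∞) + 1)⁻¹ * ∫⁻ a, ∫⁻ y,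
      ψ (h.extend (t + 1) a y j) ∂particleLaw (I ω) h (t + 1) z j a
        ∂ancestorLaw (I ω) h (t + 1) j) = ((N : ℝ≥0∞) + 1)⁻¹ * ∫⁻ a,
      mass (I ω) T (t + 1) p q z * ∫⁻ y, ψ (h.extend (t + 1) a y j)
        ∂particleLaw (I ω) h (t + 1) z j a ∂ancestorLaw (I ω) h (t + 1) j := by
    intro z j
    rw [lintegral_const_mul _ (measurable_of_countable _)]
    ring
  simp only [hrew]
  rw [lintegral_finsetSum _ fun j _ => (Measurable.lintegral_prod_right' (hpair j)).const_mul _]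
  refine Finset.sum_congr rfl fun j _ => ?_
  rw [lintegral_const_mul _ (Measurable.lintegral_prod_right' (hpair j)),
    lintegral_lintegral_swap (hpair j).aemeasurable]
  congr 1
  refine lintegral_congr_ae ?_
  filter_upwards [hpq j] with a ha
  -- The prescribed states `p`, `q` are those of the ancestor that the reference particle almost
  -- surely has.
  rw [← ha.1, ← ha.2]
  exact hI.lintegral_particleLaw ht ω h a j _ (hΦ j a)

end Regular

/-- The system in which the reference path is at position `k` at all times. -/
def System.withPosition {D N : ℕ} (h : System D N) (k : Fin (N + 1)) : System D N :=
  (h.1, h.2.1, fun _ => k)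

theorem measurable_withPosition {D N : ℕ} (k : Fin (N + 1)) :
    Measurable fun h : System D N => h.withPosition k :=
  measurable_fst.prodMk (measurable_snd.fst.prodMk measurable_const)

/-- Integrands of the form `φ s.core (s.k t)` see the particles, the ancestors and the position at
time `t`, and no other position. Conditioning on the system without positions thus becomes a
statement about such `φ`. -/
theorem measurable_core_position {D N : ℕ} {φ : System D N → Fin (N + 1) → ℝ≥0∞}
    (hφ : ∀ k, Measurable fun h => φ h k) (t : ℕ) :
    Measurable fun s : System D N => φ s.core (s.k t) :=
  measurable_apply_index (f := fun s : System D N => φ s.core)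
    (measurable_pi_lambda _ fun k => (hφ k).comp measurable_core)
    (measurable_position measurable_id t)

/-- The expected value of `φ` after step `t + 1` when the reference path is at position `k` at time
`t` and its new state has density `mass`. -/
def bracket {D N : ℕ} (J : Ingredients D) (T t : ℕ) (φ : System D N → Fin (N + 1) → ℝ≥0∞)
    (h : System D N) (k : Fin (N + 1)) : ℝ≥0∞ :=
  ∫⁻ z, mass J T (t + 1) (h.parent t k) (h.x t k) z *
    ∫⁻ s, φ s.core (s.k (t + 1)) ∂forwardStep J z (t + 1) (h.withPosition k)

/-- The expected value of `φ` after an unconditional step with ancestor law `A`, weighted by the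
weight of a uniformly chosen particle. -/
def freeStep {D N : ℕ} (J : Ingredients D) (t : ℕ) (φ : System D N → Fin (N + 1) → ℝ≥0∞)
    (h : System D N) (A : Measure (Fin (N + 1) → Fin (N + 1))) : ℝ≥0∞ :=
  ∑ j, ((N : ℝ≥0∞) + 1)⁻¹ * ∫⁻ a, ∫⁻ y,
    J.wt (t + 1) (h.parent t (a j)) (h.x t (a j)) (y j) * φ (h.extend (t + 1) a y j).core j
    ∂(Measure.pi fun n => lawOf (J.prop (t + 1) (h.x t (a n)))) ∂A

/-- The average of `φ` over the weights at time `t`. -/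
def resampled {D N : ℕ} (J : Ingredients D) (t : ℕ) (φ : System D N → Fin (N + 1) → ℝ≥0∞)
    (h : System D N) (_ : Fin (N + 1)) : ℝ≥0∞ :=
  ∑ k, weight J h t k * φ h k

namespace Regular

variable {Ω : Type*} [MeasurableSpace Ω] {D : ℕ} {I : Ω → Ingredients D} {T : ℕ}
  (hI : Regular I T) {N : ℕ}
include hI

theorem measurable_resampled {t : ℕ} (ht : t ∈ Finset.Icc 1 T) (ω : Ω)
    {φ : System D N → Fin (N + 1) → ℝ≥0∞} (hφ : ∀ k, Measurable fun h => φ h k)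
    (k : Fin (N + 1)) : Measurable fun h => resampled (I ω) t φ h k :=
  Finset.measurable_sum _ fun i _ =>
    (hI.measurable_weight (v := fun _ => ω) ht measurable_const measurable_id i).mul (hφ i)

/-- Once positions are erased, the extended system is the same for every `j`, so the sum over `j` is
a weighted sum of `φ` over the particles of a single system. Replacing `φ` by its average under the
normalised weights does not change such a sum. Hypothesis `hA` ensures that the tilt is exactly the
weight the extended system assigns to particle `j`. -/
theorem freeStep_resampled {t : ℕ} (ht : t + 1 ≤ T) (ω : Ω)
    {φ : System D N → Fin (N + 1) → ℝ≥0∞} (hφ : ∀ k, Measurable fun h => φ h k)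
    (h : System D N) {A : Measure (Fin (N + 1) → Fin (N + 1))}
    (hA : ∀ᵐ a ∂A, ∀ y k j, (h.extend (t + 1) a y k).grandparent (t + 1) j = h.parent t (a j)) :
    freeStep (I ω) t (resampled (I ω) (t + 1) φ) h A = freeStep (I ω) t φ h A := by
  have ht' : t + 1 ∈ Finset.Icc 1 T := by simp; omega
  have hmeas : ∀ {χ : System D N → Fin (N + 1) → ℝ≥0∞}, (∀ k, Measurable fun h => χ h k) →
      ∀ (a : Fin (N + 1) → Fin (N + 1)) j, Measurable fun y : Fin (N + 1) → State D =>
        (I ω).wt (t + 1) (h.parent t (a j)) (h.x t (a j)) (y j) *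
          χ (h.extend (t + 1) a y j).core j := fun hχ a j =>
    (hI.measurable_wt_comp (v := fun _ => ω) ht' measurable_const measurable_const
      measurable_const (measurable_pi_apply j)).mul ((hχ j).comp (measurable_core.comp
        (measurable_extend _ measurable_const measurable_const measurable_id measurable_const)))
  have hsum : ∀ {χ : System D N → Fin (N + 1) → ℝ≥0∞}, (∀ k, Measurable fun h => χ h k) →
      freeStep (I ω) t χ h A = ((N : ℝ≥0∞) + 1)⁻¹ * ∫⁻ a, ∫⁻ y, ∑ j,
        (I ω).wt (t + 1) (h.parent t (a j)) (h.x t (a j)) (y j) *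
          χ (h.extend (t + 1) a y j).core j
        ∂(Measure.pi fun n => lawOf ((I ω).prop (t + 1) (h.x t (a n)))) ∂A := by
    intro χ hχ
    rw [freeStep, ← Finset.mul_sum, ← lintegral_finsetSum _ fun j _ => measurable_of_countable _]
    congr 1
    refine lintegral_congr fun a => ?_
    rw [lintegral_finsetSum _ fun j _ => hmeas hχ a j]
  rw [hsum hφ, hsum (hI.measurable_resampled ht' ω hφ)]
  congr 1
  refine lintegral_congr_ae ?_
  filter_upwards [hA] with a ha
  refine lintegral_congr fun y => ?_
  -- The position `0` stored here is arbitrary, since `core` erases it.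
  have hwt : ∀ j, (I ω).wt (t + 1) (h.parent t (a j)) (h.x t (a j)) (y j) =
      (I ω).wt (t + 1) ((h.extend (t + 1) a y 0).core.grandparent (t + 1) j)
        ((h.extend (t + 1) a y 0).core.parent (t + 1) j)
        ((h.extend (t + 1) a y 0).core.x (t + 1) j) := by
    intro j
    have h1 := ha y 0 j
    have h2 := System.extend_parent_self h t a y 0 j
    have h3 := System.extend_x_self h (t + 1) a y 0 j
    exact congr (congr (congrArg ((I ω).wt (t + 1)) h1.symm) h2.symm) h3.symm
  simp only [hwt]
  exact sum_mul_sum_normalise (fun j => hI.wt_ne_zero _ ht' ω _ _ _)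
    (fun j => hI.wt_ne_top _ ht' ω _ _ _) fun k => φ (h.extend (t + 1) a y 0).core k

theorem bracket_eq {t : ℕ} (ht : t + 1 ≤ T) (ω : Ω) {φ : System D N → Fin (N + 1) → ℝ≥0∞}
    (hφ : ∀ k, Measurable fun h => φ h k) (h : System D N) (k : Fin (N + 1))
    (hk : ∀ j, ∀ᵐ a ∂ancestorLaw (I ω) (h.withPosition k) (t + 1) j,
      h.parent t (a j) = h.parent t k ∧ h.x t (a j) = h.x t k) :
    bracket (I ω) T t φ h k = ∑ j, ((N : ℝ≥0∞) + 1)⁻¹ * ∫⁻ a, ∫⁻ y,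
      (I ω).wt (t + 1) (h.parent t (a j)) (h.x t (a j)) (y j) *
        φ (h.extend (t + 1) a y j).core j
      ∂(Measure.pi fun n => lawOf ((I ω).prop (t + 1) (h.x t (a n))))
      ∂ancestorLaw (I ω) (h.withPosition k) (t + 1) j := by
  refine (hI.lintegral_bracket ht ω (h.withPosition k) (h.parent t k) (h.x t k) hk
    (measurable_core_position hφ (t + 1))).trans ?_
  refine Finset.sum_congr rfl fun j _ => congrArg _ ?_
  refine lintegral_congr fun a => ?_
  refine lintegral_congr fun y => ?_
  rw [System.extend_k_self]
  rfl

/-- The old position `k` enters the next step only as the prescribed ancestor of the reference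
particle. Drawing it from the weights makes that ancestor an ordinary resampling draw, so the whole
ancestor row becomes independent and identically distributed. -/
theorem sum_weight_mul_bracket {t : ℕ} (h1 : 1 ≤ t) (ht : t + 1 ≤ T) (ω : Ω)
    {φ : System D N → Fin (N + 1) → ℝ≥0∞} (hφ : ∀ k, Measurable fun h => φ h k)
    (h : System D N) :
    ∑ k, weight (I ω) h t k * bracket (I ω) T t φ h k =
      freeStep (I ω) t φ h (Measure.pi fun _ => categorical (weight (I ω) h t)) := by
  have := isProbabilityMeasure_categorical (hI.sum_weight (t := t) (by simp; omega) ω h)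
  have hanc : ∀ k j, ancestorLaw (I ω) (h.withPosition k) (t + 1) j =
      Measure.pi fun n => if n = j then Measure.dirac k else categorical (weight (I ω) h t) := by
    intro k j
    rw [ancestorLaw, if_pos (by omega)]
    rfl
  have hbr := fun k => hI.bracket_eq ht ω hφ h k fun j => by
    filter_upwards [hI.ae_ancestorLaw h1 (by omega) ω (h.withPosition k) j] with a ha
    rw [ha]
    exact ⟨rfl, rfl⟩
  simp only [hbr, hanc, Finset.mul_sum]
  rw [Finset.sum_comm, freeStep]
  refine Finset.sum_congr rfl fun j _ => ?_
  have hmix := lintegral_pi_mixture (fun _ : Fin (N + 1) => categorical (weight (I ω) h t)) j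
    (f := fun a => ∫⁻ y, (I ω).wt (t + 1) (h.parent t (a j)) (h.x t (a j)) (y j) *
        φ (h.extend (t + 1) a y j).core j
      ∂(Measure.pi fun n => lawOf ((I ω).prop (t + 1) (h.x t (a n))))) (measurable_of_countable _)
  rw [← hmix, lintegral_categorical, Finset.mul_sum]
  exact Finset.sum_congr rfl fun k _ => mul_left_comm _ _ _

theorem measurable_bracket_left {t : ℕ} (ht : t + 1 ≤ T) (ω : Ω)
    {φ : System D N → Fin (N + 1) → ℝ≥0∞} (hφ : ∀ k, Measurable fun h => φ h k)
    (k : Fin (N + 1)) : Measurable fun h => bracket (I ω) T t φ h k :=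
  Measurable.lintegral_prod_right' (hI.measurable_bracket ht ω
    (measurable_core_position hφ (t + 1)) (measurable_parent measurable_id measurable_const t)
    (measurable_particle measurable_id measurable_const t) (measurable_withPosition k))

/-- The transition reads no position other than `h.k t`, so the remaining record of positions may be
overwritten. This puts the integrand at time `t` in the form to which the induction hypothesis of
`flow_position` applies. -/
theorem flow_succ_eq_bracket {t : ℕ} (ht : t + 1 ≤ T) (ω : Ω)
    {φ : System D N → Fin (N + 1) → ℝ≥0∞} (hφ : ∀ k, Measurable fun h => φ h k) :
    flow (I ω) T (t + 1) (fun h => φ h.core (h.k (t + 1))) =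
      flow (I ω) T t fun h => bracket (I ω) T t φ h.core (h.k t) := by
  have hψ := measurable_core_position hφ (t + 1)
  rw [hI.flow_succ ht ω hψ]
  congr 1
  funext h
  refine lintegral_congr fun z => congrArg _ ?_
  rw [lintegral_forwardStep _ _ _ _ hψ, lintegral_forwardStep _ _ _ _ hψ]
  refine Finset.sum_congr rfl fun j _ => congrArg _ ?_
  have hanc : ancestorLaw (I ω) (h.core.withPosition (h.k t)) (t + 1) j =
    ancestorLaw (I ω) h (t + 1) j := rfl
  rw [hanc]
  refine lintegral_congr fun a => lintegral_congr fun y => ?_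
  rw [System.extend_k_self, System.extend_k_self]
  rfl

/-- Given the particles and ancestors, the position of the reference path at time `t` is distributed
according to the weights. -/
theorem flow_position {t : ℕ} (h1 : 1 ≤ t) (ht : t ≤ T) (ω : Ω)
    {φ : System D N → Fin (N + 1) → ℝ≥0∞} (hφ : ∀ k, Measurable fun h => φ h k) :
    flow (I ω) T t (fun h => φ h.core (h.k t)) =
      flow (I ω) T t fun h => ∑ k, weight (I ω) h t k * φ h.core k := by
  -- The weighted average is itself of the form `φ h.core (h.k t)`, with a `φ` that ignores its
  -- index. Both sides can therefore be pushed back by the same recursion.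
  have hres : ∀ (s : ℕ) (χ : System D N → Fin (N + 1) → ℝ≥0∞),
      (fun h : System D N => ∑ k, weight (I ω) h s k * χ h.core k) =
        fun h : System D N => resampled (I ω) s χ h.core (h.k s) := fun s χ => rfl
  induction t, h1 using Nat.le_induction generalizing φ with
  | base =>
    have hres' := hI.measurable_resampled (t := 1) (by simp; omega) ω hφ
    rw [hres, hI.flow_succ_eq_bracket ht ω hφ, hI.flow_succ_eq_bracket ht ω hres']
    refine lintegral_congr fun x => congrArg _ ?_
    rw [forwardNat, lintegral_dirac, lintegral_dirac]
    have hbr : ∀ {χ : System D N → Fin (N + 1) → ℝ≥0∞}, (∀ k, Measurable fun h => χ h k) →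
        bracket (I ω) T 0 χ 0 0 = freeStep (I ω) 0 χ 0 (Measure.dirac 0) := by
      intro χ hχ
      exact hI.bracket_eq ht ω hχ 0 0 fun j => Filter.Eventually.of_forall fun a => ⟨rfl, rfl⟩
    have := hI.freeStep_resampled ht ω hφ 0 (A := Measure.dirac 0) (by
      rw [ae_dirac_eq]
      intro y k j
      simp [System.grandparent, System.parent, System.extend, System.x])
    exact (hbr hφ).trans (this.symm.trans (hbr hres').symm)
  | succ t h1 ih =>
    have hres' := hI.measurable_resampled (t := t + 1) (by simp; omega) ω hφ
    -- The induction hypothesis, applied to the `bracket` of `φ` and to that of its weighted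
    -- average, averages the position at time `t` over the weights. Both sides become unconditional
    -- steps, which agree by `freeStep_resampled`.
    rw [hres, hI.flow_succ_eq_bracket ht ω hφ, hI.flow_succ_eq_bracket ht ω hres',
      ih (by omega) (hI.measurable_bracket_left ht ω hφ),
      ih (by omega) (hI.measurable_bracket_left ht ω hres')]
    congr 1
    funext h
    refine (hI.sum_weight_mul_bracket h1 ht ω hφ h.core).trans (Eq.trans ?_
      (hI.sum_weight_mul_bracket h1 ht ω hres' h.core).symm)
    exact (hI.freeStep_resampled ht ω hφ h.core (Filter.Eventually.of_forall fun a y k j =>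
      System.extend_grandparent_self _ _ _ _ _ _ h1)).symm

end Regular

/-! ### Backward sampling. -/

/-- The terms of the target that involve both the state `x_t` and later states `z`, as a function of
`(x_{t-1}, x_t) = (x, y)`. -/
def future {D : ℕ} (J : Ingredients D) (T t : ℕ) (x y : State D) (z : ℕ → State D) : ℝ≥0∞ :=
  mass J T (t + 1) x y (z (t + 1)) * mass J T (t + 2) y (z (t + 1)) (z (t + 2))

/-- The backward-sampling probabilities at time `t` given the later states `z`. -/
def backwardProb {D N : ℕ} (J : Ingredients D) (T t : ℕ) (h : System D N) (z : ℕ → State D) :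
    Fin (N + 1) → ℝ≥0∞ :=
  normalise fun i => weight J h t i * future J T t (h.parent t i) (h.x t i) z

/-- The expected value of `F` at the path that consists of `z` after time `t` and is obtained by
backward sampling from `h` up to time `t`. -/
def backwardMean {D N : ℕ} (J : Ingredients D) (T : ℕ) (F : (ℕ → State D) → ℝ≥0∞) :
    ℕ → System D N → (ℕ → State D) → ℝ≥0∞
  | 0, _, z => F z
  | t + 1, h, z => ∑ i, backwardProb J T (t + 1) h z i *
      backwardMean J T F t h (Function.update z (t + 1) (h.x (t + 1) i))

/-- The path that is `y` up to time `t` and `z` afterwards. -/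
def splice {D : ℕ} (t : ℕ) (y z : ℕ → State D) (s : ℕ) : State D :=
  if 1 ≤ s ∧ s ≤ t then y s else z s

theorem splice_update {D : ℕ} (t : ℕ) (y z : ℕ → State D) (w : State D) :
    splice (t + 1) (Function.update y (t + 1) w) z =
      splice t y (Function.update z (t + 1) w) := by
  funext s
  rcases eq_or_ne s (t + 1) with rfl | hs
  · simp [splice]
  · have : s ≤ t + 1 ↔ s ≤ t := by omega
    simp [splice, Function.update_of_ne hs, this]

theorem measurable_splice {D : ℕ} (t : ℕ) : Measurable (Function.uncurry (splice (D := D) t)) := by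
  refine measurable_pi_lambda _ fun s => ?_
  simp only [Function.uncurry, splice]
  split_ifs
  · exact (measurable_pi_apply s).comp measurable_fst
  · exact (measurable_pi_apply s).comp measurable_snd

theorem future_congr {D : ℕ} (J : Ingredients D) {T t : ℕ} (x y : State D) {z z' : ℕ → State D}
    (hz : ∀ s, t < s → s ≤ T → z s = z' s) : future J T t x y z = future J T t x y z' := by
  have h1 : ∀ x y, mass J T (t + 1) x y (z (t + 1)) = mass J T (t + 1) x y (z' (t + 1)) := by
    intro x y
    unfold mass
    split_ifs with h
    · rw [hz _ (by omega) h]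
    · rfl
  have h2 : ∀ y, mass J T (t + 2) y (z (t + 1)) (z (t + 2)) =
      mass J T (t + 2) y (z' (t + 1)) (z' (t + 2)) := by
    intro y
    unfold mass
    split_ifs with h
    · rw [hz _ (by omega) h, hz (t + 1) (by omega) (by omega)]
    · rfl
  rw [future, future, h1, h2]

/-- Since `mass` is `1` beyond the horizon, entries of `z` at index `0` or after `T` are never used.
At the horizon this allows a path that vanishes except at time `T` to replace the traced one. -/
theorem backwardMean_congr_path {D N : ℕ} (J : Ingredients D) {T : ℕ}
    {F : (ℕ → State D) → ℝ≥0∞}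
    (hF : ∀ z z', (∀ s, 1 ≤ s → s ≤ T → z s = z' s) → F z = F z') (t : ℕ) (h : System D N)
    {z z' : ℕ → State D} (hz : ∀ s, t < s → s ≤ T → z s = z' s) :
    backwardMean J T F t h z = backwardMean J T F t h z' := by
  induction t generalizing z z' with
  | zero => exact hF z z' hz
  | succ t ih =>
    rw [backwardMean, backwardMean]
    refine Finset.sum_congr rfl fun i _ => ?_
    congr 1
    · simp only [backwardProb, future_congr J _ _ hz]
    · refine ih fun s hs hs' => ?_
      rcases eq_or_ne s (t + 1) with rfl | hne
      · simp
      · rw [Function.update_of_ne hne, Function.update_of_ne hne, hz s (by omega) hs']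

/-- Backward sampling from time `t` downwards looks only at particles up to `t` and at ancestor rows
before `t`. It is therefore unaffected by the later steps of the forward pass and by positions. -/
theorem backwardMean_congr_system {D N : ℕ} (J : Ingredients D) {T : ℕ}
    (F : (ℕ → State D) → ℝ≥0∞) (t : ℕ) {h h' : System D N}
    (hx : ∀ s ≤ t, ∀ n, h.x s n = h'.x s n) (ha : ∀ s < t, ∀ n, h.a s n = h'.a s n)
    (z : ℕ → State D) : backwardMean J T F t h z = backwardMean J T F t h' z := by
  induction t generalizing z with
  | zero => rfl
  | succ t ih =>
    have hpar : ∀ s, s ≤ t + 1 → 1 ≤ s → ∀ n, h.parent s n = h'.parent s n := by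
      intro s hs h1 n
      rw [System.parent, System.parent, ha _ (by omega), hx _ (by omega)]
    have hpar0 : ∀ n, h.parent t n = h'.parent t n := by
      intro n
      rw [System.parent, System.parent, ha _ (by omega), hx _ (by omega)]
    have hgrand : ∀ n, h.grandparent (t + 1) n = h'.grandparent (t + 1) n := by
      intro n
      rw [System.grandparent, System.grandparent, ha _ (by omega)]
      exact hpar0 _
    have hw : weight J h (t + 1) = weight J h' (t + 1) := by
      simp only [weight, hgrand, hpar (t + 1) le_rfl (by omega), hx (t + 1) le_rfl]
    rw [backwardMean, backwardMean]
    refine Finset.sum_congr rfl fun i _ => ?_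
    simp only [backwardProb, hw, hpar (t + 1) le_rfl (by omega), hx (t + 1) le_rfl]
    rw [ih (fun s hs => hx s (by omega)) fun s hs => ha s (by omega)]

theorem backwardMean_core {D N : ℕ} (J : Ingredients D) {T : ℕ}
    (F : (ℕ → State D) → ℝ≥0∞) (t : ℕ) (h : System D N) (z : ℕ → State D) :
    backwardMean J T F t h.core z = backwardMean J T F t h z :=
  backwardMean_congr_system (h := h.core) (h' := h) J F t (fun _ _ _ => rfl) (fun _ _ _ => rfl) z

/-- The path through the particles `l` of the system. -/
def System.trace {D N : ℕ} (h : System D N) (l : ℕ → Fin (N + 1)) (s : ℕ) : State D := h.x s (l s)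

theorem System.trace_update {D N : ℕ} (h : System D N) (l : ℕ → Fin (N + 1)) (t : ℕ)
    (i : Fin (N + 1)) :
    h.trace (Function.update l t i) = Function.update (h.trace l) t (h.x t i) := by
  funext s
  rcases eq_or_ne s t with rfl | hs
  · simp [System.trace]
  · simp [System.trace, Function.update_of_ne hs]

namespace Regular

variable {Ω : Type*} [MeasurableSpace Ω] {D : ℕ} {I : Ω → Ingredients D} {T : ℕ}
  (hI : Regular I T) {α : Type*} [MeasurableSpace α] {N : ℕ}
include hI

theorem future_ne_zero (ω : Ω) (t : ℕ) (x y : State D) (z : ℕ → State D) :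
    future (I ω) T t x y z ≠ 0 :=
  mul_ne_zero (hI.mass_ne_zero ω (by omega) _ _ _) (hI.mass_ne_zero ω (by omega) _ _ _)

theorem future_ne_top (ω : Ω) (t : ℕ) (x y : State D) (z : ℕ → State D) :
    future (I ω) T t x y z ≠ ∞ :=
  ENNReal.mul_ne_top (hI.mass_ne_top ω (by omega) _ _ _) (hI.mass_ne_top ω (by omega) _ _ _)

theorem measurable_future (ω : Ω) (t : ℕ) {x y : α → State D} {z : α → ℕ → State D}
    (hx : Measurable x) (hy : Measurable y) (hz : Measurable z) :
    Measurable fun a => future (I ω) T t (x a) (y a) (z a) :=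
  (hI.measurable_mass_comp (v := fun _ => ω) (by omega) measurable_const hx hy
    (measurable_pi_iff.1 hz _)).mul (hI.measurable_mass_comp (v := fun _ => ω) (by omega)
      measurable_const hy (measurable_pi_iff.1 hz _) (measurable_pi_iff.1 hz _))

theorem measurable_backwardMean (ω : Ω) {F : (ℕ → State D) → ℝ≥0∞} (hF : Measurable F) {t : ℕ}
    (ht : t ≤ T) {h : α → System D N} {z : α → ℕ → State D} (hh : Measurable h)
    (hz : Measurable z) : Measurable fun a => backwardMean (I ω) T F t (h a) (z a) := by
  induction t generalizing z with
  | zero => exact hF.comp hz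
  | succ t ih =>
    simp only [backwardMean]
    refine Finset.measurable_sum _ fun i _ => Measurable.mul ?_ ?_
    · refine measurable_normalise (fun j => ?_) i
      exact (hI.measurable_weight (v := fun _ => ω) (by simp; omega) measurable_const hh j).mul
        (hI.measurable_future ω _ (measurable_parent hh measurable_const _)
          (measurable_particle hh measurable_const _) hz)
    · exact ih (by omega) (measurable_update_param hz (measurable_particle hh measurable_const _) _)

/-- The constant of `back_factor` cancels in the normalisation. From here on the filtering and
smoothing variants need no separate treatment. -/
theorem backwardStep_eq {t : ℕ} (h1 : 1 ≤ t) (hT : t < T) (ω : Ω) (h : System D N)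
    (l : ℕ → Fin (N + 1)) :
    backwardStep (I ω) h t l = categorical (backwardProb (I ω) T t h (h.trace l)) := by
  obtain ⟨c, hc0, hc, hb⟩ := hI.back_factor t h1 hT ω (h.trace l (t + 1)) (h.trace l (t + 2))
  rw [backwardStep, backwardProb, ← normalise_mul_const _ hc0 hc]
  congr 2
  funext i
  rw [mul_assoc, future, ← hb]
  rfl

/-- A tower property: each backward step uses up one layer of the recursion for `backwardMean` and
preserves the expectation. At `r = T - 1` no layer is left and the left side is the expectation of
`F` at the returned path. -/
theorem lintegral_backward (ω : Ω) {F : (ℕ → State D) → ℝ≥0∞}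
    (hF : Measurable F) (h : System D N) {r : ℕ} (hr : r < T) :
    ∫⁻ l, backwardMean (I ω) T F (T - 1 - r) h (h.trace l) ∂backward (I ω) T h r =
      ∫⁻ i, backwardMean (I ω) T F (T - 1) h (h.trace (Function.update 0 T i))
        ∂finalIndex (I ω) T h := by
  have htrace : Measurable fun l : ℕ → Fin (N + 1) => h.trace l :=
    measurable_pi_lambda _ fun s => measurable_particle measurable_const (measurable_pi_apply s) s
  have hmean : ∀ t ≤ T, Measurable fun l => backwardMean (I ω) T F t h (h.trace l) :=
    fun t ht => hI.measurable_backwardMean ω hF ht measurable_const htrace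
  induction r with
  | zero =>
    rw [backward, lintegral_map (hmean _ (by omega)) measurable_from_top]
    rfl
  | succ r ih =>
    rw [← ih (by omega)]
    have hp := fun l => hI.isProbabilityMeasure_backwardStep (t := T - (r + 1)) (by omega)
      (by omega) ω h l
    have hker : Measurable fun l => (backwardStep (I ω) h (T - (r + 1)) l).map
        fun i => Function.update l (T - (r + 1)) i := measurable_map_param
      (hI.measurable_backwardStep (v := fun _ => ω) (h := fun _ => h) (by omega) (by omega)
        measurable_const measurable_const measurable_id)
      (measurable_update_param measurable_fst measurable_snd _)
    rw [backward, Measure.lintegral_bind hker.aemeasurable (hmean _ (by omega)).aemeasurable]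
    refine lintegral_congr fun l => ?_
    rw [lintegral_map (hmean _ (by omega)) measurable_from_top,
      hI.backwardStep_eq (by omega) (by omega), lintegral_categorical]
    obtain ⟨n, hn⟩ : ∃ n, T - (r + 1) = n + 1 := ⟨T - (r + 1) - 1, by omega⟩
    have h1 : T - 1 - (r + 1) = n := by omega
    have h2 : T - 1 - r = n + 1 := by omega
    rw [h1, h2, hn, backwardMean]
    simp only [System.trace_update]

/-- The claim of `flow_position` with the position drawn from reweighted weights. -/
theorem flow_backwardProb {t : ℕ} (h1 : 1 ≤ t) (ht : t ≤ T) (ω : Ω) (z : ℕ → State D)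
    {φ : System D N → Fin (N + 1) → ℝ≥0∞} (hφ : ∀ k, Measurable fun h => φ h k) :
    flow (I ω) T t (fun h => future (I ω) T t (h.parent t (h.k t)) (h.x t (h.k t)) z *
        ∑ i, backwardProb (I ω) T t h z i * φ h.core i) =
      flow (I ω) T t fun h => future (I ω) T t (h.parent t (h.k t)) (h.x t (h.k t)) z *
        φ h.core (h.k t) := by
  have ht' : t ∈ Finset.Icc 1 T := by simp; omega
  have hfut : ∀ k, Measurable fun h : System D N =>
      future (I ω) T t (h.parent t k) (h.x t k) z := fun k =>
    hI.measurable_future ω t (measurable_parent measurable_id measurable_const _)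
      (measurable_particle measurable_id measurable_const _) measurable_const
  have hprob : ∀ k, Measurable fun h : System D N => backwardProb (I ω) T t h z k := fun k =>
    measurable_normalise (fun j => (hI.measurable_weight (v := fun _ => ω) ht' measurable_const
      measurable_id j).mul (hfut j)) k
  have hL := hI.flow_position h1 ht ω (φ := fun h k =>
    future (I ω) T t (h.parent t k) (h.x t k) z * ∑ i, backwardProb (I ω) T t h z i * φ h i)
    fun k => (hfut k).mul (Finset.measurable_sum _ fun i _ => (hprob i).mul (hφ i))
  have hR := hI.flow_position h1 ht ω (φ := fun h k =>
    future (I ω) T t (h.parent t k) (h.x t k) z * φ h k) fun k => (hfut k).mul (hφ k)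
  refine hL.trans (Eq.trans ?_ hR.symm)
  congr 1
  funext h
  -- With the position averaged out, both sides are sums with coefficients `W_t · future`, whose
  -- normalisation is `backwardProb`.
  simp only [← mul_assoc]
  exact sum_mul_sum_normalise
    (fun i => mul_ne_zero (hI.weight_ne_zero ht' ω h i) (hI.future_ne_zero ω _ _ _ _))
    (fun i => ENNReal.mul_ne_top (hI.weight_ne_top ht' ω h i) (hI.future_ne_top ω _ _ _ _)) _

/-- An integral over the last state is an integral over the future of the preceding ones. -/
theorem lintegral_future_succ (ω : Ω) (t : ℕ) (z : ℕ → State D)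
    {Ψ Ψ' : (ℕ → State D) → (ℕ → State D) → ℝ≥0∞}
    (hΨ : Measurable (Function.uncurry Ψ)) (hΨ' : Measurable fun y => Ψ' y z)
    (hrec : ∀ y w, y 0 = 0 → Ψ' (Function.update y (t + 1) w) z =
      Ψ y (Function.update z (t + 1) w)) :
    ∫⁻ x : StatePath D (t + 1), massProd (I ω) T (t + 1) (ext x) *
        (future (I ω) T (t + 1) (ext x t) (ext x (t + 1)) z * Ψ' (ext x) z) =
      ∫⁻ w, mass (I ω) T (t + 3) w (z (t + 2)) (z (t + 3)) *
        ∫⁻ x : StatePath D t, massProd (I ω) T t (ext x) *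
          (future (I ω) T t (ext x (t - 1)) (ext x t) (Function.update z (t + 1) w) *
            Ψ (ext x) (Function.update z (t + 1) w)) := by
  have hupd : Measurable fun p : StatePath D t × State D => Function.update z (t + 1) p.2 :=
    measurable_update_param measurable_const measurable_snd _
  have hext : Measurable fun p : StatePath D t × State D => ext p.1 :=
    (measurable_ext' t).comp measurable_fst
  have hin : Measurable fun p : StatePath D t × State D => massProd (I ω) T t (ext p.1) *
      (future (I ω) T t (ext p.1 (t - 1)) (ext p.1 t) (Function.update z (t + 1) p.2) *
        Ψ (ext p.1) (Function.update z (t + 1) p.2)) :=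
    ((hI.measurable_massProd ω t).comp hext).mul ((hI.measurable_future ω t
      (measurable_pi_iff.1 hext _) (measurable_pi_iff.1 hext _) hupd).mul
        (hΨ.comp (hext.prodMk hupd)))
  have hmass : Measurable fun w : State D => mass (I ω) T (t + 3) w (z (t + 2)) (z (t + 3)) :=
    hI.measurable_mass_comp (v := fun _ => ω) (by omega) measurable_const measurable_id
      measurable_const measurable_const
  have hout : Measurable fun y : ℕ → State D => massProd (I ω) T (t + 1) y *
      (future (I ω) T (t + 1) (y t) (y (t + 1)) z * Ψ' y z) :=
    (hI.measurable_massProd ω _).mul ((hI.measurable_future ω (t + 1) (x := fun y => y t)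
      (y := fun y => y (t + 1)) (measurable_pi_apply _) (measurable_pi_apply _)
      measurable_const).mul hΨ')
  refine (lintegral_ext_succ t hout).trans ?_
  -- The factors at times `t + 1`, `t + 2`, `t + 3` are regrouped: the first two form `future` at
  -- time `t` with `w` inserted into `z`, while the third does not involve the states up to time `t`
  -- and leaves the inner integral.
  have hterm : ∀ (x : StatePath D t) (w : State D),
      massProd (I ω) T (t + 1) (Function.update (ext x) (t + 1) w) *
        (future (I ω) T (t + 1) (Function.update (ext x) (t + 1) w t)
          (Function.update (ext x) (t + 1) w (t + 1)) z *
            Ψ' (Function.update (ext x) (t + 1) w) z) =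
      mass (I ω) T (t + 3) w (z (t + 2)) (z (t + 3)) * (massProd (I ω) T t (ext x) *
        (future (I ω) T t (ext x (t - 1)) (ext x t) (Function.update z (t + 1) w) *
          Ψ (ext x) (Function.update z (t + 1) w))) := by
    intro x w
    rw [hrec _ _ (ext_zero x), massProd_update, Function.update_self,
      Function.update_of_ne (by omega), future, future, Function.update_self,
      Function.update_of_ne (by omega)]
    ring
  refine (lintegral_congr fun x => lintegral_congr fun w => hterm x w).trans ?_
  have hpair : Measurable (Function.uncurry fun (x : StatePath D t) (w : State D) =>
      mass (I ω) T (t + 3) w (z (t + 2)) (z (t + 3)) * (massProd (I ω) T t (ext x) *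
        (future (I ω) T t (ext x (t - 1)) (ext x t) (Function.update z (t + 1) w) *
          Ψ (ext x) (Function.update z (t + 1) w)))) :=
    (hmass.comp measurable_snd).mul hin
  have hslice : ∀ w, Measurable fun x : StatePath D t => massProd (I ω) T t (ext x) *
      (future (I ω) T t (ext x (t - 1)) (ext x t) (Function.update z (t + 1) w) *
        Ψ (ext x) (Function.update z (t + 1) w)) := fun w =>
    Measurable.comp (f := fun x => (x, w)) hin (measurable_id.prodMk measurable_const)
  rw [lintegral_lintegral_swap hpair.aemeasurable]
  exact lintegral_congr fun w => lintegral_const_mul _ (hslice w)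

/-- The integrand does not see step `t + 1`, and that step is a probability measure. -/
theorem lintegral_forwardNat_backwardMean {t : ℕ} (ht : t + 1 ≤ T) (ω : Ω)
    {F : (ℕ → State D) → ℝ≥0∞} (hF : Measurable F) (y z : ℕ → State D) :
    ∫⁻ h : System D N, backwardMean (I ω) T F t h z ∂forwardNat (I ω) y (t + 1) =
      ∫⁻ h : System D N, backwardMean (I ω) T F t h z ∂forwardNat (I ω) y t := by
  have hmean : Measurable fun h : System D N => backwardMean (I ω) T F t h z :=
    hI.measurable_backwardMean (z := fun _ => z) ω hF (by omega) measurable_id measurable_const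
  have ht' : t + 1 ∈ Finset.Icc 1 T := by simp; omega
  rw [hI.lintegral_forwardNat_succ ht ω y hmean]
  refine lintegral_congr fun h => ?_
  rw [lintegral_forwardStep (I ω) _ _ _ hmean]
  have hloc : ∀ a y' k, backwardMean (I ω) T F t (h.extend (t + 1) a y' k) z =
      backwardMean (I ω) T F t h z := fun a y' k =>
    backwardMean_congr_system _ _ _ (fun s hs n => System.extend_x_of_ne _ _ _ _ _ _ (by omega))
      (fun s hs n => System.extend_a_of_ne _ _ _ _ _ _ (by omega)) _
  have := fun k => hI.isProbabilityMeasure_ancestorLaw ht' ω h k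
  have := fun k a => hI.isProbabilityMeasure_particleLaw ht' ω h (y (t + 1)) k a
  simp only [hloc, lintegral_const, measure_univ, mul_one]
  rw [← Finset.sum_mul, sum_uniform, one_mul]

theorem measurable_lintegral_backwardMean (ω : Ω) {F : (ℕ → State D) → ℝ≥0∞} (hF : Measurable F)
    {t : ℕ} (ht : t ≤ T) : Measurable (Function.uncurry fun y z : ℕ → State D =>
      ∫⁻ h : System D N, backwardMean (I ω) T F t h z ∂forwardNat (I ω) y t) := by
  have := fun p : (ℕ → State D) × (ℕ → State D) =>
    hI.isProbabilityMeasure_forwardNat (N := N) ht ω p.1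
  exact measurable_lintegral_param
    (hI.measurable_forwardNat (v := fun _ => ω) ht measurable_const measurable_fst)
    (hI.measurable_backwardMean ω hF ht measurable_snd (measurable_snd.comp measurable_fst))

/-- A `flow` whose integrand involves the reference path through its last two states. -/
theorem flow_eq_lintegral {t : ℕ} (ht : t ≤ T) (ω : Ω) {g : State D → State D → ℝ≥0∞}
    (ψ : State D → System D N → ℝ≥0∞)
    (hψ : ∀ y, Measurable (ψ y)) :
    flow (I ω) T t (fun h => g (h.parent t (h.k t)) (h.x t (h.k t)) * ψ (h.x t (h.k t)) h) =
      ∫⁻ x : StatePath D t, massProd (I ω) T t (ext x) * (g (ext x (t - 1)) (ext x t) *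
        ∫⁻ h, ψ (ext x t) h ∂forwardNat (I ω) (ext x) t) := by
  refine lintegral_congr fun x => congrArg _ ?_
  rw [← lintegral_const_mul _ (hψ _)]
  refine lintegral_congr_ae ?_
  filter_upwards [hI.ae_forwardNat (N := N) ht ω (ext_zero x)] with h hh
  rw [hh.1, hh.2]

/-- The state at time `t + 1` is now that of the reference path, so it can be fixed and counted
among the later states, where `ih` applies. The statement does not refer to how the index at `t + 1`
was drawn, so it serves both for backward draws and for the forced move at the horizon. -/
theorem lintegral_backwardMean_update {t : ℕ} (ht : t + 1 ≤ T) (ω : Ω)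
    {F : (ℕ → State D) → ℝ≥0∞} (hF : Measurable F) (z : ℕ → State D)
    (ih : ∀ z : ℕ → State D, ∫⁻ x : StatePath D t, massProd (I ω) T t (ext x) *
        (future (I ω) T t (ext x (t - 1)) (ext x t) z *
          ∫⁻ h : System D N, backwardMean (I ω) T F t h z ∂forwardNat (I ω) (ext x) t) =
      ∫⁻ x : StatePath D t, massProd (I ω) T t (ext x) *
        (future (I ω) T t (ext x (t - 1)) (ext x t) z * F (splice t (ext x) z))) :
    ∫⁻ x : StatePath D (t + 1), massProd (I ω) T (t + 1) (ext x) *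
        (future (I ω) T (t + 1) (ext x t) (ext x (t + 1)) z * ∫⁻ h : System D N,
          backwardMean (I ω) T F t h (Function.update z (t + 1) (ext x (t + 1)))
            ∂forwardNat (I ω) (ext x) (t + 1)) =
      ∫⁻ x : StatePath D (t + 1), massProd (I ω) T (t + 1) (ext x) *
        (future (I ω) T (t + 1) (ext x t) (ext x (t + 1)) z * F (splice (t + 1) (ext x) z)) := by
  simp only [hI.lintegral_forwardNat_backwardMean ht ω hF]
  have hsplice : ∀ s, Measurable (Function.uncurry fun y z : ℕ → State D =>
      F (splice s y z)) := fun s => hF.comp (measurable_splice s)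
  have hmean := hI.measurable_lintegral_backwardMean (N := N) ω hF (t := t) (by omega)
  have hL := hI.lintegral_future_succ ω t z (Ψ' := fun y z => ∫⁻ h : System D N,
      backwardMean (I ω) T F t h (Function.update z (t + 1) (y (t + 1)))
        ∂forwardNat (I ω) y t) hmean (hmean.comp (measurable_id.prodMk
          (measurable_update_param measurable_const (measurable_pi_apply _) _)))
    fun y w hy => by
      rw [Function.update_self, forwardNat_congr (y' := y) _ fun s hs =>
        Function.update_of_ne (by omega) _ _]
  have hR := hI.lintegral_future_succ ω t z (Ψ' := fun y z => F (splice (t + 1) y z)) (hsplice t)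
    ((hsplice (t + 1)).comp (measurable_id.prodMk measurable_const))
    fun y w hy => congrArg F (splice_update t y z w)
  refine hL.trans (Eq.trans ?_ hR.symm)
  exact lintegral_congr fun w => congrArg _ (ih _)

/-- Backward sampling up to time `t`, given later states, reproduces the target. -/
theorem lintegral_backwardMean {t : ℕ} (ht : t ≤ T) (ω : Ω) {F : (ℕ → State D) → ℝ≥0∞}
    (hF : Measurable F) (z : ℕ → State D) :
    ∫⁻ x : StatePath D t, massProd (I ω) T t (ext x) *
        (future (I ω) T t (ext x (t - 1)) (ext x t) z *
          ∫⁻ h : System D N, backwardMean (I ω) T F t h z ∂forwardNat (I ω) (ext x) t) =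
      ∫⁻ x : StatePath D t, massProd (I ω) T t (ext x) *
        (future (I ω) T t (ext x (t - 1)) (ext x t) z * F (splice t (ext x) z)) := by
  induction t generalizing z with
  | zero =>
    refine lintegral_congr fun x => ?_
    have hs : splice 0 (ext x) z = z := by
      funext s
      rw [splice, if_neg (by omega)]
    simp only [forwardNat, backwardMean, hs, lintegral_const, measure_univ, mul_one]
  | succ t ih =>
    have hupd : ∀ k, Measurable fun h : System D N =>
        backwardMean (I ω) T F t h (Function.update z (t + 1) (h.x (t + 1) k)) := fun k =>
      hI.measurable_backwardMean ω hF (by omega) measurable_id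
        (measurable_update_param measurable_const
          (measurable_particle measurable_id measurable_const _) _)
    have h1 := hI.flow_eq_lintegral ht ω (g := fun p q => future (I ω) T (t + 1) p q z)
      (fun _ h => backwardMean (I ω) T F (t + 1) h z)
      fun _ => hI.measurable_backwardMean (N := N) ω hF ht measurable_id measurable_const
    have h2 := hI.flow_eq_lintegral ht ω (g := fun p q => future (I ω) T (t + 1) p q z)
      (fun q h => backwardMean (I ω) T F t h (Function.update z (t + 1) q))
      fun _ => hI.measurable_backwardMean (N := N) ω hF (by omega) measurable_id measurable_const
    have h3 := hI.flow_backwardProb (by omega) ht ω z hupd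
    simp only [backwardMean_core] at h3
    -- Redrawing the index at time `t + 1` leaves the reweighted law of the position unchanged, so
    -- the drawn particle may be taken to be the reference state.
    refine h1.symm.trans (h3.trans (h2.trans ?_))
    exact hI.lintegral_backwardMean_update ht ω hF z (ih (by omega))

/-- The conditional sequential Monte Carlo update leaves the distribution with density `massProd`
invariant. -/
theorem lintegral_massProd_csmc (hT : 1 ≤ T) (hN : 1 ≤ N) (ω : Ω) {f : StatePath D T → ℝ≥0∞}
    (hf : Measurable f) :
    ∫⁻ x : StatePath D T, massProd (I ω) T T (ext x) * ∫⁻ y, f y ∂csmc (I ω) N x =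
      ∫⁻ x : StatePath D T, massProd (I ω) T T (ext x) * f x := by
  have htT : T ∈ Finset.Icc 1 T := by simp; omega
  let F : (ℕ → State D) → ℝ≥0∞ := fun z => f fun i => z (i + 1)
  have hF : Measurable F := hf.comp (measurable_pi_lambda _ fun i => measurable_pi_apply _)
  have hFloc : ∀ z z' : ℕ → State D, (∀ s, 1 ≤ s → s ≤ T → z s = z' s) → F z = F z' := by
    intro z z' hz
    exact congrArg f (funext fun i => hz _ (by omega) (by omega))
  let φ : System D N → Fin (N + 1) → ℝ≥0∞ := fun h i =>
    backwardMean (I ω) T F (T - 1) h (Function.update 0 T (h.x T i))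
  have hφ : ∀ k, Measurable fun h => φ h k := fun k =>
    hI.measurable_backwardMean ω hF (by omega) measurable_id
      (measurable_update_param measurable_const
        (measurable_particle measurable_id measurable_const _) _)
  have hφcore : ∀ h k, φ h.core k = φ h k := fun h k => backwardMean_core _ _ _ _ _
  have hcs : ∀ x : StatePath D T, ∫⁻ y, f y ∂csmc (I ω) N x =
      ∫⁻ h : System D N, (∫⁻ i, φ h i ∂forcedMove (weight (I ω) h T) (h.k T))
        ∂forwardNat (I ω) (ext x) T := by
    intro x
    rw [hI.lintegral_csmc hT hN ω x hf]
    refine lintegral_congr fun h => ?_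
    have := hI.lintegral_backward ω hF h (r := T - 1) (by omega)
    rw [Nat.sub_self] at this
    refine Eq.trans this ?_
    rw [finalIndex_eq]
    refine lintegral_congr fun i => ?_
    refine backwardMean_congr_path _ hFloc _ _ fun s hs hs' => ?_
    obtain rfl : s = T := by omega
    simp [System.trace]
  have hfm : ∀ k, Measurable fun h : System D N =>
      ∫⁻ i, φ h i ∂forcedMove (weight (I ω) h T) k := by
    intro k
    have := fun h : System D N => isProbabilityMeasure_forcedMove hN
      (hI.weight_ne_zero htT ω h) (hI.sum_weight htT ω h) k
    exact measurable_lintegral_param (measurable_forcedMove hN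
      (fun h => hI.weight_ne_zero htT ω h) (fun h => hI.sum_weight htT ω h)
      (fun i => hI.measurable_weight (v := fun _ => ω) htT measurable_const measurable_id i) k)
      (measurable_from_prod_countable_left hφ)
  -- The position at time `T` has law `W_T`, which the forced move preserves; the moved index may be
  -- replaced by the position itself.
  have hstep : flow (I ω) T T (fun h : System D N =>
      ∫⁻ i, φ h i ∂forcedMove (weight (I ω) h T) (h.k T)) =
        flow (I ω) T T fun h => φ h (h.k T) := by
    have hL := hI.flow_position hT le_rfl ω hfm
    have hR := hI.flow_position hT le_rfl ω hφ
    simp only [hφcore] at hL hR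
    refine hL.trans (Eq.trans ?_ hR.symm)
    congr 1
    funext h
    exact sum_mul_lintegral_forcedMove hN (hI.weight_ne_zero htT ω h) (hI.sum_weight htT ω h) _
  have hfin := hI.flow_eq_lintegral le_rfl ω (g := fun _ _ => 1)
    (fun q (h : System D N) => backwardMean (I ω) T F (T - 1) h (Function.update 0 T q))
    fun q => hI.measurable_backwardMean ω hF (by omega) measurable_id measurable_const
  simp only [one_mul] at hfin
  -- The zero path serves as the later states: there are none after `T`, and `future` at the horizon
  -- equals `1`.
  have hupd := hI.lintegral_backwardMean_update (N := N) (t := T - 1) (by omega) ω hF 0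
    (hI.lintegral_backwardMean (by omega) ω hF)
  rw [Nat.sub_add_cancel hT] at hupd
  have hfut : ∀ x y, future (I ω) T T x y 0 = 1 := fun x y => by
    rw [future, mass, mass, if_neg (by omega), if_neg (by omega), mul_one]
  have hFx : ∀ x : StatePath D T, F (splice T (ext x) 0) = f x := by
    intro x
    refine congrArg f (funext fun i => ?_)
    rw [splice, if_pos (by omega), ext_succ]
  simp only [hfut, hFx, one_mul] at hupd
  simp only [hcs]
  exact hstep.trans (hfin.trans hupd)

end Regular

/-! ### From conditional SMC given `u` to the auxiliary-variable kernel. -/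

theorem prod_Icc_one_eq_prod_fin (T : ℕ) (f : ℕ → ℝ≥0∞) :
    ∏ s ∈ Finset.Icc 1 T, f s = ∏ i : Fin T, f (i + 1) := by
  rw [Fin.prod_univ_eq_prod_range (fun i => f (i + 1)) T]
  induction T with
  | zero => simp
  | succ T ih => rw [Finset.prod_Icc_succ_top (by omega), Finset.prod_range_succ, ih]

/-- An auxiliary-variable update: if the density of `(x, u)` factorises as the target of the
conditional sequential Monte Carlo update given `u`, then drawing `u` given `x` and updating `x`
given `u` leaves the marginal distribution of `x` invariant. -/
theorem Regular.inducesInvariantKernel {D T N : ℕ} {I : StatePath D T → Ingredients D}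
    (hI : Regular I T) (hT : 1 ≤ T) (hN : 1 ≤ N) {g : StatePath D T → Fin T → State D → ℝ≥0∞}
    (hg : ∀ i, Measurable fun p : StatePath D T × State D => g p.1 i p.2)
    (hg1 : ∀ x i, ∫⁻ u, g x i u = 1) {γ : StatePath D T → ℝ≥0∞} (hγ : Measurable γ)
    (hfac : ∀ u x, massProd (I u) T T (ext x) = γ x * ∏ i, g x i (u i)) (c : ℝ≥0∞) :
    InducesInvariantKernel
      (fun x => (Measure.pi fun i => lawOf (g x i)).bind fun u => csmc (I u) N x)
      (c • (volume : Measure (StatePath D T)).withDensity γ) := by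
  have hlaw : ∀ i x, IsProbabilityMeasure (lawOf (g x i)) := fun i x =>
    isProbabilityMeasure_lawOf (hg1 x i)
  have haux : Measurable fun x => Measure.pi fun i => lawOf (g x i) :=
    measurable_measure_pi fun i => measurable_lawOf (hg i)
  have hcs : ∀ x, Measurable fun u => csmc (I u) N x := fun x =>
    hI.measurable_csmc hT hN measurable_id measurable_const
  have hmeas : Measurable fun x =>
      (Measure.pi fun i => lawOf (g x i)).bind fun u => csmc (I u) N x :=
    measurable_bind_param haux (hI.measurable_csmc hT hN measurable_snd measurable_fst)
  refine ⟨⟨_, hmeas⟩, ⟨fun x => ?_⟩, fun x => rfl, ?_⟩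
  · exact isProbabilityMeasure_bind (hcs x) fun u => hI.isProbabilityMeasure_csmc hT hN u x
  have hprod : Measurable fun p : StatePath D T × StatePath D T => ∏ i, g p.1 i (p.2 i) :=
    Finset.measurable_prod _ fun i _ =>
      (hg i).comp (measurable_fst.prodMk ((measurable_pi_apply i).comp measurable_snd))
  have hprod1 : ∀ x, ∫⁻ u : StatePath D T, ∏ i, g x i (u i) = 1 := fun x => by
    have hm : ∀ i, Measurable (g x i) := fun i => (hg i).comp measurable_prodMk_left
    rw [lintegral_fin_prod T hm]
    simp [hg1]
  change Measure.bind (c • _) _ = c • _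
  -- Invariance is homogeneous in the measure, so the normalising constant can be dropped.
  rw [Measure.bind_smul]
  congr 1
  refine Measure.ext fun s hs => ?_
  rw [Measure.bind_apply hs (Kernel.measurable _).aemeasurable, withDensity_apply _ hs]
  refine (lintegral_withDensity_eq_lintegral_mul _ hγ
    ((Measure.measurable_coe hs).comp hmeas)).trans ?_
  have hval : ∀ x, ((Measure.pi fun i => lawOf (g x i)).bind fun u => csmc (I u) N x) s =
      ∫⁻ u : StatePath D T, (∏ i, g x i (u i)) * csmc (I u) N x s := by
    intro x
    have hm : ∀ i, Measurable (g x i) := fun i => (hg i).comp measurable_prodMk_left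
    rw [Measure.bind_apply hs (hcs x).aemeasurable, pi_lawOf hm (hg1 x)]
    exact lintegral_withDensity_eq_lintegral_mul _ (hprod.comp measurable_prodMk_left)
      ((Measure.measurable_coe hs).comp (hcs x))
  have hjoint : Measurable (Function.uncurry fun (x u : StatePath D T) =>
      γ x * ((∏ i, g x i (u i)) * csmc (I u) N x s)) :=
    (hγ.comp measurable_fst).mul (hprod.mul ((Measure.measurable_coe hs).comp
      (hI.measurable_csmc hT hN measurable_snd measurable_fst)))
  have hjoint' : Measurable (Function.uncurry fun (u x : StatePath D T) =>
      γ x * (∏ i, g x i (u i)) * s.indicator 1 x) :=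
    ((hγ.comp measurable_snd).mul (hprod.comp measurable_swap)).mul
      ((measurable_one.indicator hs).comp measurable_snd)
  -- For fixed `u` the joint density is the target of the conditional SMC update, whose invariance
  -- is tested on the indicator of `s`.
  have hinv : ∀ u, ∫⁻ x, γ x * ((∏ i, g x i (u i)) * csmc (I u) N x s) =
      ∫⁻ x, γ x * (∏ i, g x i (u i)) * s.indicator 1 x := by
    intro u
    have := hI.lintegral_massProd_csmc hT hN u (measurable_one.indicator hs)
    simpa only [lintegral_indicator_one hs, hfac, mul_assoc] using this
  calc ∫⁻ x, γ x * ((Measure.pi fun i => lawOf (g x i)).bind fun u => csmc (I u) N x) s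
      = ∫⁻ x, ∫⁻ u : StatePath D T, γ x * ((∏ i, g x i (u i)) * csmc (I u) N x s) := by
        refine lintegral_congr fun x => ?_
        rw [hval, lintegral_const_mul]
        exact (hprod.comp measurable_prodMk_left).mul ((Measure.measurable_coe hs).comp (hcs x))
    _ = ∫⁻ u : StatePath D T, ∫⁻ x, γ x * (∏ i, g x i (u i)) * s.indicator 1 x := by
        rw [lintegral_lintegral_swap hjoint.aemeasurable]
        exact lintegral_congr hinv
    _ = ∫⁻ x, ∫⁻ u : StatePath D T, γ x * (∏ i, g x i (u i)) * s.indicator 1 x :=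
        lintegral_lintegral_swap hjoint'.aemeasurable
    _ = ∫⁻ x in s, γ x := by
        rw [← lintegral_indicator hs]
        refine lintegral_congr fun x => ?_
        have h1 : Measurable fun u : StatePath D T => ∏ i, g x i (u i) :=
          hprod.comp measurable_prodMk_left
        rw [lintegral_mul_const _ (h1.const_mul _), lintegral_const_mul _ h1, hprod1]
        by_cases hx : x ∈ s <;> simp [hx]

/-! ### Admissible models: gradients, potentials and the factorisation of the joint density. -/

/-- Standing assumptions on the model and the tuning parameters. -/
structure Admissible {D : ℕ} (𝓜 : Model D) (θ : Tuning D) (T : ℕ) : Prop where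
  measurable_m : ∀ t ∈ Finset.Icc 1 T, Measurable (𝓜.m t)
  measurable_C : ∀ t ∈ Finset.Icc 1 T, ∀ i j, Measurable fun x => 𝓜.C t x i j
  posDef_C : ∀ t ∈ Finset.Icc 1 T, ∀ x, (𝓜.C t x).PosDef
  G_pos : ∀ t ∈ Finset.Icc 1 T, ∀ x y, 0 < 𝓜.G t x y
  differentiable_G : ∀ t ∈ Finset.Icc 1 T,
    Differentiable ℝ fun p : State D × State D => 𝓜.G t p.1 p.2
  δ_pos : ∀ t ∈ Finset.Icc 1 T, 0 < θ.δ t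
  measurable_pre : ∀ t ∈ Finset.Icc 1 T, ∀ i j, Measurable fun x => θ.pre t x i j

/-- A measurable family of positive and finite proposal densities. -/
structure Proposal.Regular {D T : ℕ} (M' : Proposal D T) : Prop where
  measurable : ∀ t ∈ Finset.Icc 1 T,
    Measurable fun p : StatePath D T × State D × State D => M' p.1 t p.2.1 p.2.2
  ne_zero : ∀ t ∈ Finset.Icc 1 T, ∀ u x y, M' u t x y ≠ 0
  ne_top : ∀ t ∈ Finset.Icc 1 T, ∀ u x y, M' u t x y ≠ ∞
  lintegral : ∀ t ∈ Finset.Icc 1 T, ∀ u x, ∫⁻ y, M' u t x y = 1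

/-- Joint continuity of `f` suffices; nothing is asked of the gradient, which need not be continuous
when `G` is merely differentiable. -/
theorem measurable_gradient_param {α E : Type*} [TopologicalSpace α] [MeasurableSpace α]
    [OpensMeasurableSpace α] [NormedAddCommGroup E] [InnerProductSpace ℝ E] [CompleteSpace E]
    [LocallyCompactSpace E] [MeasurableSpace E] [BorelSpace E] {f : α → E → ℝ}
    (hf : Continuous (Function.uncurry f)) :
    Measurable fun p : α × E => gradient (f p.1) p.2 :=
  (InnerProductSpace.toDual ℝ E).symm.continuous.measurable.comp
    (measurable_fderiv_with_param ℝ hf)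

theorem gradient_const_add {E : Type*} [NormedAddCommGroup E] [InnerProductSpace ℝ E]
    [CompleteSpace E] (f : E → ℝ) (c : ℝ) (y : E) :
    gradient (fun z => c + f z) y = gradient f y := by
  rw [gradient, gradient, fderiv_const_add]

section Paths

variable {D T : ℕ}

theorem succ_mem_Icc (i : Fin T) : (i : ℕ) + 1 ∈ Finset.Icc 1 T :=
  Finset.mem_Icc.2 ⟨by omega, i.2⟩

theorem ext_update (x : StatePath D T) (i : Fin T) (y : State D) :
    ext (Function.update x i y) = Function.update (ext x) (i + 1) y := by
  funext s
  rcases eq_or_ne s (i + 1) with rfl | hs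
  · rw [ext_succ, Function.update_self, Function.update_self]
  · rw [Function.update_of_ne hs]
    by_cases h : 1 ≤ s ∧ s ≤ T
    · rw [ext, ext, dif_pos h, dif_pos h, Function.update_of_ne]
      intro he
      have : s - 1 = i := congrArg Fin.val he
      omega
    · rw [ext, ext, dif_neg h, dif_neg h]

end Paths

namespace Admissible

variable {D T : ℕ} {𝓜 : Model D} {θ : Tuning D} (hA : Admissible 𝓜 θ T)
  {α : Type*} [MeasurableSpace α]
include hA

theorem continuous_logG {t : ℕ} (ht : t ∈ Finset.Icc 1 T) :
    Continuous fun p : State D × State D => Real.log (𝓜.G t p.1 p.2) :=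
  (hA.differentiable_G t ht).continuous.log fun p => (hA.G_pos t ht p.1 p.2).ne'

theorem measurable_G {t : ℕ} (ht : t ∈ Finset.Icc 1 T) :
    Measurable fun p : State D × State D => 𝓜.G t p.1 p.2 :=
  (hA.differentiable_G t ht).continuous.measurable

theorem measurable_filterGrad {t : ℕ} (ht : t ∈ Finset.Icc 1 T) :
    Measurable fun p : State D × State D => 𝓜.filterGrad t p.1 p.2 :=
  measurable_gradient_param (f := fun x y' => Real.log (𝓜.G t x y')) (hA.continuous_logG ht)

theorem measurable_smoothGradLocal {t : ℕ} (ht : t ∈ Finset.Icc 1 T)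
    (ht' : t + 1 ∈ Finset.Icc 1 T) :
    Measurable fun p : State D × State D × State D => 𝓜.smoothGradLocal t p.1 p.2.1 p.2.2 := by
  have hc : Continuous (Function.uncurry fun (q : State D × State D) (y' : State D) =>
      Real.log (𝓜.G t q.1 y') + Real.log (𝓜.G (t + 1) y' q.2)) :=
    ((hA.continuous_logG ht).comp (f := fun p : (State D × State D) × State D => (p.1.1, p.2))
      (by fun_prop)).add ((hA.continuous_logG ht').comp
        (f := fun p : (State D × State D) × State D => (p.2, p.1.2)) (by fun_prop))
  exact (measurable_gradient_param hc).comp ((measurable_fst.prodMk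
    (measurable_snd.comp measurable_snd)).prodMk (measurable_fst.comp measurable_snd))

theorem log_prod_G (y : ℕ → State D) :
    Real.log (∏ s ∈ Finset.Icc 1 T, 𝓜.G s (y (s - 1)) (y s)) =
      ∑ s ∈ Finset.Icc 1 T, Real.log (𝓜.G s (y (s - 1)) (y s)) :=
  Real.log_prod fun s hs => (hA.G_pos s hs _ _).ne'

/-- Only the factors of `G_{1:T}` at the two adjacent time steps involve the state being varied; the
logarithms of the others add up to a constant. Coordinate `i` is the state at time `i + 1`. -/
theorem smoothGrad_eq_local (x : StatePath D T) (i : Fin T) (hi : (i : ℕ) + 1 < T) :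
    𝓜.smoothGrad x i =
      𝓜.smoothGradLocal (i + 1) (ext x i) (ext x (i + 1)) (ext x (i + 2)) := by
  have h1 := succ_mem_Icc i
  have h2 : (i : ℕ) + 2 ∈ (Finset.Icc 1 T).erase (i + 1) := by simp; omega
  rw [Model.smoothGrad, Model.smoothGradLocal, ext_succ]
  refine Eq.trans ?_ (gradient_const_add _
    (∑ s ∈ ((Finset.Icc 1 T).erase ((i : ℕ) + 1)).erase ((i : ℕ) + 2),
      Real.log (𝓜.G s (ext x (s - 1)) (ext x s))) _)
  congr 1
  funext y
  simp only [ext_update]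
  have hsum : ∀ s ∈ ((Finset.Icc 1 T).erase (i + 1)).erase (i + 2),
      Real.log (𝓜.G s (Function.update (ext x) (i + 1) y (s - 1))
        (Function.update (ext x) (i + 1) y s)) = Real.log (𝓜.G s (ext x (s - 1)) (ext x s)) := by
    intro s hs
    have ha := Finset.ne_of_mem_erase hs
    have hb := Finset.ne_of_mem_erase (Finset.mem_of_mem_erase hs)
    rw [Function.update_of_ne hb, Function.update_of_ne (by omega)]
  have e1 : (i : ℕ) + 2 - 1 = i + 1 := by omega
  rw [hA.log_prod_G, ← Finset.add_sum_erase _ _ h1, ← Finset.add_sum_erase _ _ h2,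
    Finset.sum_congr rfl hsum, Nat.add_sub_cancel, e1, Function.update_self,
    Function.update_of_ne (by omega), Function.update_of_ne (by omega)]
  ring

theorem smoothGrad_eq_filterGrad (x : StatePath D T) (i : Fin T) (hi : (i : ℕ) + 1 = T) :
    𝓜.smoothGrad x i = 𝓜.filterGrad (i + 1) (ext x i) (ext x (i + 1)) := by
  have h1 := succ_mem_Icc i
  rw [Model.smoothGrad, Model.filterGrad, ext_succ]
  refine Eq.trans ?_ (gradient_const_add _ (∑ s ∈ (Finset.Icc 1 T).erase ((i : ℕ) + 1),
    Real.log (𝓜.G s (ext x (s - 1)) (ext x s))) _)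
  congr 1
  funext y
  simp only [ext_update]
  have hsum : ∀ s ∈ (Finset.Icc 1 T).erase (i + 1),
      Real.log (𝓜.G s (Function.update (ext x) (i + 1) y (s - 1))
        (Function.update (ext x) (i + 1) y s)) = Real.log (𝓜.G s (ext x (s - 1)) (ext x s)) := by
    intro s hs
    have ha := Finset.ne_of_mem_erase hs
    have hb := Finset.mem_Icc.1 (Finset.mem_of_mem_erase hs)
    rw [Function.update_of_ne ha, Function.update_of_ne (by omega)]
  rw [hA.log_prod_G, ← Finset.add_sum_erase _ _ h1, Finset.sum_congr rfl hsum,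
    Nat.add_sub_cancel, Function.update_self, Function.update_of_ne (by omega)]
  ring

theorem measurable_smoothGrad (i : Fin T) : Measurable fun x : StatePath D T =>
    𝓜.smoothGrad x i := by
  have h1 := succ_mem_Icc i
  have hx : ∀ t, Measurable fun x : StatePath D T => ext x t := measurable_ext T
  rcases Nat.lt_or_ge ((i : ℕ) + 1) T with hi | hi
  · simp only [hA.smoothGrad_eq_local _ i hi]
    have h2 : (i : ℕ) + 1 + 1 ∈ Finset.Icc 1 T := Finset.mem_Icc.2 ⟨by omega, hi⟩
    exact Measurable.comp (f := fun x : StatePath D T =>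
      (ext x (i : ℕ), ext x ((i : ℕ) + 1), ext x ((i : ℕ) + 2)))
      (hA.measurable_smoothGradLocal h1 h2) (hx _ |>.prodMk ((hx _).prodMk (hx _)))
  · simp only [hA.smoothGrad_eq_filterGrad _ i (by omega)]
    exact Measurable.comp (f := fun x : StatePath D T => (ext x (i : ℕ), ext x ((i : ℕ) + 1)))
      (hA.measurable_filterGrad h1) ((hx _).prodMk (hx _))

theorem measurable_M {t : ℕ} (ht : t ∈ Finset.Icc 1 T) {x y : α → State D} (hx : Measurable x)
    (hy : Measurable y) : Measurable fun a => 𝓜.M t (x a) (y a) :=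
  measurable_gaussPDF ((hA.measurable_m t ht).comp hx) hy fun i j =>
    (hA.measurable_C t ht i j).comp hx

theorem measurable_Q {t : ℕ} (ht : t ∈ Finset.Icc 1 T) {x y : α → State D} (hx : Measurable x)
    (hy : Measurable y) : Measurable fun a => 𝓜.Q t (x a) (y a) :=
  (hA.measurable_M ht hx hy).mul
    (ENNReal.measurable_ofReal.comp ((hA.measurable_G ht).comp (hx.prodMk hy)))

theorem measurable_gamma : Measurable fun x : StatePath D T => 𝓜.gamma x :=
  Finset.measurable_prod _ fun _ ht => hA.measurable_Q ht (measurable_ext T _) (measurable_ext T _)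

theorem Q_ne_zero {t : ℕ} (ht : t ∈ Finset.Icc 1 T) (x y : State D) : 𝓜.Q t x y ≠ 0 :=
  mul_ne_zero (gaussPDF_pos _ _ (hA.posDef_C t ht x)) (by simpa using hA.G_pos t ht x y)

omit hA in
theorem Q_ne_top (t : ℕ) (x y : State D) : 𝓜.Q t x y ≠ ∞ :=
  ENNReal.mul_ne_top (gaussPDF_ne_top _ _ _) ENNReal.ofReal_ne_top

theorem posDef_auxCov {t : ℕ} (ht : t ∈ Finset.Icc 1 T) (x : State D) :
    (auxCov 𝓜 θ t x).PosDef :=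
  (hA.posDef_C t ht x).smul (half_pos (hA.δ_pos t ht))

theorem measurable_auxCov {t : ℕ} (ht : t ∈ Finset.Icc 1 T) {x : α → State D} (hx : Measurable x)
    (i j : Fin D) : Measurable fun a => auxCov 𝓜 θ t (x a) i j :=
  ((hA.measurable_C t ht i j).comp hx).const_mul _

theorem measurable_auxDensity {t : ℕ} (ht : t ∈ Finset.Icc 1 T) {x y g u : α → State D}
    (hx : Measurable x) (hy : Measurable y) (hg : Measurable g) (hu : Measurable u) :
    Measurable fun a => gaussPDF (auxMean θ t (x a) (y a) (g a)) (auxCov 𝓜 θ t (x a)) (u a) :=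
  measurable_gaussPDF (hy.add ((measurable_act (A := fun a => θ.pre t (x a))
    (fun i j => (hA.measurable_pre t ht i j).comp hx) hg).const_smul (θ.κ * (θ.δ t / 2)))) hu
    (hA.measurable_auxCov ht hx)

theorem measurable_potential {M' : Proposal D T} (hM : M'.Regular) {t : ℕ}
    (ht : t ∈ Finset.Icc 1 T) {u : α → StatePath D T} {x y : α → State D} (hu : Measurable u)
    (hx : Measurable x) (hy : Measurable y) :
    Measurable fun a => potential 𝓜 θ M' (u a) t (x a) (y a) :=
  ((hA.measurable_Q ht hx hy).mul (hA.measurable_auxDensity ht hx hy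
    ((hA.measurable_filterGrad ht).comp (hx.prodMk hy)) ((measurable_ext T t).comp hu))).div
      ((hM.measurable t ht).comp (hu.prodMk (hx.prodMk hy)))

theorem potential_ne_zero {M' : Proposal D T} (hM : M'.Regular) {t : ℕ} (ht : t ∈ Finset.Icc 1 T)
    (u : StatePath D T) (x y : State D) : potential 𝓜 θ M' u t x y ≠ 0 :=
  ENNReal.div_ne_zero.2 ⟨mul_ne_zero (hA.Q_ne_zero ht x y)
    (gaussPDF_pos _ _ (hA.posDef_auxCov ht x)), hM.ne_top t ht u x y⟩

omit hA in
theorem potential_ne_top {M' : Proposal D T} (hM : M'.Regular) {t : ℕ} (ht : t ∈ Finset.Icc 1 T)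
    (u : StatePath D T) (x y : State D) : potential 𝓜 θ M' u t x y ≠ ∞ :=
  ENNReal.div_ne_top (ENNReal.mul_ne_top (Q_ne_top t x y) (gaussPDF_ne_top _ _ _))
    (hM.ne_zero t ht u x y)

omit hA in
theorem semigroup_eq {M' : Proposal D T} (hM : M'.Regular) {t : ℕ} (ht : t ∈ Finset.Icc 1 T)
    (u : StatePath D T) (x y : State D) : M' u t x y * potential 𝓜 θ M' u t x y =
      𝓜.Q t x y * gaussPDF (auxMean θ t x y (𝓜.filterGrad t x y)) (auxCov 𝓜 θ t x) (ext u t) :=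
  ENNReal.mul_div_cancel (hM.ne_zero t ht u x y) (hM.ne_top t ht u x y)

theorem regular_filter {M' : Proposal D T} (hM : M'.Regular) :
    Regular (filterIngredients 𝓜 θ M') T where
  measurable_prop := hM.measurable
  prop_ne_zero := hM.ne_zero
  prop_ne_top := hM.ne_top
  lintegral_prop := hM.lintegral
  measurable_wt t ht := by
    have hx : Measurable fun p : StatePath D T × State D × State D × State D => p.2.2.1 := by
      fun_prop
    have hy : Measurable fun p : StatePath D T × State D × State D × State D => p.2.2.2 := by
      fun_prop
    exact hA.measurable_potential hM ht measurable_fst hx hy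
  wt_ne_zero t ht u _ x y := hA.potential_ne_zero hM ht u x y
  wt_ne_top t ht u _ x y := potential_ne_top hM ht u x y
  measurable_back t h1 hT := by
    have ht : t + 1 ∈ Finset.Icc 1 T := by simp; omega
    have hy : Measurable fun p : StatePath D T × State D × State D × State D × State D =>
      p.2.2.1 := by fun_prop
    have hz : Measurable fun p : StatePath D T × State D × State D × State D × State D =>
      p.2.2.2.1 := by fun_prop
    exact ((hM.measurable _ ht).comp (measurable_fst.prodMk (hy.prodMk hz))).mul
      (hA.measurable_potential hM ht measurable_fst hy hz)
  back_factor t h1 hT u z z' := by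
    have ht : t + 1 ∈ Finset.Icc 1 T := by simp; omega
    -- Filtering weights ignore the grandparent, so the factor at time `t + 2` does not involve the
    -- candidate at time `t` and is the required constant. The `0` stands for that ignored argument.
    refine ⟨mass (filterIngredients 𝓜 θ M' u) T (t + 2) 0 z z', ?_, ?_, fun x y => ?_⟩
    · unfold mass
      split_ifs with h
      · have ht2 : t + 2 ∈ Finset.Icc 1 T := by simp; omega
        exact mul_ne_zero (hM.ne_zero _ ht2 _ _ _) (hA.potential_ne_zero hM ht2 _ _ _)
      · exact one_ne_zero
    · unfold mass
      split_ifs with h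
      · have ht2 : t + 2 ∈ Finset.Icc 1 T := by simp; omega
        exact ENNReal.mul_ne_top (hM.ne_top _ ht2 _ _ _) (potential_ne_top hM ht2 _ _ _)
      · exact ENNReal.one_ne_top
    · simp only [mass, if_pos (show t + 1 ≤ T by omega)]
      rfl

theorem measurable_potentialPlus {M' : Proposal D T} (hM : M'.Regular) {t : ℕ}
    (ht : t ∈ Finset.Icc 1 T) {u : α → StatePath D T} {w x y : α → State D} (hu : Measurable u)
    (hw : Measurable w) (hx : Measurable x) (hy : Measurable y) :
    Measurable fun a => potentialPlus 𝓜 θ M' (u a) t (w a) (x a) (y a) := by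
  unfold potentialPlus
  refine (hA.measurable_potential hM ht hu hx hy).mul ?_
  split_ifs with h2
  · have ht1 : t - 1 ∈ Finset.Icc 1 T := by simp at ht ⊢; omega
    have ht2 : t - 1 + 1 ∈ Finset.Icc 1 T := by simp at ht ⊢; omega
    exact (hA.measurable_auxDensity ht1 hw hx ((hA.measurable_smoothGradLocal ht1 ht2).comp
      (hw.prodMk (hx.prodMk hy))) ((measurable_ext T _).comp hu)).div
      (hA.measurable_auxDensity ht1 hw hx ((hA.measurable_filterGrad ht1).comp (hw.prodMk hx))
        ((measurable_ext T _).comp hu))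
  · exact measurable_const

theorem potentialPlus_ne_zero {M' : Proposal D T} (hM : M'.Regular) {t : ℕ}
    (ht : t ∈ Finset.Icc 1 T) (u : StatePath D T) (w x y : State D) :
    potentialPlus 𝓜 θ M' u t w x y ≠ 0 := by
  refine mul_ne_zero (hA.potential_ne_zero hM ht u x y) ?_
  split_ifs with h2
  · exact ENNReal.div_ne_zero.2 ⟨gaussPDF_pos _ _
      (hA.posDef_auxCov (by simp at ht ⊢; omega) w), gaussPDF_ne_top _ _ _⟩
  · exact one_ne_zero

theorem potentialPlus_ne_top {M' : Proposal D T} (hM : M'.Regular) {t : ℕ}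
    (ht : t ∈ Finset.Icc 1 T) (u : StatePath D T) (w x y : State D) :
    potentialPlus 𝓜 θ M' u t w x y ≠ ∞ := by
  refine ENNReal.mul_ne_top (potential_ne_top hM ht u x y) ?_
  split_ifs with h2
  · exact ENNReal.div_ne_top (gaussPDF_ne_top _ _ _) (gaussPDF_pos _ _
      (hA.posDef_auxCov (by simp at ht ⊢; omega) w))
  · exact ENNReal.one_ne_top

theorem measurable_semigroupPlus {M' : Proposal D T} (hM : M'.Regular) {t : ℕ}
    (ht : 1 ≤ t) {u : α → StatePath D T} {w x y : α → State D} (hu : Measurable u)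
    (hw : Measurable w) (hx : Measurable x) (hy : Measurable y) :
    Measurable fun a => semigroupPlus 𝓜 θ M' (u a) t (w a) (x a) (y a) := by
  unfold semigroupPlus
  split_ifs with h
  · have := Finset.mem_Icc.2 ⟨ht, h⟩
    exact ((hM.measurable t this).comp (hu.prodMk (hx.prodMk hy))).mul
      (hA.measurable_potentialPlus hM this hu hw hx hy)
  · exact measurable_const

theorem regular_smooth {M' : Proposal D T} (hM : M'.Regular) :
    Regular (smoothIngredients 𝓜 θ M') T where
  measurable_prop := hM.measurable
  prop_ne_zero := hM.ne_zero
  prop_ne_top := hM.ne_top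
  lintegral_prop := hM.lintegral
  measurable_wt t ht := by
    have hw : Measurable fun p : StatePath D T × State D × State D × State D => p.2.1 := by
      fun_prop
    have hx : Measurable fun p : StatePath D T × State D × State D × State D => p.2.2.1 := by
      fun_prop
    have hy : Measurable fun p : StatePath D T × State D × State D × State D => p.2.2.2 := by
      fun_prop
    exact hA.measurable_potentialPlus hM ht measurable_fst hw hx hy
  wt_ne_zero t ht u w x y := hA.potentialPlus_ne_zero hM ht u w x y
  wt_ne_top t ht u w x y := hA.potentialPlus_ne_top hM ht u w x y
  measurable_back t h1 hT := by
    have hx : Measurable fun p : StatePath D T × State D × State D × State D × State D =>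
      p.2.1 := by fun_prop
    have hy : Measurable fun p : StatePath D T × State D × State D × State D × State D =>
      p.2.2.1 := by fun_prop
    have hz : Measurable fun p : StatePath D T × State D × State D × State D × State D =>
      p.2.2.2.1 := by fun_prop
    have hz' : Measurable fun p : StatePath D T × State D × State D × State D × State D =>
      p.2.2.2.2 := by fun_prop
    have h1 := hA.measurable_semigroupPlus hM (t := t + 1) (by omega) measurable_fst hx hy hz
    have h2 := hA.measurable_semigroupPlus hM (t := t + 2) (by omega) measurable_fst hy hz hz'
    exact h1.mul h2
  back_factor t h1 hT u z z' := by
    refine ⟨1, one_ne_zero, ENNReal.one_ne_top, fun x y => ?_⟩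
    rw [mul_one]
    rfl

omit hA in
-- The proposal cancels against the denominator of the potential at each time, so the density given
-- `u` is the same for every regular proposal.
theorem massProd_filter {M' : Proposal D T} (hM : M'.Regular) (u x : StatePath D T) :
    massProd (filterIngredients 𝓜 θ M' u) T T (ext x) = 𝓜.gamma x * ∏ i : Fin T,
      gaussPDF (auxMean θ (i + 1) (ext x i) (ext x (i + 1))
        (𝓜.filterGrad (i + 1) (ext x i) (ext x (i + 1)))) (auxCov 𝓜 θ (i + 1) (ext x i)) (u i) := by
  have hterm : ∀ s ∈ Finset.Icc 1 T, mass (filterIngredients 𝓜 θ M' u) T s (ext x (s - 1 - 1))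
      (ext x (s - 1)) (ext x s) = 𝓜.Q s (ext x (s - 1)) (ext x s) *
      gaussPDF (auxMean θ s (ext x (s - 1)) (ext x s) (𝓜.filterGrad s (ext x (s - 1)) (ext x s)))
        (auxCov 𝓜 θ s (ext x (s - 1))) (ext u s) := fun s hs => by
    rw [mass, if_pos (Finset.mem_Icc.1 hs).2]
    exact semigroup_eq hM hs u _ _
  rw [massProd, Finset.prod_congr rfl hterm, Finset.prod_mul_distrib, Model.gamma,
    prod_Icc_one_eq_prod_fin T fun s => gaussPDF _ _ _]
  simp only [Nat.add_sub_cancel, ext_succ]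

omit hA in
-- Each `a s` is cancelled by the denominator of the next factor, which puts `b s` in its place.
-- Only the last `a` survives.
theorem prod_ratio_telescope {a b : ℕ → ℝ≥0∞} {n : ℕ}
    (ha0 : ∀ s ∈ Finset.Icc 1 n, a s ≠ 0) (ha : ∀ s, a s ≠ ∞) :
    ∏ s ∈ Finset.Icc 1 (n + 1), a s * (if 2 ≤ s then b (s - 1) / a (s - 1) else 1) =
      (∏ s ∈ Finset.Icc 1 n, b s) * a (n + 1) := by
  induction n with
  | zero => simp
  | succ n ih =>
    rw [Finset.prod_Icc_succ_top (by omega), ih fun s hs => ha0 s (by simp at hs ⊢; omega),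
      if_pos (by omega), Finset.prod_Icc_succ_top (by omega), Nat.add_sub_cancel, mul_assoc,
      mul_left_comm (a (n + 1)), ENNReal.mul_div_cancel (ha0 _ (by simp)) (ha _)]
    ring

/-- The ratio carried by the weight at time `t + 1` exchanges the filtering density of `u_t` for the
smoothing one. At time `T` no exchange is needed, as the two gradients coincide there. -/
theorem massProd_smooth (hT : 1 ≤ T) {M' : Proposal D T} (hM : M'.Regular)
    (u x : StatePath D T) :
    massProd (smoothIngredients 𝓜 θ M' u) T T (ext x) = 𝓜.gamma x * ∏ i : Fin T,
      gaussPDF (auxMean θ (i + 1) (ext x i) (ext x (i + 1)) (𝓜.smoothGrad x i))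
        (auxCov 𝓜 θ (i + 1) (ext x i)) (u i) := by
  obtain ⟨n, rfl⟩ : ∃ n, T = n + 1 := ⟨T - 1, by omega⟩
  let a : ℕ → ℝ≥0∞ := fun s => gaussPDF (auxMean θ s (ext x (s - 1)) (ext x s)
    (𝓜.filterGrad s (ext x (s - 1)) (ext x s))) (auxCov 𝓜 θ s (ext x (s - 1))) (ext u s)
  let b : ℕ → ℝ≥0∞ := fun s => gaussPDF (auxMean θ s (ext x (s - 1)) (ext x s)
    (𝓜.smoothGradLocal s (ext x (s - 1)) (ext x s) (ext x (s + 1))))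
      (auxCov 𝓜 θ s (ext x (s - 1))) (ext u s)
  have hterm : ∀ s ∈ Finset.Icc 1 (n + 1), mass (smoothIngredients 𝓜 θ M' u) (n + 1) s
      (ext x (s - 1 - 1)) (ext x (s - 1)) (ext x s) = 𝓜.Q s (ext x (s - 1)) (ext x s) *
        (a s * if 2 ≤ s then b (s - 1) / a (s - 1) else 1) := fun s hs => by
    rw [mass, if_pos (Finset.mem_Icc.1 hs).2, ← mul_assoc]
    have h := semigroup_eq (𝓜 := 𝓜) (θ := θ) hM hs u (ext x (s - 1)) (ext x s)
    change M' u s _ _ * (potential 𝓜 θ M' u s _ _ * _) = _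
    rw [← mul_assoc, h]
    congr 1
    split_ifs with h2
    · have : s - 1 + 1 = s := by omega
      simp only [a, b, this]
    · rfl
  have ha0 : ∀ s ∈ Finset.Icc 1 n, a s ≠ 0 := fun s hs =>
    gaussPDF_pos _ _ (hA.posDef_auxCov (by simp at hs ⊢; omega) _)
  rw [massProd, Finset.prod_congr rfl hterm, Finset.prod_mul_distrib,
    prod_ratio_telescope ha0 fun s => gaussPDF_ne_top _ _ _, prod_Icc_one_eq_prod_fin n,
    Fin.prod_univ_castSucc, Model.gamma]
  refine congrArg _ (congrArg₂ _ ?_ ?_)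
  · refine Finset.prod_congr rfl fun i _ => ?_
    rw [hA.smoothGrad_eq_local x i.castSucc (by simp)]
    have : u i.castSucc = ext u (i + 1) := (ext_succ u i.castSucc).symm
    rw [this]
    rfl
  · rw [hA.smoothGrad_eq_filterGrad x (Fin.last n) (by simp)]
    have : u (Fin.last n) = ext u (n + 1) := (ext_succ u (Fin.last n)).symm
    rw [this]
    rfl

theorem filterUpdate_invariant (hT : 1 ≤ T) {N : ℕ} (hN : 1 ≤ N) {M' : Proposal D T}
    (hM : M'.Regular) : InducesInvariantKernel (filterUpdate 𝓜 θ N M') (𝓜.target T) := by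
  have hi := succ_mem_Icc (T := T)
  refine (hA.regular_filter hM).inducesInvariantKernel hT hN (fun i => ?_)
    (fun x i => lintegral_gaussPDF _ (hA.posDef_auxCov (hi i) _)) hA.measurable_gamma
    (massProd_filter hM) _
  have h0 : ∀ t, Measurable fun p : StatePath D T × State D => ext p.1 t := fun t =>
    (measurable_ext T t).comp measurable_fst
  exact hA.measurable_auxDensity (hi i) (h0 _) (h0 _)
    ((hA.measurable_filterGrad (hi i)).comp ((h0 _).prodMk (h0 _))) measurable_snd

theorem smoothUpdate_invariant (hT : 1 ≤ T) {N : ℕ} (hN : 1 ≤ N) {M' : Proposal D T}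
    (hM : M'.Regular) : InducesInvariantKernel (smoothUpdate 𝓜 θ N M') (𝓜.target T) := by
  have hi := succ_mem_Icc (T := T)
  refine (hA.regular_smooth hM).inducesInvariantKernel hT hN (fun i => ?_)
    (fun x i => lintegral_gaussPDF _ (hA.posDef_auxCov (hi i) _)) hA.measurable_gamma
    (hA.massProd_smooth hT hM) _
  have h0 : ∀ t, Measurable fun p : StatePath D T × State D => ext p.1 t := fun t =>
    (measurable_ext T t).comp measurable_fst
  exact hA.measurable_auxDensity (hi i) (h0 _) (h0 _)
    ((hA.measurable_smoothGrad i).comp measurable_fst) measurable_snd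

/-! ### Regularity of the fully-adapted and of the twisted proposals. -/

theorem beta_lt_one {t : ℕ} (ht : t ∈ Finset.Icc 1 T) : 0 < 1 - beta θ t := by
  have := hA.δ_pos t ht
  rw [beta, sub_pos, div_lt_one (by linarith)]
  linarith

theorem regular_adapted : (adapted 𝓜 θ : Proposal D T).Regular where
  measurable t ht := by
    have hx : Measurable fun p : StatePath D T × State D × State D => p.2.1 := by fun_prop
    have hy : Measurable fun p : StatePath D T × State D × State D => p.2.2 := by fun_prop
    have hu : Measurable fun p : StatePath D T × State D × State D => ext p.1 t :=
      (measurable_ext T t).comp measurable_fst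
    have hm := (hA.measurable_m t ht).comp hx
    exact measurable_gaussPDF ((hu.const_smul (beta θ t)).add (hm.const_smul (1 - beta θ t))) hy
      fun i j => ((hA.measurable_C t ht i j).comp hx).const_mul (1 - beta θ t)
  ne_zero t ht u x y :=
    gaussPDF_pos _ _ ((hA.posDef_C t ht x).smul (hA.beta_lt_one ht))
  ne_top t ht u x y := gaussPDF_ne_top _ _ _
  lintegral t ht u x :=
    lintegral_gaussPDF _ ((hA.posDef_C t ht x).smul (hA.beta_lt_one ht))

theorem measurable_futureLik {r t : ℕ} (h : t + r ≤ T) :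
    Measurable fun p : StatePath D T × State D => futureLik 𝓜 θ p.1 r t p.2 := by
  induction r generalizing t with
  | zero => exact measurable_const
  | succ r ih =>
    have ht : t + 1 ∈ Finset.Icc 1 T := by simp; omega
    have hx : Measurable fun q : (StatePath D T × State D) × State D => q.1.2 := by fun_prop
    have hu : Measurable fun q : (StatePath D T × State D) × State D => q.1.1 := by fun_prop
    exact Measurable.lintegral_prod_right' (f := fun q : (StatePath D T × State D) × State D =>
        𝓜.M (t + 1) q.1.2 q.2 * gaussPDF q.2 (auxCov 𝓜 θ (t + 1) q.1.2) (ext q.1.1 (t + 1)) *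
          futureLik 𝓜 θ q.1.1 r (t + 1) q.2)
      (((hA.measurable_M ht hx measurable_snd).mul (measurable_gaussPDF measurable_snd
        ((measurable_ext T (t + 1)).comp hu) (hA.measurable_auxCov ht hx))).mul
        ((ih (by omega)).comp (hu.prodMk measurable_snd)))

theorem measurable_twistedKernel {t : ℕ} (ht : t ∈ Finset.Icc 1 T) :
    Measurable fun q : (StatePath D T × State D) × State D => 𝓜.M t q.1.2 q.2 *
      gaussPDF q.2 (auxCov 𝓜 θ t q.1.2) (ext q.1.1 t) * futureLik 𝓜 θ q.1.1 (T - t) t q.2 := by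
  have hx : Measurable fun q : (StatePath D T × State D) × State D => q.1.2 := by fun_prop
  have hu : Measurable fun q : (StatePath D T × State D) × State D => q.1.1 := by fun_prop
  have := Finset.mem_Icc.1 ht
  exact ((hA.measurable_M ht hx measurable_snd).mul (measurable_gaussPDF measurable_snd
    ((measurable_ext T t).comp hu) (hA.measurable_auxCov ht hx))).mul
      ((hA.measurable_futureLik (by omega)).comp (hu.prodMk measurable_snd))

omit hA in
theorem lintegral_ne_zero_of_forall {f : State D → ℝ≥0∞} (hf : Measurable f)
    (h : ∀ y, f y ≠ 0) : ∫⁻ y, f y ≠ 0 := by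
  rw [Ne, lintegral_eq_zero_iff hf]
  intro h0
  obtain ⟨y, hy⟩ := h0.exists
  exact h y hy

theorem futureLik_ne_zero {r t : ℕ} (h : t + r ≤ T) (u : StatePath D T) (x : State D) :
    futureLik 𝓜 θ u r t x ≠ 0 := by
  induction r generalizing t x with
  | zero => exact one_ne_zero
  | succ r ih =>
    have ht : t + 1 ∈ Finset.Icc 1 T := by simp; omega
    have hM : Measurable fun y => 𝓜.M (t + 1) x y :=
      hA.measurable_M ht measurable_const measurable_id
    have hg : Measurable fun y => gaussPDF y (auxCov 𝓜 θ (t + 1) x) (ext u (t + 1)) :=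
      measurable_gaussPDF measurable_id measurable_const fun i j => measurable_const
    have hf : Measurable fun y => futureLik 𝓜 θ u r (t + 1) y :=
      (hA.measurable_futureLik (t := t + 1) (by omega)).comp (measurable_prodMk_left (x := u))
    refine lintegral_ne_zero_of_forall ((hM.mul hg).mul hf) fun y => ?_
    exact mul_ne_zero (mul_ne_zero (gaussPDF_pos _ _ (hA.posDef_C _ ht x))
      (gaussPDF_pos _ _ (hA.posDef_auxCov ht x))) (ih (by omega) y)

/-- The Gaussian density of the pseudo observation is at most its peak value, and the mutation
density integrates to one. -/
theorem lintegral_M_mul_le {t : ℕ} (ht : t ∈ Finset.Icc 1 T) (u x : State D)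
    {f : State D → ℝ≥0∞} {B : ℝ≥0∞} (hf : ∀ y, f y ≤ B) :
    ∫⁻ y, 𝓜.M t x y * gaussPDF y (auxCov 𝓜 θ t x) u * f y ≤
      ENNReal.ofReal (Real.sqrt ((2 * Real.pi) ^ D * (auxCov 𝓜 θ t x).det))⁻¹ * B := by
  calc ∫⁻ y, 𝓜.M t x y * gaussPDF y (auxCov 𝓜 θ t x) u * f y
      ≤ ∫⁻ y, 𝓜.M t x y *
          (ENNReal.ofReal (Real.sqrt ((2 * Real.pi) ^ D * (auxCov 𝓜 θ t x).det))⁻¹ * B) := by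
        refine lintegral_mono fun y => ?_
        rw [mul_assoc]
        gcongr
        · exact gaussPDF_le _ _ (hA.posDef_auxCov ht x)
        · exact hf y
    _ = _ := by
        have hM : Measurable fun y => 𝓜.M t x y :=
          hA.measurable_M ht measurable_const measurable_id
        rw [lintegral_mul_const _ hM]
        have h1 : ∫⁻ y, 𝓜.M t x y = 1 := lintegral_gaussPDF _ (hA.posDef_C t ht x)
        rw [h1, one_mul]

/-- The peak of the pseudo-observation density depends on the state only through the covariance.
With a constant covariance the bound is uniform in the state, so it survives integration at every
level of the recursion. This makes the normaliser of the twisted proposal finite. -/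
theorem exists_futureLik_le {C : ℕ → Matrix (Fin D) (Fin D) ℝ}
    (hconst : ∀ t ∈ Finset.Icc 1 T, ∀ x, 𝓜.C t x = C t) {r t : ℕ} (h : t + r ≤ T)
    (u : StatePath D T) : ∃ B : ℝ≥0∞, B ≠ ∞ ∧ ∀ x, futureLik 𝓜 θ u r t x ≤ B := by
  induction r generalizing t with
  | zero => exact ⟨1, ENNReal.one_ne_top, fun x => le_rfl⟩
  | succ r ih =>
    have ht : t + 1 ∈ Finset.Icc 1 T := by simp; omega
    obtain ⟨B, hB, hle⟩ := ih (t := t + 1) (by omega)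
    refine ⟨_, ENNReal.mul_ne_top (ENNReal.ofReal_ne_top (r := (Real.sqrt ((2 * Real.pi) ^ D *
      ((θ.δ (t + 1) / 2) • C (t + 1)).det))⁻¹)) hB, fun x => ?_⟩
    rw [← hconst _ ht x]
    exact hA.lintegral_M_mul_le ht _ x hle

theorem twistedKernel_ne_zero {t : ℕ} (ht : t ∈ Finset.Icc 1 T) (u : StatePath D T)
    (x y : State D) : 𝓜.M t x y * gaussPDF y (auxCov 𝓜 θ t x) (ext u t) *
      futureLik 𝓜 θ u (T - t) t y ≠ 0 := by
  have := Finset.mem_Icc.1 ht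
  exact mul_ne_zero (mul_ne_zero (gaussPDF_pos _ _ (hA.posDef_C _ ht x))
    (gaussPDF_pos _ _ (hA.posDef_auxCov ht x))) (hA.futureLik_ne_zero (by omega) u y)

theorem measurable_twistedKernel_right {t : ℕ} (ht : t ∈ Finset.Icc 1 T) (u : StatePath D T)
    (x : State D) : Measurable fun y => 𝓜.M t x y * gaussPDF y (auxCov 𝓜 θ t x) (ext u t) *
      futureLik 𝓜 θ u (T - t) t y :=
  Measurable.comp (f := fun y => ((u, x), y)) (hA.measurable_twistedKernel ht)
    measurable_prodMk_left

theorem lintegral_twistedKernel_ne_zero {t : ℕ} (ht : t ∈ Finset.Icc 1 T) (u : StatePath D T)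
    (x : State D) : (∫⁻ y, 𝓜.M t x y * gaussPDF y (auxCov 𝓜 θ t x) (ext u t) *
      futureLik 𝓜 θ u (T - t) t y) ≠ 0 :=
  lintegral_ne_zero_of_forall (hA.measurable_twistedKernel_right ht u x)
    (hA.twistedKernel_ne_zero ht u x)

theorem lintegral_twistedKernel_ne_top {C : ℕ → Matrix (Fin D) (Fin D) ℝ}
    (hconst : ∀ t ∈ Finset.Icc 1 T, ∀ x, 𝓜.C t x = C t) {t : ℕ} (ht : t ∈ Finset.Icc 1 T)
    (u : StatePath D T) (x : State D) :
    (∫⁻ y, 𝓜.M t x y * gaussPDF y (auxCov 𝓜 θ t x) (ext u t) *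
      futureLik 𝓜 θ u (T - t) t y) ≠ ∞ := by
  have := Finset.mem_Icc.1 ht
  obtain ⟨B, hB, hle⟩ := hA.exists_futureLik_le hconst (r := T - t) (t := t) (by omega) u
  exact ne_top_of_le_ne_top (ENNReal.mul_ne_top ENNReal.ofReal_ne_top hB)
    (hA.lintegral_M_mul_le ht _ x hle)

theorem measurable_twisted {t : ℕ} (ht : t ∈ Finset.Icc 1 T) :
    Measurable fun p : StatePath D T × State D × State D => twisted 𝓜 θ p.1 t p.2.1 p.2.2 := by
  have hk := hA.measurable_twistedKernel ht
  have hZ : Measurable fun q : StatePath D T × State D => ∫⁻ y, 𝓜.M t q.2 y *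
      gaussPDF y (auxCov 𝓜 θ t q.2) (ext q.1 t) * futureLik 𝓜 θ q.1 (T - t) t y :=
    Measurable.lintegral_prod_right' hk
  have h1 : Measurable fun p : StatePath D T × State D × State D => (p.1, p.2.1) := by fun_prop
  have h2 : Measurable fun p : StatePath D T × State D × State D => ((p.1, p.2.1), p.2.2) := by
    fun_prop
  have hn := hk.comp h2
  have hd := hZ.comp h1
  exact hn.div hd

theorem regular_twisted {C : ℕ → Matrix (Fin D) (Fin D) ℝ}
    (hconst : ∀ t ∈ Finset.Icc 1 T, ∀ x, 𝓜.C t x = C t) :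
    (twisted 𝓜 θ : Proposal D T).Regular where
  measurable _ ht := hA.measurable_twisted ht
  ne_zero _ ht u x y := ENNReal.div_ne_zero.2
    ⟨hA.twistedKernel_ne_zero ht u x y, hA.lintegral_twistedKernel_ne_top hconst ht u x⟩
  ne_top t ht u x y := by
    have := Finset.mem_Icc.1 ht
    obtain ⟨B, hB, hle⟩ := hA.exists_futureLik_le hconst (r := T - t) (t := t) (by omega) u
    exact ENNReal.div_ne_top (ENNReal.mul_ne_top (ENNReal.mul_ne_top (gaussPDF_ne_top _ _ _)
      (gaussPDF_ne_top _ _ _)) (ne_top_of_le_ne_top hB (hle y)))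
      (hA.lintegral_twistedKernel_ne_zero ht u x)
  lintegral t ht u x := by
    simp only [twisted, div_eq_mul_inv]
    rw [lintegral_mul_const _ (hA.measurable_twistedKernel_right ht u x)]
    exact ENNReal.mul_inv_cancel (hA.lintegral_twistedKernel_ne_zero ht u x)
      (hA.lintegral_twistedKernel_ne_top hconst ht u x)

end Admissible

end ParticlePCNL

end

open ParticlePCNL in
theorem mainTheorem12 (D T N : ℕ) (hT : 1 ≤ T) (hN : 1 ≤ N)
    (𝓜 : Model D) (θ : Tuning D)
    (hm : ∀ t ∈ Finset.Icc 1 T, Measurable (𝓜.m t))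
    (hC : ∀ t ∈ Finset.Icc 1 T, ∀ i j, Measurable fun x => 𝓜.C t x i j)
    (hCpos : ∀ t ∈ Finset.Icc 1 T, ∀ x, (𝓜.C t x).PosDef)
    (hGpos : ∀ t ∈ Finset.Icc 1 T, ∀ x y, 0 < 𝓜.G t x y)
    (hGdiff : ∀ t ∈ Finset.Icc 1 T,
      Differentiable ℝ fun p : State D × State D => 𝓜.G t p.1 p.2)
    (hZ : (∫⁻ x : StatePath D T, 𝓜.gamma x) ≠ ∞)
    (hδ : ∀ t ∈ Finset.Icc 1 T, 0 < θ.δ t)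
    (hκ : θ.κ = 0 ∨ θ.κ = 1)
    (hpre : ∀ t ∈ Finset.Icc 1 T, ∀ i j, Measurable fun x => θ.pre t x i j) :
    InducesInvariantKernel (aPCNL 𝓜 θ N) (𝓜.target T) ∧
    InducesInvariantKernel (aPCNLPlus 𝓜 θ N) (𝓜.target T) ∧
    ∀ (F : ℕ → Matrix (Fin D) (Fin D) ℝ) (b : ℕ → State D) (C : ℕ → Matrix (Fin D) (Fin D) ℝ),
      (∀ t ∈ Finset.Icc 1 T, ∀ x, 𝓜.m t x = act (F t) x + b t ∧ 𝓜.C t x = C t) →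
      InducesInvariantKernel (twistedAPCNL 𝓜 θ N) (𝓜.target T) ∧
      InducesInvariantKernel (twistedAPCNLPlus 𝓜 θ N) (𝓜.target T) := by
  have hA : Admissible 𝓜 θ T := ⟨hm, hC, hCpos, hGpos, hGdiff, hδ, hpre⟩
  refine ⟨hA.filterUpdate_invariant hT hN hA.regular_adapted,
    hA.smoothUpdate_invariant hT hN hA.regular_adapted, fun F b C hlin => ?_⟩
  have hM := hA.regular_twisted fun t ht x => (hlin t ht x).2
  exact ⟨hA.filterUpdate_invariant hT hN hM, hA.smoothUpdate_invariant hT hN hM⟩
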